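/- Let $n\ge 1$ be an integer, and let $f$ be analytic in an open set $D\subset\mathbb C$ containing $[0,\infty)$, with $f(z)=O(|z|^{n-1-\alpha})$ as $z\to\infty$ in $D$ for some $\alpha>0$. Denote by $$I^{(n)}[f]=\lim_{\epsilon\downarrow0}\Big\{\int_\epsilon^\infty x^{-n}f(x)\,dx-\sum_{k=0}^{n-2}\frac{\epsilon^{k+1-n}}{k!\,(n-1-k)}f^{(k)}(0)+\frac{\log\epsilon}{(n-1)!}f^{(n-1)}(0)\Big\}$$ the Hadamard finite-part integral of $x^{-n}f(x)$ over $[0,\infty)$. Let $C\subset D\setminus[0,\infty)$ be a path $z=\varphi(u)$, $-\infty<u<\infty$, with $|\varphi(u)|\to\infty$ as $u\to\pm\infty$, which encircles $[0,\infty)$ in the positive sense with the enclosed region contained in $D$. (Precisely: for every $A$ there are $u_1\le -A$ and $u_2\ge A$ such that $|\varphi(u_1)|=|\varphi(u_2)|=R$, the polar angle in $(0,2\pi)$ of $\varphi(u_1)$ is smaller than that of $\varphi(u_2)$, the arc of $|z|=R$ running counterclockwise from $\varphi(u_2)$ across the positive real axis to $\varphi(u_1)$ lies in $D$, and the loop formed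 by $\varphi|_{[u_1,u_2]}$ and this arc has winding number $1$ about each point of $[0,R)$ and $0$ about each point of $\mathbb C\setminus D$.) Let $\psi_{\rm DE}(v)=\sinh(\sinh v)$ or $\psi_{\rm DE}(v)=\sinh v$, and for $h>0$ and integers $N'\ge0$ put $$I^{(n)}_{h,N'}[f]=\frac{h}{2\pi i}\sum_{k=-N'}^{N'}\varphi(\psi_{\rm DE}(kh))^{-n}f(\varphi(\psi_{\rm DE}(kh)))\log(-\varphi(\psi_{\rm DE}(kh)))\,\varphi'(\psi_{\rm DE}(kh))\,\psi_{\rm DE}'(kh),$$ with the principal branch of the logarithm. For $d>0$ let $\mathscr D_d=\{w\in\mathbb C:|\operatorname{Im}w|<d\}$ and $\mathscr D_d(\epsilon)=\{w:|\operatorname{Re}w|<1/\epsilon,\ |\operatorname{Im}w|<d(1-\epsilon)\}$. Suppose that 1. $v\mapsto\varphi(\psi_{\rm DE}(v))$ extends from $\mathbb R$ to an analytic function $\Phi$ on $\mathscr D_d$ which maps $\mathscr D_d$ into $\mathbb C\setminus[0,\infty)$, and $f$ is analytic at every point of $\Phi(\mathscr D_d)$; 2. the limit $$\mathscr N=\lim_{\epsilon\downarrow0}\oint_{\partial\mathscr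 D_d(\epsilon)}\big|\Phi(w)^{-n}f(\Phi(w))\log(-\Phi(w))\,\Phi'(w)\big|\,|dw|$$ exists and is finite; 3. there are positive $C_0,c_1,c_2$ such that $|f(\varphi(\psi_{\rm DE}(v)))|\le C_0\exp(-c_1\exp(c_2|v|))$ for all $v\in\mathbb R$. Then the limit defining $I^{(n)}[f]$ exists, and there is a constant $C>0$, independent of $h$ and $N'$, such that for all $h>0$ and all integers $N'\ge0$ $$\big|I^{(n)}[f]-I^{(n)}_{h,N'}[f]\big|\le\frac1{2\pi}\,\mathscr N\,\frac{e^{-2\pi d/h}}{1-e^{-2\pi d/h}}+C\exp\!\big(-c_1\exp(c_2N'h)\big).$$ -/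

import Mathlib

open Filter Topology MeasureTheory Set

noncomputable section

/-- The half line `[0, +∞)` as a subset of the complex plane. -/
def nonnegRay : Set ℂ := {z : ℂ | 0 ≤ z.re ∧ z.im = 0}

/-- The strip `|Im w| < d`. -/
def strip (d : ℝ) : Set ℂ := {w : ℂ | |w.im| < d}

/-- `HasFinitePart n f I`: the Hadamard finite part of `∫₀^∞ x⁻ⁿ f(x) dx` (for `n ≥ 1`) exists
and equals `I`. The finite sum runs over `0 ≤ k ≤ n - 2` and is empty for `n = 1`. -/
def HasFinitePart (n : ℕ) (f : ℂ → ℂ) (I : ℂ) : Prop :=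
  Tendsto
    (fun ε : ℝ =>
      (∫ x in Ioi ε, (x : ℂ) ^ (-(n : ℤ)) * f (x : ℂ))
        - ∑ k ∈ Finset.range (n - 1),
            (ε : ℂ) ^ ((k : ℤ) + 1 - (n : ℤ)) / ((k.factorial : ℂ) * ((n : ℂ) - 1 - (k : ℂ)))
              * iteratedDeriv k f 0
        + (Real.log ε : ℂ) / ((n - 1).factorial : ℂ) * iteratedDeriv (n - 1) f 0)
    (𝓝[>] 0) (𝓝 I)

/-- The circular arc that runs counterclockwise, across the positive real axis, from `φ u₂` to
`φ u₁`, where `φ u₁`, `φ u₂` are off the half line `[0, +∞)` and have the same modulus `R`. The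
polar angle of a point `z` off the half line, taken in `(0, 2π)`, is `arg (-z) + π`. -/
def closingArc (φ : ℝ → ℂ) (u₁ u₂ : ℝ) : Set ℂ :=
  (fun θ : ℝ => (‖φ u₂‖ : ℂ) * Complex.exp (θ * Complex.I)) ''
    Icc (Complex.arg (-φ u₂) + Real.pi) (Complex.arg (-φ u₁) + 3 * Real.pi)

/-- The winding number around `a` of the closed loop formed by the curve `φ` on `[u₁, u₂]` and the
arc `closingArc φ u₁ u₂`, as the integral `(2πi)⁻¹ ∮ dz / (z - a)`. -/
def closedWinding (φ : ℝ → ℂ) (u₁ u₂ : ℝ) (a : ℂ) : ℂ :=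
  (2 * (Real.pi : ℂ) * Complex.I)⁻¹ *
    ((∫ u in u₁..u₂, deriv φ u / (φ u - a))
      + ∫ θ in (Complex.arg (-φ u₂) + Real.pi)..(Complex.arg (-φ u₁) + 3 * Real.pi),
          (‖φ u₂‖ : ℂ) * Complex.exp (θ * Complex.I) * Complex.I
            / ((‖φ u₂‖ : ℂ) * Complex.exp (θ * Complex.I) - a))

/-- The path `z = φ u`, `-∞ < u < +∞`, lies in `D` and encircles `[0, +∞)` in the positive sense,
the enclosed region being contained in `D`: the path avoids `[0, +∞)`, goes to infinity at both
ends, and arbitrarily far out it can be cut off and closed up inside `D` by a circular arc across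
the positive real axis (the starting point having the smaller polar angle), so that the closed
loop winds once around the enclosed part of `[0, +∞)` and does not wind around any point
outside `D`. -/
structure EncirclesRay (D : Set ℂ) (φ : ℝ → ℂ) : Prop where
  mem : ∀ u, φ u ∈ D
  avoids : ∀ u, φ u ∉ nonnegRay
  start_infinity : Tendsto φ atBot (Bornology.cobounded ℂ)
  end_infinity : Tendsto φ atTop (Bornology.cobounded ℂ)
  closes : ∀ A : ℝ, ∃ u₁ u₂ : ℝ, u₁ ≤ -A ∧ A ≤ u₂ ∧ ‖φ u₁‖ = ‖φ u₂‖ ∧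
    Complex.arg (-φ u₁) < Complex.arg (-φ u₂) ∧
    closingArc φ u₁ u₂ ⊆ D ∧
    (∀ x : ℝ, 0 ≤ x → x < ‖φ u₂‖ → closedWinding φ u₁ u₂ (x : ℂ) = 1) ∧
    (∀ a : ℂ, a ∉ D → closedWinding φ u₁ u₂ a = 0)

/-- `ψ` is one of the two double exponential transforms. -/
def IsDETransform (ψ : ℝ → ℝ) : Prop :=
  (ψ = fun v => Real.sinh (Real.sinh v)) ∨ (ψ = fun v => Real.sinh v)

/-- The truncated trapezoidal approximation after the substitution `u = ψ v`, with mesh `h` and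
the sampling points `k h`, `-Nm ≤ k ≤ Np`. -/
def deApprox (n : ℕ) (f : ℂ → ℂ) (φ : ℝ → ℂ) (ψ : ℝ → ℝ) (h : ℝ) (Np Nm : ℕ) : ℂ :=
  (h : ℂ) / (2 * (Real.pi : ℂ) * Complex.I) *
    ∑ k ∈ Finset.Icc (-(Nm : ℤ)) (Np : ℤ),
      (φ (ψ (k * h))) ^ (-(n : ℤ)) * f (φ (ψ (k * h))) * Complex.log (-φ (ψ (k * h)))
        * deriv φ (ψ (k * h)) * ((deriv ψ (k * h) : ℝ) : ℂ)

/-- The transformed integrand on the strip. Here `Φ` stands for `φ ∘ ψ`, so that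
`deriv Φ w = φ' (ψ w) ψ' w`. -/
def transformedIntegrand (n : ℕ) (f : ℂ → ℂ) (Φ : ℂ → ℂ) (w : ℂ) : ℂ :=
  (Φ w) ^ (-(n : ℤ)) * f (Φ w) * Complex.log (-Φ w) * deriv Φ w

/-- `∮ |G(w)| |dw|` over the boundary of the rectangle `|Re w| < a`, `|Im w| < b`. -/
def rectBoundaryIntegral (G : ℂ → ℂ) (a b : ℝ) : ℝ :=
  (∫ x in (-a)..a, ‖G ((x : ℂ) + (b : ℂ) * Complex.I)‖)
    + (∫ x in (-a)..a, ‖G ((x : ℂ) - (b : ℂ) * Complex.I)‖)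
    + (∫ y in (-b)..b, ‖G ((a : ℂ) + (y : ℂ) * Complex.I)‖)
    + (∫ y in (-b)..b, ‖G (-(a : ℂ) + (y : ℂ) * Complex.I)‖)

/-- The boundary norm of `G` on the strip `|Im w| < d` is finite and equals `N`: the integrals of
`|G|` over the boundaries of the rectangles `|Re w| < 1 / ε`, `|Im w| < d (1 - ε)` tend to `N`. -/
def HasBoundaryNorm (G : ℂ → ℂ) (d N : ℝ) : Prop :=
  Tendsto (fun ε : ℝ => rectBoundaryIntegral G (1 / ε) (d * (1 - ε))) (𝓝[>] 0) (𝓝 N)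

end

/-!
The logarithm turns the finite part into a contour integral: with `log (-z)` cut along `[0, +∞)`,
whose jump across the half line is `2πi`,
`I = (2πi)⁻¹ ∫_C z⁻ⁿ f(z) log (-z) dz`.
The substitution `u = ψ v` makes this an integral over the real line of a function `g`, the
`transformedIntegrand`, that is analytic in a strip, and the approximation is the truncated
trapezoidal rule for it.

*Contour representation* (`exists_hasFinitePart_eq_integral`). Cut the path far out and close it up
by an arc. Split `z⁻ⁿ f(z)` into its polar part at `0` and a function `F` holomorphic on `D`
(`exists_taylor_remainder`). For the polar part, explicit primitives of `z⁻ᵐ log (-z)` give the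
integral along the loop (`ClosedUpPath.integral_zpow_mul_log`). For `F`, move the branch point: the
integral of `F(z) log (t - z)` along the loop is continuous in `t ≥ 0`, has derivative `-2πi F(t)`
while `t` is inside the loop, and vanishes once `t` is outside. The last two facts are Cauchy's
formula and theorem for a loop known only through its winding numbers; they are proved, after Dixon,
in `integral_div_eq_mul_index` and `integral_eq_zero_of_index`. The growth condition on `f` makes
the arcs negligible (`norm_integral_arc_le`).

*Decay.* A branch of the logarithm with imaginary part in `(-π, π)` on a strip has bounded
derivative on the real line, by the Cauchy estimate for the bounded function `exp (i log (-Φ))`.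
Hence `|g v| ≤ K (1 + |v|) |f(Φ v)|` (`exists_bound_transformedIntegrand`), and the double
exponential decay of `f` along the path passes to the tails of the trapezoidal sums
(`exists_tail_bound`); the factor `1 + |v|` costs nothing there.

*Discretization error* (`norm_integral_sub_sum_le`). The kernel `1 / (1 - e^{-2πiw/h})` has its poles
at the sampling points, and is within `e^{-2πb/h} / (1 - e^{-2πb/h})` of `0` on `Im w = b` and of `1`
on `Im w = -b`. The finite sum minus the integral is therefore an integral over the boundary of a
rectangle whose vertical sides run midway between sampling points. On these sides the kernel
contributes `e^{-2π|y|/h}`, which is small only for large `|y|`; for the other `y` one uses that `g`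
tends to `0` at infinity inside the strip. Here `g` is bounded on smaller strips, by Cauchy's formula
on the rectangles that define the boundary norm, with a kernel periodic in the width of the rectangle
(`exists_bound_substrip`), and the decay on the real line spreads by the three lines theorem
(`eventually_norm_le_of_three_lines`).
-/

/-! ### Cauchy's theorem for cycles that do not wind around the complement of the domain -/

section Homology

variable {X : Type*} [MeasurableSpace X] {μ : Measure X} {γ ρ : X → ℂ} {K D : Set ℂ}

theorem ContinuousOn.aestronglyMeasurable_comp_of_ae_mem {F : ℂ → ℂ} (hD : IsOpen D)
    (hF : ContinuousOn F D) (hγ : AEStronglyMeasurable γ μ) (hγD : ∀ᵐ x ∂μ, γ x ∈ D) :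
    AEStronglyMeasurable (fun x => F (γ x)) μ := by
  have h1 : (Measure.map γ μ).restrict D = Measure.map γ μ :=
    Measure.restrict_eq_self_of_ae_mem
      ((ae_map_iff hγ.aemeasurable hD.measurableSet).2 hγD)
  have h2 : AEStronglyMeasurable F (Measure.map γ μ) := by
    rw [← h1]; exact hF.aestronglyMeasurable hD.measurableSet
  exact h2.comp_aemeasurable hγ.aemeasurable

theorem integrable_comp_mul_weight {F : ℂ → ℂ} (hD : IsOpen D) (hK : IsCompact K) (hKD : K ⊆ D)
    (hF : ContinuousOn F D) (hγ : AEStronglyMeasurable γ μ) (hγK : ∀ᵐ x ∂μ, γ x ∈ K)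
    (hρ : Integrable ρ μ) : Integrable (fun x => F (γ x) * ρ x) μ := by
  obtain ⟨M, hM⟩ := hK.exists_bound_of_continuousOn (hF.mono hKD)
  refine hρ.bdd_mul (c := M)
    (hF.aestronglyMeasurable_comp_of_ae_mem hD hγ (hγK.mono fun x hx => hKD hx)) ?_
  filter_upwards [hγK] with x hx using hM _ hx

theorem integrable_cauchyKernel (hK : IsClosed K) (hγ : AEStronglyMeasurable γ μ)
    (hγK : ∀ᵐ x ∂μ, γ x ∈ K) (hρ : Integrable ρ μ) {a : ℂ} (ha : a ∉ K) :
    Integrable (fun x => ρ x / (γ x - a)) μ := by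
  obtain ⟨ε, hε, hball⟩ := Metric.isOpen_iff.1 hK.isOpen_compl a ha
  have hm : AEStronglyMeasurable (fun x => (γ x - a)⁻¹) μ :=
    (hγ.sub aestronglyMeasurable_const).aemeasurable.inv.aestronglyMeasurable
  have : Integrable (fun x => (γ x - a)⁻¹ * ρ x) μ := by
    refine hρ.bdd_mul (c := ε⁻¹) hm ?_
    filter_upwards [hγK] with x hx
    have : ε ≤ ‖γ x - a‖ := by
      by_contra! h
      exact hball (by simpa [dist_eq_norm] using h) hx
    rw [norm_inv]
    exact inv_anti₀ hε this
  simpa [div_eq_mul_inv, mul_comm] using this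

/-- The Cauchy transform of an integrable weight is holomorphic off the support of the path. -/
theorem hasDerivAt_cauchyTransform (hK : IsClosed K) (hγ : AEStronglyMeasurable γ μ)
    (hγK : ∀ᵐ x ∂μ, γ x ∈ K) (hρ : Integrable ρ μ) {a : ℂ} (ha : a ∉ K) :
    HasDerivAt (fun a => ∫ x, ρ x / (γ x - a) ∂μ) (∫ x, ρ x / (γ x - a) ^ 2 ∂μ) a := by
  obtain ⟨ε, hε, hball⟩ := Metric.isOpen_iff.1 hK.isOpen_compl a ha
  have hfar : ∀ᵐ x ∂μ, ∀ b ∈ Metric.ball a (ε / 2), ε / 2 ≤ ‖γ x - b‖ := by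
    filter_upwards [hγK] with x hx b hb
    by_contra! h
    refine hball ?_ hx
    rw [Metric.mem_ball] at hb ⊢
    calc dist (γ x) a ≤ dist (γ x) b + dist b a := dist_triangle _ _ _
      _ < ε := by rw [dist_eq_norm (γ x)]; linarith
  refine (hasDerivAt_integral_of_dominated_loc_of_deriv_le
    (F := fun a x => ρ x / (γ x - a)) (F' := fun a x => ρ x / (γ x - a) ^ 2)
    (bound := fun x => ‖ρ x‖ * ((ε / 2) ^ 2)⁻¹)
    (Metric.ball_mem_nhds a (half_pos hε)) ?_ ?_ ?_ ?_ ?_ ?_).2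
  · filter_upwards [hK.isOpen_compl.mem_nhds ha] with b hb
    exact (integrable_cauchyKernel hK hγ hγK hρ hb).1
  · exact integrable_cauchyKernel hK hγ hγK hρ ha
  · exact (hρ.1.aemeasurable.div
      ((hγ.sub aestronglyMeasurable_const).aemeasurable.pow_const 2)).aestronglyMeasurable
  · filter_upwards [hfar] with x hx b hb
    rw [norm_div, norm_pow, div_eq_mul_inv]
    have := hx b hb
    gcongr
  · exact hρ.norm.mul_const _
  · filter_upwards [hfar] with x hx b hb
    have h0 : γ x - b ≠ 0 := by
      intro h; have := hx b hb; rw [h, norm_zero] at this; linarith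
    have h1 : HasDerivAt (fun b => γ x - b) (-1) b := by
      simpa using (hasDerivAt_id b).const_sub (γ x)
    have := (h1.inv h0).const_mul (ρ x)
    convert! this using 1
    simp [div_eq_mul_inv]

theorem tendsto_cauchyTransform_zero (hK : Bornology.IsBounded K)
    (hγK : ∀ᵐ x ∂μ, γ x ∈ K) (hρ : Integrable ρ μ) :
    Tendsto (fun a => ∫ x, ρ x / (γ x - a) ∂μ) (Bornology.cobounded ℂ) (𝓝 0) := by
  obtain ⟨M, hM⟩ := hK.exists_norm_le
  have hb : ∀ᶠ a in Bornology.cobounded ℂ,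
      ‖∫ x, ρ x / (γ x - a) ∂μ‖ ≤ (∫ x, ‖ρ x‖ ∂μ) / (‖a‖ - M) := by
    filter_upwards [tendsto_norm_cobounded_atTop.eventually_gt_atTop M] with a ha
    rw [← integral_div]
    refine norm_integral_le_of_norm_le (hρ.norm.div_const _) ?_
    filter_upwards [hγK] with x hx
    rw [norm_div]
    have h1 : ‖a‖ - M ≤ ‖γ x - a‖ := by
      have := norm_sub_norm_le a (γ x)
      rw [norm_sub_rev] at this
      linarith [hM _ hx]
    have : 0 < ‖a‖ - M := sub_pos.2 ha
    gcongr
  refine squeeze_zero_norm' hb ?_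
  exact tendsto_const_nhds.div_atTop
    (tendsto_atTop_add_const_right _ (-M) tendsto_norm_cobounded_atTop)

theorem dslope_comm_right (g : ℂ → ℂ) (z w : ℂ) : dslope g z w = dslope g w z := by
  rcases eq_or_ne w z with rfl | h
  · rfl
  · rw [dslope_of_ne _ h, dslope_of_ne _ h.symm, slope_comm]

/-- The difference quotients `(g w - g z) / (w - z)` are bounded uniformly for `z` in a compact set
and `w` in a small disc; near the diagonal this is the maximum principle. -/
theorem exists_bound_dslope {g : ℂ → ℂ} (hg : DifferentiableOn ℂ g D) (hD : IsOpen D)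
    (hK : IsCompact K) (hKD : K ⊆ D) {w₀ : ℂ} {r : ℝ} (hr : 0 < r)
    (hball : Metric.closedBall w₀ (3 * r) ⊆ D) :
    ∃ M, ∀ z ∈ K, ∀ w ∈ Metric.closedBall w₀ r, ‖dslope g z w‖ ≤ M := by
  obtain ⟨M, hM⟩ := (hK.union (isCompact_closedBall w₀ (3 * r))).exists_bound_of_continuousOn
    (hg.continuousOn.mono (union_subset hKD hball))
  -- away from the diagonal the bound is immediate; `3 * r` is chosen so that the circle of this radius
  -- is at distance at least `r` from every `z` with `|z - w₀| ≤ 2 * r`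
  have hfar : ∀ z ∈ K, ∀ w ∈ Metric.closedBall w₀ (3 * r), r ≤ ‖w - z‖ →
      ‖dslope g z w‖ ≤ r⁻¹ * (M + M) := by
    intro z hz w hw h
    have hne : w ≠ z := by
      rintro rfl; simp at h; linarith
    rw [dslope_of_ne _ hne, slope_def_module, norm_smul, norm_inv]
    have := (norm_sub_le (g w) (g z)).trans
      (add_le_add (hM w (Or.inr hw)) (hM z (Or.inl hz)))
    gcongr
  refine ⟨r⁻¹ * (M + M), fun z hz w hw => ?_⟩
  rw [Metric.mem_closedBall] at hw
  rcases le_or_gt (dist z w₀) (2 * r) with h | h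
  · have hd : DiffContOnCl ℂ (dslope g z) (Metric.ball w₀ (3 * r)) := by
      apply DifferentiableOn.diffContOnCl
      rw [closure_ball _ (by positivity)]
      exact ((Complex.differentiableOn_dslope (hD.mem_nhds (hKD hz))).2 hg).mono hball
    refine Complex.norm_le_of_forall_mem_frontier_norm_le Metric.isBounded_ball hd ?_
      (subset_closure (Metric.mem_ball.2 (by linarith)))
    intro w' hw'
    rw [frontier_ball _ (by positivity), mem_sphere_iff_norm] at hw'
    refine hfar z hz w' (by rw [mem_closedBall_iff_norm]; exact hw'.le) ?_
    have := norm_sub_norm_le (w' - w₀) (z - w₀)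
    rw [dist_eq_norm] at h
    rw [sub_sub_sub_cancel_right] at this
    linarith
  · refine hfar z hz w (Metric.mem_closedBall.2 (by linarith)) ?_
    have := norm_sub_norm_le (z - w₀) (w - w₀)
    rw [dist_eq_norm] at h hw
    rw [sub_sub_sub_cancel_right, norm_sub_rev z w] at this
    linarith

/-- Differentiability, at the points of the domain, of the auxiliary function in Dixon's proof of
Cauchy's theorem. -/
theorem differentiableAt_integral_dslope {g : ℂ → ℂ} (hg : DifferentiableOn ℂ g D) (hD : IsOpen D)
    (hK : IsCompact K) (hKD : K ⊆ D) (hγ : AEStronglyMeasurable γ μ)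
    (hγK : ∀ᵐ x ∂μ, γ x ∈ K) (hρ : Integrable ρ μ) {w₀ : ℂ} (hw₀ : w₀ ∈ D) :
    DifferentiableAt ℂ (fun w => ∫ x, dslope g w (γ x) * ρ x ∂μ) w₀ := by
  obtain ⟨ε, hε, hball⟩ := Metric.isOpen_iff.1 hD w₀ hw₀
  obtain ⟨r, hr, hr3⟩ : ∃ r > 0, 3 * r < ε := ⟨ε / 4, by positivity, by linarith⟩
  have hcb : Metric.closedBall w₀ (3 * r) ⊆ D :=
    (Metric.closedBall_subset_ball hr3).trans hball
  obtain ⟨M, hM⟩ := exists_bound_dslope hg hD hK hKD hr hcb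
  have hcont : ∀ w ∈ D, ContinuousOn (dslope g w) D := fun w hw =>
    ((Complex.differentiableOn_dslope (hD.mem_nhds hw)).2 hg).continuousOn
  have hint : ∀ w ∈ D, Integrable (fun x => dslope g w (γ x) * ρ x) μ := fun w hw =>
    integrable_comp_mul_weight hD hK hKD (hcont w hw) hγ hγK hρ
  have hd : ∀ z ∈ K, DifferentiableOn ℂ (dslope g z) D := fun z hz =>
    (Complex.differentiableOn_dslope (hD.mem_nhds (hKD hz))).2 hg
  have hwD : ∀ w ∈ Metric.ball w₀ (r / 2), w ∈ D := fun w hw =>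
    hcb (Metric.ball_subset_closedBall (Metric.ball_subset_ball (by linarith) hw))
  have hderiv : ∀ᵐ x ∂μ, ∀ w ∈ Metric.ball w₀ (r / 2),
      HasDerivAt (fun w => dslope g w (γ x) * ρ x) (deriv (dslope g (γ x)) w * ρ x) w := by
    filter_upwards [hγK] with x hx w hw
    simp_rw [← dslope_comm_right g (γ x)]
    exact (((hd _ hx).differentiableAt (hD.mem_nhds (hwD w hw))).hasDerivAt).mul_const _
  refine (hasDerivAt_integral_of_dominated_loc_of_deriv_le
    (F := fun w x => dslope g w (γ x) * ρ x)
    (F' := fun w x => deriv (dslope g (γ x)) w * ρ x)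
    (bound := fun x => M / (r / 2) * ‖ρ x‖)
    (Metric.ball_mem_nhds w₀ (half_pos hr)) ?_ ?_ ?_ ?_ ?_ hderiv).2.differentiableAt
  · filter_upwards [hD.mem_nhds hw₀] with w hw using (hint w hw).1
  · exact hint w₀ hw₀
  · -- the derivative is measurable as a pointwise limit of difference quotients
    have hu : Tendsto (fun n : ℕ => w₀ + ((r / 3 / (n + 1) : ℝ) : ℂ)) atTop (𝓝[≠] w₀) := by
      rw [tendsto_nhdsWithin_iff]
      constructor
      · have h1 : Tendsto (fun n : ℕ => ((r / 3 / (n + 1) : ℝ) : ℂ)) atTop (𝓝 0) := by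
          rw [← Complex.ofReal_zero]
          exact (Complex.continuous_ofReal.tendsto 0).comp
            (tendsto_const_nhds.div_atTop (tendsto_atTop_add_const_right _ _
              tendsto_natCast_atTop_atTop))
        simpa using h1.const_add w₀
      · refine Eventually.of_forall fun n => ?_
        have : (r / 3 / (n + 1) : ℝ) ≠ 0 := by positivity
        simpa only [mem_compl_iff, mem_singleton_iff, add_eq_left, Complex.ofReal_eq_zero] using this
    refine aestronglyMeasurable_of_tendsto_ae atTop
      (f := fun (n : ℕ) x => slope (fun w => dslope g w (γ x) * ρ x) w₀
        (w₀ + ((r / 3 / (n + 1) : ℝ) : ℂ))) (fun n => ?_) ?_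
    · simp only [slope_def_module]
      refine AEStronglyMeasurable.fun_const_smul (((hint _ (hwD _ ?_)).1).fun_sub (hint _ hw₀).1) _
      have h2 : r / 3 / ((n : ℝ) + 1) ≤ r / 3 :=
        div_le_self (by positivity) (by linarith [n.cast_nonneg (α := ℝ)])
      have h3 : 0 ≤ r / 3 / ((n : ℝ) + 1) := by positivity
      rw [Metric.mem_ball, dist_eq_norm, add_sub_cancel_left, Complex.norm_real,
        Real.norm_of_nonneg h3]
      linarith
    · filter_upwards [hderiv] with x hx
      exact (hasDerivAt_iff_tendsto_slope.1
        (hx w₀ (Metric.mem_ball_self (half_pos hr)))).comp hu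
  · filter_upwards [hγK] with x hx w hw
    rw [norm_mul]
    refine mul_le_mul_of_nonneg_right ?_ (norm_nonneg _)
    have hsub : Metric.closedBall w (r / 2) ⊆ Metric.closedBall w₀ r := by
      refine Metric.closedBall_subset_closedBall' ?_
      rw [Metric.mem_ball] at hw; linarith
    refine Complex.norm_deriv_le_of_forall_mem_sphere_norm_le (half_pos hr) ?_
      fun z hz => hM _ hx z (hsub (Metric.sphere_subset_closedBall hz))
    apply DifferentiableOn.diffContOnCl
    rw [closure_ball _ (by positivity)]
    exact (hd _ hx).mono ((hsub.trans (Metric.closedBall_subset_closedBall (by linarith))).trans hcb)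
  · exact hρ.norm.const_mul _

/-- **Cauchy's integral formula**, homology version, for the functional `F ↦ ∫ F(γ) ρ dμ`: if its
index function `W(a) = ∫ ρ / (γ - a) dμ` vanishes near every point outside `D` and near infinity,
then `∫ g(γ) ρ / (γ - w) dμ = g(w) W(w)`. The proof is Dixon's: the integral of the difference
quotient of `g` extends to an entire function that vanishes at infinity. -/
theorem integral_div_eq_mul_index {g : ℂ → ℂ} (hg : DifferentiableOn ℂ g D) (hD : IsOpen D)
    (hK : IsCompact K) (hKD : K ⊆ D) (hγ : AEStronglyMeasurable γ μ)
    (hγK : ∀ᵐ x ∂μ, γ x ∈ K) (hρ : Integrable ρ μ)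
    (hout : ∀ a ∉ D, ∀ᶠ b in 𝓝 a, ∫ x, ρ x / (γ x - b) ∂μ = 0)
    (hinf : ∀ᶠ b in Bornology.cobounded ℂ, ∫ x, ρ x / (γ x - b) ∂μ = 0)
    {w : ℂ} (hwD : w ∈ D) (hwK : w ∉ K) :
    ∫ x, g (γ x) * ρ x / (γ x - w) ∂μ = g w * ∫ x, ρ x / (γ x - w) ∂μ := by
  classical
  -- extended by zero, `g` has difference quotients with the right behaviour outside `D` as well
  set G : ℂ → ℂ := D.indicator g with hGdef
  have hG : DifferentiableOn ℂ G D := hg.congr fun z hz => by simp [hGdef, hz]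
  have hgρ : Integrable (fun x => g (γ x) * ρ x) μ :=
    integrable_comp_mul_weight hD hK hKD hg.continuousOn hγ hγK hρ
  set h : ℂ → ℂ := fun w => ∫ x, dslope G w (γ x) * ρ x ∂μ with hh
  have hform : ∀ w ∉ K, h w = (∫ x, g (γ x) * ρ x / (γ x - w) ∂μ)
      - G w * ∫ x, ρ x / (γ x - w) ∂μ := by
    intro w hw
    rw [hh, ← integral_const_mul, ← integral_sub (integrable_cauchyKernel hK.isClosed hγ hγK hgρ hw)
      ((integrable_cauchyKernel hK.isClosed hγ hγK hρ hw).const_mul _)]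
    refine integral_congr_ae ?_
    filter_upwards [hγK] with x hx
    have hne : γ x ≠ w := fun h => hw (h ▸ hx)
    have : G (γ x) = g (γ x) := by simp [hGdef, hKD hx]
    rw [dslope_of_ne _ hne, slope_def_field, this]
    ring
  have hGh : ∀ w ∉ K, (∫ x, ρ x / (γ x - w) ∂μ) = 0 →
      h w = ∫ x, g (γ x) * ρ x / (γ x - w) ∂μ := fun w hw h0 => by rw [hform w hw, h0]; simp
  -- at a point outside `D`, `h` is locally a Cauchy transform, since the index vanishes there
  have hdiff : Differentiable ℂ h := by
    intro w₀
    by_cases hw₀ : w₀ ∈ D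
    · exact differentiableAt_integral_dslope hG hD hK hKD hγ hγK hρ hw₀
    · have hw₀K : w₀ ∉ K := fun hmem => hw₀ (hKD hmem)
      refine (hasDerivAt_cauchyTransform hK.isClosed hγ hγK hgρ
        hw₀K).differentiableAt.congr_of_eventuallyEq ?_
      filter_upwards [hout w₀ hw₀, hK.isClosed.isOpen_compl.mem_nhds hw₀K] with b hb hbK
      exact hGh b hbK hb
  have hlim : Tendsto h (cocompact ℂ) (𝓝 0) := by
    rw [← Metric.cobounded_eq_cocompact]
    refine (tendsto_cauchyTransform_zero hK.isBounded hγK hgρ).congr' ?_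
    filter_upwards [hinf, Bornology.isBounded_def.1 hK.isBounded] with b hb hbK
    exact (hGh b hbK hb).symm
  have h0 := hdiff.apply_eq_of_tendsto_cocompact w hlim
  rw [hform w hwK, sub_eq_zero] at h0
  simpa [hGdef, hwD] using h0

/-- **Cauchy's theorem**, homology version. -/
theorem integral_eq_zero_of_index {g : ℂ → ℂ} (hg : DifferentiableOn ℂ g D) (hD : IsOpen D)
    (hK : IsCompact K) (hKD : K ⊆ D) (hγ : AEStronglyMeasurable γ μ)
    (hγK : ∀ᵐ x ∂μ, γ x ∈ K) (hρ : Integrable ρ μ)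
    (hout : ∀ a ∉ D, ∀ᶠ b in 𝓝 a, ∫ x, ρ x / (γ x - b) ∂μ = 0)
    (hinf : ∀ᶠ b in Bornology.cobounded ℂ, ∫ x, ρ x / (γ x - b) ∂μ = 0)
    {w : ℂ} (hwD : w ∈ D) (hwK : w ∉ K) :
    ∫ x, g (γ x) * ρ x ∂μ = 0 := by
  have := integral_div_eq_mul_index (g := fun z => g z * (z - w))
    (hg.mul (differentiableOn_id.sub_const w)) hD hK hKD hγ hγK hρ hout hinf hwD hwK
  simp only [sub_self, mul_zero, zero_mul] at this
  rw [← this]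
  refine integral_congr_ae ?_
  filter_upwards [hγK] with x hx
  have hne : γ x - w ≠ 0 := sub_ne_zero.2 fun h => hwK (h ▸ hx)
  field_simp

/-- If the index function is locally constant off `K`, then it vanishes at `w` as soon as the ray
from `w` away from the origin avoids `K`. -/
theorem index_eq_zero_of_ray (hK : IsCompact K) (hγ : AEStronglyMeasurable γ μ)
    (hγK : ∀ᵐ x ∂μ, γ x ∈ K) (hρ : Integrable ρ μ)
    (hconst : ∀ a ∉ K, ∫ x, ρ x / (γ x - a) ^ 2 ∂μ = 0) {w : ℂ} (hw : w ≠ 0)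
    (hray : ∀ t : ℝ, 1 ≤ t → (t : ℂ) * w ∉ K) : ∫ x, ρ x / (γ x - w) ∂μ = 0 := by
  set W : ℂ → ℂ := fun a => ∫ x, ρ x / (γ x - a) ∂μ with hW
  have hder : ∀ t : ℝ, 1 ≤ t → HasDerivAt (fun t : ℝ => W (t * w)) 0 t := by
    intro t ht
    have h1 := hasDerivAt_cauchyTransform hK.isClosed hγ hγK hρ (hray t ht)
    rw [hconst _ (hray t ht)] at h1
    have h2 : HasDerivAt (fun t : ℝ => (t : ℂ) * w) (1 * w) t :=
      (HasDerivAt.ofReal_comp (hasDerivAt_id t)).mul_const w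
    simpa [hW, Function.comp_def] using h1.comp t h2
  have hc : ∀ t : ℝ, 1 ≤ t → W (t * w) = W w := by
    intro t ht
    have := constant_of_has_deriv_right_zero (f := fun t : ℝ => W (t * w)) (a := 1) (b := t)
      (fun s hs => (hder s hs.1).continuousAt.continuousWithinAt)
      (fun s hs => (hder s hs.1).hasDerivWithinAt) t (right_mem_Icc.2 ht)
    simpa using this
  have hlim : Tendsto (fun t : ℝ => W (t * w)) atTop (𝓝 0) := by
    refine (tendsto_cauchyTransform_zero hK.isBounded hγK hρ).comp ?_
    rw [← tendsto_norm_atTop_iff_cobounded]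
    simp only [norm_mul, Complex.norm_real]
    exact tendsto_norm_atTop_atTop.atTop_mul_const (norm_pos_iff.2 hw)
  refine tendsto_nhds_unique (tendsto_const_nhds.congr' ?_) hlim
  filter_upwards [eventually_ge_atTop 1] with t ht using (hc t ht).symm

theorem index_eventually_eq_zero_cobounded (hK : IsCompact K) (hγ : AEStronglyMeasurable γ μ)
    (hγK : ∀ᵐ x ∂μ, γ x ∈ K) (hρ : Integrable ρ μ)
    (hconst : ∀ a ∉ K, ∫ x, ρ x / (γ x - a) ^ 2 ∂μ = 0) :
    ∀ᶠ b in Bornology.cobounded ℂ, ∫ x, ρ x / (γ x - b) ∂μ = 0 := by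
  obtain ⟨M, hM0, hM⟩ := hK.isBounded.exists_pos_norm_le
  filter_upwards [tendsto_norm_cobounded_atTop.eventually_gt_atTop M] with w hw
  refine index_eq_zero_of_ray hK hγ hγK hρ hconst (norm_pos_iff.1 (hM0.trans hw))
    fun t ht hmem => ?_
  have := hM _ hmem
  rw [norm_mul, Complex.norm_real, Real.norm_of_nonneg (by linarith)] at this
  nlinarith [norm_nonneg w]

theorem index_eventually_eq_zero (hK : IsCompact K) (hγ : AEStronglyMeasurable γ μ)
    (hγK : ∀ᵐ x ∂μ, γ x ∈ K) (hρ : Integrable ρ μ)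
    (hconst : ∀ a ∉ K, ∫ x, ρ x / (γ x - a) ^ 2 ∂μ = 0) {a : ℂ} (ha : a ∉ K)
    (h0 : ∫ x, ρ x / (γ x - a) ∂μ = 0) : ∀ᶠ b in 𝓝 a, ∫ x, ρ x / (γ x - b) ∂μ = 0 := by
  obtain ⟨ε, hε, hball⟩ := Metric.isOpen_iff.1 hK.isClosed.isOpen_compl a ha
  have hder : ∀ b ∈ Metric.ball a ε, HasDerivAt (fun a => ∫ x, ρ x / (γ x - a) ∂μ) 0 b := by
    intro b hb
    have h1 := hasDerivAt_cauchyTransform hK.isClosed hγ hγK hρ (hball hb)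
    rwa [hconst _ (hball hb)] at h1
  filter_upwards [Metric.ball_mem_nhds a hε] with b hb
  rw [← h0]
  refine (convex_ball a ε).is_const_of_fderivWithin_eq_zero (𝕜 := ℂ)
    (fun c hc => (hder c hc).differentiableAt.differentiableWithinAt) (fun c hc => ?_) hb
    (Metric.mem_ball_self hε)
  rw [fderivWithin_of_isOpen Metric.isOpen_ball hc]
  ext
  simp [(hder c hc).deriv]

end Homology

/-! ### The path closed up by a circular arc -/

theorem sub_mem_slitPlane_of_notMem_nonnegRay {z : ℂ} (hz : z ∉ nonnegRay) {t : ℝ} (ht : 0 ≤ t) :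
    (t : ℂ) - z ∈ Complex.slitPlane := by
  rw [Complex.mem_slitPlane_iff]
  by_cases h : z.im = 0
  · left
    have : ¬ 0 ≤ z.re := fun h' => hz ⟨h', h⟩
    simp; linarith
  · right; simpa using h

theorem neg_mem_slitPlane_of_notMem_nonnegRay {z : ℂ} (hz : z ∉ nonnegRay) :
    -z ∈ Complex.slitPlane := by
  simpa using sub_mem_slitPlane_of_notMem_nonnegRay hz le_rfl

theorem isClosed_nonnegRay : IsClosed nonnegRay :=
  (isClosed_le continuous_const Complex.continuous_re).inter
    (isClosed_eq Complex.continuous_im continuous_const)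

theorem ofReal_mem_nonnegRay {x : ℝ} (hx : 0 ≤ x) : (x : ℂ) ∈ nonnegRay := by
  simp [nonnegRay, hx]

/-- The point of polar coordinates `R`, `θ`. -/
noncomputable def polarPt (R θ : ℝ) : ℂ := (R : ℂ) * Complex.exp (θ * Complex.I)

theorem norm_polarPt {R : ℝ} (hR : 0 ≤ R) (θ : ℝ) : ‖polarPt R θ‖ = R := by
  simp [polarPt, Complex.norm_exp_ofReal_mul_I, abs_of_nonneg hR]

theorem hasDerivAt_polarPt (R θ : ℝ) :
    HasDerivAt (polarPt R) (polarPt R θ * Complex.I) θ := by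
  have h1 : HasDerivAt (fun θ : ℝ => (θ : ℂ) * Complex.I) Complex.I θ := by
    simpa using (HasDerivAt.ofReal_comp (hasDerivAt_id θ)).mul_const Complex.I
  have := (h1.cexp).const_mul (R : ℂ)
  simpa only [polarPt, mul_assoc] using! this

theorem continuous_polarPt (R : ℝ) : Continuous (polarPt R) := by
  unfold polarPt; fun_prop

theorem polarPt_re (R θ : ℝ) : (polarPt R θ).re = R * Real.cos θ := by
  simp [polarPt, Complex.exp_ofReal_mul_I_re]

theorem polarPt_im (R θ : ℝ) : (polarPt R θ).im = R * Real.sin θ := by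
  simp [polarPt, Complex.exp_ofReal_mul_I_im]

/-- The curve `p` on `[v₁, v₂]`, off the half line `[0, +∞)`, starts and ends on the circle
`|z| = R`, at the polar angles `θ₃` and `θ₂` respectively; the arc of that circle from `θ₂` to `θ₃`
closes it up and crosses the positive real axis once, at the angle `2π`. -/
structure ClosedUpPath (p p' : ℝ → ℂ) (v₁ v₂ R θ₂ θ₃ : ℝ) : Prop where
  hasDerivAt : ∀ v, HasDerivAt p (p' v) v
  continuous_deriv : Continuous p'
  le : v₁ ≤ v₂
  R_pos : 0 < R
  start_eq : p v₁ = polarPt R θ₃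
  end_eq : p v₂ = polarPt R θ₂
  angle_pos : 0 < θ₂
  angle_lt : θ₂ < 2 * Real.pi
  lt_angle : 2 * Real.pi < θ₃
  angle_lt' : θ₃ < 4 * Real.pi
  avoids : ∀ v, p v ∉ nonnegRay

/-- The concatenation of the curve `p` up to the parameter `v₂` and of the circular arc that starts
at the polar angle `θ₂`. -/
noncomputable def loopCurve (p : ℝ → ℂ) (v₂ R θ₂ : ℝ) (x : ℝ) : ℂ :=
  if x ≤ v₂ then p x else polarPt R (x + (θ₂ - v₂))

/-- The derivative of `loopCurve`. -/
noncomputable def loopWeight (p' : ℝ → ℂ) (v₂ R θ₂ : ℝ) (x : ℝ) : ℂ :=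
  if x ≤ v₂ then p' x else polarPt R (x + (θ₂ - v₂)) * Complex.I

/-- Lebesgue measure on the parameter interval of the closed loop. -/
noncomputable def loopMeasure (v₁ v₂ θ₂ θ₃ : ℝ) : Measure ℝ :=
  volume.restrict (Ioc v₁ (θ₃ - (θ₂ - v₂)))

/-- The trace of the closed loop. -/
def loopTrace (p : ℝ → ℂ) (v₁ v₂ R θ₂ θ₃ : ℝ) : Set ℂ :=
  p '' Icc v₁ v₂ ∪ polarPt R '' Icc θ₂ θ₃

namespace ClosedUpPath

variable {p p' : ℝ → ℂ} {v₁ v₂ R θ₂ θ₃ : ℝ} (H : ClosedUpPath p p' v₁ v₂ R θ₂ θ₃)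
include H

theorem continuous : Continuous p :=
  continuous_iff_continuousAt.2 fun v => (H.hasDerivAt v).continuousAt

theorem angle_le : θ₂ ≤ θ₃ := (H.angle_lt.trans H.lt_angle).le

theorem isCompact_trace : IsCompact (loopTrace p v₁ v₂ R θ₂ θ₃) :=
  (isCompact_Icc.image H.continuous).union (isCompact_Icc.image (continuous_polarPt R))

theorem measurable_curve : Measurable (loopCurve p v₂ R θ₂) :=
  Measurable.ite measurableSet_Iic H.continuous.measurable
    ((continuous_polarPt R).comp (by fun_prop)).measurable

theorem measurable_weight : Measurable (loopWeight p' v₂ R θ₂) :=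
  Measurable.ite measurableSet_Iic H.continuous_deriv.measurable
    (((continuous_polarPt R).comp (by fun_prop)).mul continuous_const).measurable

omit H in
theorem ae_mem_trace :
    ∀ᵐ x ∂(loopMeasure v₁ v₂ θ₂ θ₃), loopCurve p v₂ R θ₂ x ∈ loopTrace p v₁ v₂ R θ₂ θ₃ := by
  refine (ae_restrict_iff' measurableSet_Ioc).2 (Eventually.of_forall fun x hx => ?_)
  unfold loopCurve
  split_ifs with h
  · exact Or.inl ⟨x, ⟨hx.1.le, h⟩, rfl⟩
  · exact Or.inr ⟨_, ⟨by linarith, by linarith [hx.2]⟩, rfl⟩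

theorem exists_bound_weight : ∃ C, ∀ᵐ x ∂(loopMeasure v₁ v₂ θ₂ θ₃), ‖loopWeight p' v₂ R θ₂ x‖ ≤ C := by
  obtain ⟨C, hC⟩ := (isCompact_Icc (a := v₁) (b := v₂)).exists_bound_of_continuousOn
    H.continuous_deriv.continuousOn
  refine ⟨max C R, (ae_restrict_iff' measurableSet_Ioc).2 (Eventually.of_forall fun x hx => ?_)⟩
  unfold loopWeight
  split_ifs with h
  · exact (hC x ⟨hx.1.le, h⟩).trans (le_max_left _ _)
  · rw [norm_mul, norm_polarPt H.R_pos.le, Complex.norm_I, mul_one]; exact le_max_right _ _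

theorem integrable_weight : Integrable (loopWeight p' v₂ R θ₂) (loopMeasure v₁ v₂ θ₂ θ₃) := by
  obtain ⟨C, hC⟩ := H.exists_bound_weight
  have : IsFiniteMeasure (loopMeasure v₁ v₂ θ₂ θ₃) := by unfold loopMeasure; infer_instance
  exact Integrable.of_bound H.measurable_weight.aestronglyMeasurable C hC

/-- Integrals along the loop are the sum of an integral along `p` and an integral along the arc. -/
theorem integral_loop {E : ℂ → ℂ → ℂ}
    (hE : Integrable (fun x => E (loopCurve p v₂ R θ₂ x) (loopWeight p' v₂ R θ₂ x))
      (loopMeasure v₁ v₂ θ₂ θ₃)) :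
    ∫ x, E (loopCurve p v₂ R θ₂ x) (loopWeight p' v₂ R θ₂ x) ∂(loopMeasure v₁ v₂ θ₂ θ₃) =
      (∫ v in v₁..v₂, E (p v) (p' v))
        + ∫ θ in θ₂..θ₃, E (polarPt R θ) (polarPt R θ * Complex.I) := by
  have hle : v₂ ≤ θ₃ - (θ₂ - v₂) := by linarith [H.angle_le]
  have hle1 := H.le
  unfold loopMeasure at hE ⊢
  rw [← intervalIntegral.integral_of_le (hle1.trans hle)]
  have hi : IntervalIntegrable (fun x => E (loopCurve p v₂ R θ₂ x) (loopWeight p' v₂ R θ₂ x))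
      volume v₁ (θ₃ - (θ₂ - v₂)) :=
    (intervalIntegrable_iff_integrableOn_Ioc_of_le (hle1.trans hle)).2 hE
  rw [← intervalIntegral.integral_add_adjacent_intervals (b := v₂)
    (hi.mono_set (by rw [uIcc_of_le hle1, uIcc_of_le (hle1.trans hle)]
                     exact Icc_subset_Icc_right hle))
    (hi.mono_set (by rw [uIcc_of_le hle, uIcc_of_le (hle1.trans hle)]
                     exact Icc_subset_Icc_left hle1))]
  congr 1
  · refine intervalIntegral.integral_congr_ae (Eventually.of_forall fun x hx => ?_)
    rw [uIoc_of_le hle1] at hx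
    simp [loopCurve, loopWeight, hx.2]
  · have h2 : ∫ θ in θ₂..θ₃, E (polarPt R θ) (polarPt R θ * Complex.I) =
        ∫ x in v₂..(θ₃ - (θ₂ - v₂)), E (polarPt R (x + (θ₂ - v₂)))
          (polarPt R (x + (θ₂ - v₂)) * Complex.I) := by
      rw [intervalIntegral.integral_comp_add_right
        (fun θ => E (polarPt R θ) (polarPt R θ * Complex.I))]
      congr 1 <;> ring
    rw [h2]
    refine intervalIntegral.integral_congr_ae (Eventually.of_forall fun x hx => ?_)
    rw [uIoc_of_le hle] at hx
    simp [loopCurve, loopWeight, hx.1.not_ge]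

theorem integral_weight_div_sq {a : ℂ} (ha : a ∉ loopTrace p v₁ v₂ R θ₂ θ₃) :
    ∫ x, loopWeight p' v₂ R θ₂ x / (loopCurve p v₂ R θ₂ x - a) ^ 2 ∂(loopMeasure v₁ v₂ θ₂ θ₃)
      = 0 := by
  have hcl := H.isCompact_trace.isClosed
  have hint : Integrable (fun x => loopWeight p' v₂ R θ₂ x / (loopCurve p v₂ R θ₂ x - a) ^ 2)
      (loopMeasure v₁ v₂ θ₂ θ₃) := by
    have := integrable_cauchyKernel hcl H.measurable_curve.aestronglyMeasurable
      ae_mem_trace (integrable_cauchyKernel hcl H.measurable_curve.aestronglyMeasurable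
        ae_mem_trace H.integrable_weight ha) ha
    refine this.congr (Eventually.of_forall fun x => ?_)
    simp only [pow_two, div_div]
  rw [H.integral_loop (E := fun z r => r / (z - a) ^ 2) hint]
  have hp0 : ∀ v ∈ uIcc v₁ v₂, p v - a ≠ 0 := fun v hv h =>
    ha (Or.inl ⟨v, by rwa [uIcc_of_le H.le] at hv, sub_eq_zero.1 h⟩)
  have hq0 : ∀ θ ∈ uIcc θ₂ θ₃, polarPt R θ - a ≠ 0 := fun θ hθ h =>
    ha (Or.inr ⟨θ, by rwa [uIcc_of_le H.angle_le] at hθ, sub_eq_zero.1 h⟩)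
  have h1 : ∫ v in v₁..v₂, p' v / (p v - a) ^ 2 = -(p v₂ - a)⁻¹ - -(p v₁ - a)⁻¹ := by
    refine intervalIntegral.integral_eq_sub_of_hasDerivAt (f := fun v => -(p v - a)⁻¹)
      (fun v hv => ?_) (ContinuousOn.intervalIntegrable ?_)
    · have := (((H.hasDerivAt v).sub_const a).inv (hp0 v hv)).neg
      convert! this using 1
      ring
    · exact H.continuous_deriv.continuousOn.div
        ((H.continuous.sub continuous_const).pow 2).continuousOn
        fun θ hθ => pow_ne_zero 2 (hp0 θ hθ)
  have h2 : ∫ θ in θ₂..θ₃, polarPt R θ * Complex.I / (polarPt R θ - a) ^ 2 =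
      -(polarPt R θ₃ - a)⁻¹ - -(polarPt R θ₂ - a)⁻¹ := by
    refine intervalIntegral.integral_eq_sub_of_hasDerivAt (f := fun θ => -(polarPt R θ - a)⁻¹)
      (fun v hv => ?_) (ContinuousOn.intervalIntegrable ?_)
    · have := (((hasDerivAt_polarPt R v).sub_const a).inv (hq0 v hv)).neg
      convert! this using 1
      ring
    · exact ((continuous_polarPt R).mul continuous_const).continuousOn.div
        (((continuous_polarPt R).sub continuous_const).pow 2).continuousOn
        fun θ hθ => pow_ne_zero 2 (hq0 θ hθ)
  rw [h1, h2, H.start_eq, H.end_eq]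
  ring

theorem integral_weight_div {a : ℂ} (ha : a ∉ loopTrace p v₁ v₂ R θ₂ θ₃) :
    ∫ x, loopWeight p' v₂ R θ₂ x / (loopCurve p v₂ R θ₂ x - a) ∂(loopMeasure v₁ v₂ θ₂ θ₃)
      = (∫ v in v₁..v₂, p' v / (p v - a))
        + ∫ θ in θ₂..θ₃, polarPt R θ * Complex.I / (polarPt R θ - a) :=
  H.integral_loop (E := fun z r => r / (z - a)) (integrable_cauchyKernel H.isCompact_trace.isClosed
    H.measurable_curve.aestronglyMeasurable ae_mem_trace H.integrable_weight ha)

theorem ofReal_notMem_trace {x : ℝ} (hx : 0 ≤ x) (hxR : x ≠ R) :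
    (x : ℂ) ∉ loopTrace p v₁ v₂ R θ₂ θ₃ := by
  rintro (⟨v, -, hv⟩ | ⟨θ, -, hθ⟩)
  · exact H.avoids v (hv ▸ ofReal_mem_nonnegRay hx)
  · have := norm_polarPt H.R_pos.le θ
    rw [hθ, Complex.norm_real, Real.norm_of_nonneg hx] at this
    exact hxR this

theorem index_eq_zero_of_gt {x : ℝ} (hx : R < x) :
    ∫ y, loopWeight p' v₂ R θ₂ y / (loopCurve p v₂ R θ₂ y - x) ∂(loopMeasure v₁ v₂ θ₂ θ₃) = 0 := by
  have hx0 : 0 < x := H.R_pos.trans hx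
  refine index_eq_zero_of_ray H.isCompact_trace H.measurable_curve.aestronglyMeasurable
    ae_mem_trace H.integrable_weight (fun a ha => H.integral_weight_div_sq ha)
    (by exact_mod_cast hx0.ne') fun t ht => ?_
  have h1 : x ≤ t * x := by nlinarith
  exact_mod_cast H.ofReal_notMem_trace (x := t * x) (by linarith) (by linarith)

end ClosedUpPath

/-! ### Moving the branch point of the logarithm -/

theorem norm_clog_le_of_norm_mem_Icc {z : ℂ} {y B : ℝ} (hy : 0 < y) (hyz : y ≤ ‖z‖) (hzB : ‖z‖ ≤ B) :
    ‖Complex.log z‖ ≤ |Real.log y| + |Real.log B| + Real.pi := by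
  have h1 : |Real.log ‖z‖| ≤ |Real.log y| + |Real.log B| :=
    (abs_le_max_abs_abs (Real.log_le_log hy hyz) (Real.log_le_log (hy.trans_le hyz) hzB)).trans
      (max_le_add_of_nonneg (abs_nonneg _) (abs_nonneg _))
  calc ‖Complex.log z‖ ≤ |(Complex.log z).re| + |(Complex.log z).im| :=
        Complex.norm_le_abs_re_add_abs_im _
    _ ≤ _ := by
        rw [Complex.log_re, Complex.log_im]
        exact add_le_add h1 (Complex.abs_arg_le_pi z)

namespace ClosedUpPath

variable {p p' : ℝ → ℂ} {v₁ v₂ R θ₂ θ₃ : ℝ} (H : ClosedUpPath p p' v₁ v₂ R θ₂ θ₃)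
include H

omit H in
theorem ae_sin_ne_zero_or :
    ∀ᵐ x ∂(loopMeasure v₁ v₂ θ₂ θ₃), x ≤ v₂ ∨ Real.sin (x + (θ₂ - v₂)) ≠ 0 := by
  have hc : {x : ℝ | Real.sin (x + (θ₂ - v₂)) = 0}.Countable := by
    refine (countable_range fun n : ℤ => (n : ℝ) * Real.pi - (θ₂ - v₂)).mono ?_
    intro x hx
    obtain ⟨n, hn⟩ := Real.sin_eq_zero_iff.1 hx
    exact ⟨n, by simp only; linarith⟩
  refine ae_restrict_of_ae ?_
  filter_upwards [hc.ae_notMem volume] with x hx using Or.inr hx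

theorem ae_notMem_nonnegRay :
    ∀ᵐ x ∂(loopMeasure v₁ v₂ θ₂ θ₃), loopCurve p v₂ R θ₂ x ∉ nonnegRay := by
  filter_upwards [ae_sin_ne_zero_or] with x hx
  unfold loopCurve
  split_ifs with h
  · exact H.avoids x
  · rintro ⟨-, h2⟩
    rw [polarPt_im] at h2
    exact (mul_ne_zero H.R_pos.ne' (hx.resolve_left h)) h2

/-- An integrable majorant, uniform in the branch point `t`, of `log (t - z)` along the loop: on the
arc, `|t - z|` is at least `|Im z|`, whose logarithm is integrable. -/
theorem exists_integrable_bound_log : ∃ b : ℝ → ℝ, Integrable b (loopMeasure v₁ v₂ θ₂ θ₃) ∧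
    ∀ t ∈ Icc (0 : ℝ) (R + 1), ∀ᵐ x ∂(loopMeasure v₁ v₂ θ₂ θ₃),
      ‖Complex.log ((t : ℂ) - loopCurve p v₂ R θ₂ x)‖ ≤ b x := by
  have hR := H.R_pos
  obtain ⟨δ, hδ, hdist⟩ : ∃ δ > 0, ∀ v ∈ Icc v₁ v₂, ∀ t : ℝ, 0 ≤ t → δ ≤ ‖(t : ℂ) - p v‖ := by
    obtain ⟨δ, hδ, hd⟩ := Metric.exists_pos_forall_lt_edist
      (isCompact_Icc.image H.continuous : IsCompact (p '' Icc v₁ v₂)) isClosed_nonnegRay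
      (by rw [disjoint_left]; rintro _ ⟨v, -, rfl⟩; exact H.avoids v)
    refine ⟨δ, hδ, fun v hv t ht => ?_⟩
    have := hd _ ⟨v, hv, rfl⟩ _ (ofReal_mem_nonnegRay ht)
    rw [edist_comm, edist_nndist, ENNReal.coe_lt_coe, ← NNReal.coe_lt_coe, coe_nndist,
      dist_eq_norm] at this
    exact this.le
  obtain ⟨M, hM0, hM⟩ := H.isCompact_trace.isBounded.exists_pos_norm_le
  set B := R + 1 + M
  set c := Real.pi + |Real.log B|
  refine ⟨fun x => (|Real.log δ| + |Real.log R| + c) + |Real.log (Real.sin (x + (θ₂ - v₂)))|,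
    ?_, fun t ht => ?_⟩
  · have : IsFiniteMeasure (loopMeasure v₁ v₂ θ₂ θ₃) := by unfold loopMeasure; infer_instance
    refine (integrable_const _).add (Integrable.abs ?_)
    unfold loopMeasure
    have hle : v₁ ≤ θ₃ - (θ₂ - v₂) := by linarith [H.angle_le, H.le]
    have := (intervalIntegrable_log_sin (a := v₁ + (θ₂ - v₂)) (b := θ₃)).comp_add_right (θ₂ - v₂)
    rw [add_sub_cancel_right] at this
    exact (intervalIntegrable_iff_integrableOn_Ioc_of_le hle).1 this
  · filter_upwards [ae_sin_ne_zero_or,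
      (ae_mem_trace : ∀ᵐ x ∂(loopMeasure v₁ v₂ θ₂ θ₃), _ ∈ loopTrace p v₁ v₂ R θ₂ θ₃),
      ae_restrict_mem measurableSet_Ioc] with x hx hxK hxI
    have hub : ‖(t : ℂ) - loopCurve p v₂ R θ₂ x‖ ≤ B := by
      refine (norm_sub_le _ _).trans (add_le_add ?_ (hM _ hxK))
      rw [Complex.norm_real, Real.norm_of_nonneg ht.1]; exact ht.2
    by_cases h : x ≤ v₂
    · have hlb : δ ≤ ‖(t : ℂ) - loopCurve p v₂ R θ₂ x‖ := by
        simp only [loopCurve, h, if_true]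
        exact hdist x ⟨hxI.1.le, h⟩ t ht.1
      have := norm_clog_le_of_norm_mem_Icc hδ hlb hub
      have h2 := abs_nonneg (Real.log R)
      have h3 := abs_nonneg (Real.log (Real.sin (x + (θ₂ - v₂))))
      simp only [c]
      linarith
    · have hs := hx.resolve_left h
      have hy : 0 < R * |Real.sin (x + (θ₂ - v₂))| := mul_pos hR (abs_pos.2 hs)
      have hlb : R * |Real.sin (x + (θ₂ - v₂))| ≤ ‖(t : ℂ) - loopCurve p v₂ R θ₂ x‖ := by
        simp only [loopCurve, h, if_false]
        refine le_trans (le_of_eq ?_) (Complex.abs_im_le_norm _)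
        rw [Complex.sub_im, polarPt_im, Complex.ofReal_im, zero_sub, abs_neg, abs_mul,
          abs_of_pos hR]
      have h1 := norm_clog_le_of_norm_mem_Icc hy hlb hub
      rw [Real.log_mul hR.ne' (abs_pos.2 hs).ne', Real.log_abs] at h1
      have h2 := abs_add_le (Real.log R) (Real.log (Real.sin (x + (θ₂ - v₂))))
      have h3 := abs_nonneg (Real.log δ)
      simp only [c]
      linarith

variable {D : Set ℂ} {F : ℂ → ℂ}

theorem integrable_mul_log (hD : IsOpen D) (hF : DifferentiableOn ℂ F D)
    (hKD : loopTrace p v₁ v₂ R θ₂ θ₃ ⊆ D) : ∃ b : ℝ → ℝ, Integrable b (loopMeasure v₁ v₂ θ₂ θ₃) ∧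
    ∀ t ∈ Icc (0 : ℝ) (R + 1), AEStronglyMeasurable (fun x => F (loopCurve p v₂ R θ₂ x) *
        Complex.log ((t : ℂ) - loopCurve p v₂ R θ₂ x) * loopWeight p' v₂ R θ₂ x)
        (loopMeasure v₁ v₂ θ₂ θ₃) ∧ ∀ᵐ x ∂(loopMeasure v₁ v₂ θ₂ θ₃),
      ‖F (loopCurve p v₂ R θ₂ x) * Complex.log ((t : ℂ) - loopCurve p v₂ R θ₂ x) *
        loopWeight p' v₂ R θ₂ x‖ ≤ b x := by
  obtain ⟨b, hb, hbl⟩ := H.exists_integrable_bound_log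
  obtain ⟨C, hC⟩ := H.exists_bound_weight
  obtain ⟨M, hM⟩ := H.isCompact_trace.exists_bound_of_continuousOn (hF.continuousOn.mono hKD)
  refine ⟨fun x => M * b x * C, (hb.const_mul M).mul_const C, fun t ht => ⟨?_, ?_⟩⟩
  · refine (AEStronglyMeasurable.mul ?_ ?_).mul H.measurable_weight.aestronglyMeasurable
    · exact hF.continuousOn.aestronglyMeasurable_comp_of_ae_mem hD
        H.measurable_curve.aestronglyMeasurable (ae_mem_trace.mono fun x hx => hKD hx)
    · exact (Complex.measurable_log.comp (measurable_const.sub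
        H.measurable_curve)).aestronglyMeasurable
  · filter_upwards [hbl t ht, hC,
      (ae_mem_trace : ∀ᵐ x ∂(loopMeasure v₁ v₂ θ₂ θ₃), _ ∈ loopTrace p v₁ v₂ R θ₂ θ₃)] with x h1 h2 h3
    rw [norm_mul, norm_mul]
    have h4 := hM _ h3
    have h5 : 0 ≤ M := (norm_nonneg _).trans h4
    have h6 : 0 ≤ b x := (norm_nonneg _).trans h1
    gcongr

/-- The integral of `F(z) log (t - z)` along the loop has derivative `-2πi F(t)` in the branch point
`t` as long as `t` is inside. -/
theorem hasDerivAt_integral_mul_log (hD : IsOpen D) (hF : DifferentiableOn ℂ F D)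
    (hKD : loopTrace p v₁ v₂ R θ₂ θ₃ ⊆ D) {t : ℝ} (ht : t ∈ Ioo 0 R) :
    HasDerivAt (fun t : ℝ => ∫ x, F (loopCurve p v₂ R θ₂ x) *
        Complex.log ((t : ℂ) - loopCurve p v₂ R θ₂ x) * loopWeight p' v₂ R θ₂ x
        ∂(loopMeasure v₁ v₂ θ₂ θ₃))
      (-∫ x, F (loopCurve p v₂ R θ₂ x) * loopWeight p' v₂ R θ₂ x / (loopCurve p v₂ R θ₂ x - t)
        ∂(loopMeasure v₁ v₂ θ₂ θ₃)) t := by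
  obtain ⟨b, hb, hbl⟩ := H.integrable_mul_log hD hF hKD
  have hcl := H.isCompact_trace.isClosed
  have htK := H.ofReal_notMem_trace ht.1.le ht.2.ne
  obtain ⟨ε, hε, hball⟩ := Metric.isOpen_iff.1 hcl.isOpen_compl _ htK
  have hFρ : Integrable (fun x => F (loopCurve p v₂ R θ₂ x) * loopWeight p' v₂ R θ₂ x)
      (loopMeasure v₁ v₂ θ₂ θ₃) :=
    integrable_comp_mul_weight hD H.isCompact_trace hKD hF.continuousOn
      H.measurable_curve.aestronglyMeasurable ae_mem_trace H.integrable_weight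
  rw [← integral_neg]
  have hs : Ioo 0 R ∩ Metric.ball t (ε / 2) ∈ 𝓝 t :=
    inter_mem (Ioo_mem_nhds ht.1 ht.2) (Metric.ball_mem_nhds t (half_pos hε))
  refine (hasDerivAt_integral_of_dominated_loc_of_deriv_le
    (F := fun (t : ℝ) x => F (loopCurve p v₂ R θ₂ x) *
        Complex.log ((t : ℂ) - loopCurve p v₂ R θ₂ x) * loopWeight p' v₂ R θ₂ x)
    (F' := fun (t : ℝ) x => -(F (loopCurve p v₂ R θ₂ x) * loopWeight p' v₂ R θ₂ x /
      (loopCurve p v₂ R θ₂ x - t)))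
    (bound := fun x => ‖F (loopCurve p v₂ R θ₂ x) * loopWeight p' v₂ R θ₂ x‖ * (ε / 2)⁻¹)
    hs ?_ ?_ ?_ ?_ ?_ ?_).2
  · filter_upwards [Ioo_mem_nhds ht.1 ht.2] with s hs
    exact (hbl s ⟨hs.1.le, by linarith [hs.2]⟩).1
  · obtain ⟨h1, h2⟩ := hbl t ⟨ht.1.le, by linarith [ht.2]⟩
    exact hb.mono' h1 h2
  · exact (integrable_cauchyKernel hcl H.measurable_curve.aestronglyMeasurable ae_mem_trace
      hFρ htK).1.neg
  · filter_upwards [(ae_mem_trace : ∀ᵐ x ∂(loopMeasure v₁ v₂ θ₂ θ₃),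
      _ ∈ loopTrace p v₁ v₂ R θ₂ θ₃)] with x hx s hs
    rw [norm_neg, norm_div, div_eq_mul_inv]
    gcongr
    by_contra! h
    refine hball ?_ hx
    have h1 : ‖(s : ℂ) - t‖ < ε / 2 := by
      rw [← Complex.ofReal_sub, Complex.norm_real]; simpa [dist_eq_norm] using hs.2
    rw [Metric.mem_ball, dist_eq_norm]
    calc _ = ‖(loopCurve p v₂ R θ₂ x - s) + (s - t)‖ := by congr 1; ring
      _ ≤ _ := norm_add_le _ _
      _ < ε := by linarith
  · exact hFρ.norm.mul_const _
  · filter_upwards [H.ae_notMem_nonnegRay, (ae_mem_trace : ∀ᵐ x ∂(loopMeasure v₁ v₂ θ₂ θ₃),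
      _ ∈ loopTrace p v₁ v₂ R θ₂ θ₃)] with x hx hxK s hs
    have hsl := sub_mem_slitPlane_of_notMem_nonnegRay hx hs.1.1.le
    have h1 : HasDerivAt (fun s : ℝ => (s : ℂ) - loopCurve p v₂ R θ₂ x) 1 s :=
      (HasDerivAt.ofReal_comp (hasDerivAt_id s)).sub_const _
    have h2 := ((h1.clog_real hsl).const_mul (F (loopCurve p v₂ R θ₂ x))).mul_const
      (loopWeight p' v₂ R θ₂ x)
    convert! h2 using 1
    rw [← neg_sub (s : ℂ), div_neg, neg_neg]
    ring

/-- With the branch point `t` outside the loop, `F(z) log (t - z)` is holomorphic on `D` without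
`[t, +∞)`, and the loop does not wind around that half line either. -/
theorem integral_mul_log_eq_zero_of_gt (hD : IsOpen D) (hF : DifferentiableOn ℂ F D)
    (hKD : loopTrace p v₁ v₂ R θ₂ θ₃ ⊆ D) (h0D : (0 : ℂ) ∈ D)
    (hout : ∀ a ∉ D, ∫ x, loopWeight p' v₂ R θ₂ x / (loopCurve p v₂ R θ₂ x - a)
      ∂(loopMeasure v₁ v₂ θ₂ θ₃) = 0) {t : ℝ} (ht : R < t) :
    ∫ x, F (loopCurve p v₂ R θ₂ x) *
        Complex.log ((t : ℂ) - loopCurve p v₂ R θ₂ x) * loopWeight p' v₂ R θ₂ x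
        ∂(loopMeasure v₁ v₂ θ₂ θ₃) = 0 := by
  have hR := H.R_pos
  have hconst := fun a (ha : a ∉ loopTrace p v₁ v₂ R θ₂ θ₃) => H.integral_weight_div_sq ha
  have hmeas := H.measurable_curve.aestronglyMeasurable (μ := loopMeasure v₁ v₂ θ₂ θ₃)
  have hopen : IsOpen (D ∩ {z | (t : ℂ) - z ∈ Complex.slitPlane}) :=
    hD.inter (Complex.isOpen_slitPlane.preimage (continuous_const.sub continuous_id))
  have hK0 : (0 : ℂ) ∉ loopTrace p v₁ v₂ R θ₂ θ₃ := by
    exact_mod_cast H.ofReal_notMem_trace le_rfl hR.ne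
  have hK' : loopTrace p v₁ v₂ R θ₂ θ₃ ⊆ D ∩ {z | (t : ℂ) - z ∈ Complex.slitPlane} := by
    intro z hz
    refine ⟨hKD hz, ?_⟩
    rcases hz with ⟨v, -, rfl⟩ | ⟨θ, -, rfl⟩
    · exact sub_mem_slitPlane_of_notMem_nonnegRay (H.avoids v) (hR.trans ht).le
    · refine Or.inl ?_
      rw [Complex.sub_re, polarPt_re, Complex.ofReal_re]
      nlinarith [Real.cos_le_one θ]
  refine integral_eq_zero_of_index (g := fun z => F z * Complex.log (t - z)) ?_ hopen
    H.isCompact_trace hK' hmeas ae_mem_trace H.integrable_weight ?_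
    (index_eventually_eq_zero_cobounded H.isCompact_trace hmeas ae_mem_trace
      H.integrable_weight hconst) (w := 0) ⟨h0D, by simpa using hR.trans ht⟩ hK0
  · refine (hF.mono inter_subset_left).mul fun z hz => ?_
    exact (((differentiableAt_const _).sub differentiableAt_id).clog hz.2).differentiableWithinAt
  · intro a ha
    have key : a ∉ loopTrace p v₁ v₂ R θ₂ θ₃ := fun h => ha (hK' h)
    refine index_eventually_eq_zero H.isCompact_trace hmeas ae_mem_trace
      H.integrable_weight hconst key ?_
    by_cases haD : a ∈ D
    · have hsl : (t : ℂ) - a ∉ Complex.slitPlane := fun h => ha ⟨haD, h⟩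
      rw [Complex.mem_slitPlane_iff, not_or, not_lt, not_ne_iff] at hsl
      simp only [Complex.sub_re, Complex.ofReal_re, Complex.sub_im, Complex.ofReal_im,
        zero_sub, neg_eq_zero] at hsl
      have : a = (a.re : ℂ) := Complex.ext (by simp) (by simpa using hsl.2)
      rw [this]
      exact H.index_eq_zero_of_gt (by linarith [hsl.1])
    · exact hout a haD

/-- For `F` holomorphic on a domain in which the loop bounds, the integral of `F(z) log (-z)` along
the loop only sees the jump of the logarithm across the enclosed segment `[0, R]`. -/
theorem integral_mul_log (hD : IsOpen D) (hF : DifferentiableOn ℂ F D)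
    (hKD : loopTrace p v₁ v₂ R θ₂ θ₃ ⊆ D) (hray : nonnegRay ⊆ D)
    (hin : ∀ x : ℝ, 0 ≤ x → x < R → ∫ y, loopWeight p' v₂ R θ₂ y / (loopCurve p v₂ R θ₂ y - x)
      ∂(loopMeasure v₁ v₂ θ₂ θ₃) = 2 * Real.pi * Complex.I)
    (hout : ∀ a ∉ D, ∫ x, loopWeight p' v₂ R θ₂ x / (loopCurve p v₂ R θ₂ x - a)
      ∂(loopMeasure v₁ v₂ θ₂ θ₃) = 0) :
    (∫ v in v₁..v₂, F (p v) * Complex.log (-p v) * p' v)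
      + (∫ θ in θ₂..θ₃, F (polarPt R θ) * Complex.log (-polarPt R θ)
          * (polarPt R θ * Complex.I)) =
      2 * Real.pi * Complex.I * ∫ x in (0 : ℝ)..R, F x := by
  have hR := H.R_pos
  obtain ⟨b, hb, hbl⟩ := H.integrable_mul_log hD hF hKD
  have hmeas := H.measurable_curve.aestronglyMeasurable (μ := loopMeasure v₁ v₂ θ₂ θ₃)
  have hconst := fun a (ha : a ∉ loopTrace p v₁ v₂ R θ₂ θ₃) => H.integral_weight_div_sq ha
  set A : ℝ → ℂ := fun t => ∫ x, F (loopCurve p v₂ R θ₂ x) *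
        Complex.log ((t : ℂ) - loopCurve p v₂ R θ₂ x) * loopWeight p' v₂ R θ₂ x
        ∂(loopMeasure v₁ v₂ θ₂ θ₃) with hA
  have hcont : ContinuousOn A (Icc 0 (R + 1)) := by
    refine continuousOn_of_dominated (fun t ht => (hbl t ht).1) (fun t ht => (hbl t ht).2) hb ?_
    filter_upwards [H.ae_notMem_nonnegRay] with x hx t ht
    have hsl := sub_mem_slitPlane_of_notMem_nonnegRay hx ht.1
    have h1 : ContinuousAt (fun s : ℝ => (s : ℂ) - loopCurve p v₂ R θ₂ x) t := by fun_prop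
    exact ((continuousAt_const.mul (h1.clog hsl)).mul continuousAt_const).continuousWithinAt
  -- the loop passes through `R`; the value there is reached by continuity from outside
  have hAR : A R = 0 := by
    have h1 : Tendsto A (𝓝[Ioc R (R + 1)] R) (𝓝 (A R)) :=
      (hcont R ⟨hR.le, by linarith⟩).mono fun x hx => ⟨hR.le.trans hx.1.le, hx.2⟩
    rw [nhdsWithin_Ioc_eq_nhdsGT (by linarith)] at h1
    refine tendsto_nhds_unique h1 (tendsto_const_nhds.congr' ?_)
    filter_upwards [self_mem_nhdsWithin] with t ht
    exact (H.integral_mul_log_eq_zero_of_gt hD hF hKD (hray ⟨by simp, by simp⟩) hout ht).symm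
  have hFc : ContinuousOn (fun x : ℝ => F x) (uIcc 0 R) := by
    refine hF.continuousOn.comp Complex.continuous_ofReal.continuousOn fun x hx => ?_
    rw [uIcc_of_le hR.le] at hx
    exact hray (ofReal_mem_nonnegRay hx.1)
  have hFTC : ∫ t in (0 : ℝ)..R, -(F t * (2 * Real.pi * Complex.I)) = A R - A 0 := by
    refine intervalIntegral.integral_eq_sub_of_hasDerivAt_of_le hR.le
      (hcont.mono (Icc_subset_Icc_right (by linarith))) (fun t ht => ?_)
      (hFc.mul continuousOn_const).neg.intervalIntegrable
    have htK := H.ofReal_notMem_trace ht.1.le ht.2.ne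
    have h1 := H.hasDerivAt_integral_mul_log hD hF hKD ht
    rw [integral_div_eq_mul_index hF hD H.isCompact_trace hKD hmeas ae_mem_trace
      H.integrable_weight
      (fun a ha => index_eventually_eq_zero H.isCompact_trace hmeas ae_mem_trace
        H.integrable_weight hconst (fun h => ha (hKD h)) (hout a ha))
      (index_eventually_eq_zero_cobounded H.isCompact_trace hmeas ae_mem_trace
        H.integrable_weight hconst) (hray (ofReal_mem_nonnegRay ht.1.le)) htK,
      hin t ht.1.le ht.2] at h1
    exact h1
  rw [hAR, zero_sub, intervalIntegral.integral_neg, neg_inj,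
    intervalIntegral.integral_mul_const] at hFTC
  have h0 := hbl 0 ⟨le_rfl, by linarith⟩
  have hloop := H.integral_loop (E := fun z r => F z * Complex.log (((0 : ℝ) : ℂ) - z) * r)
    (hb.mono' h0.1 h0.2)
  have hA0 : A 0 = _ := hloop
  rw [← hFTC] at hA0
  simp only [Complex.ofReal_zero, zero_sub] at hA0
  rw [← hA0, mul_comm]

end ClosedUpPath

/-! ### The polar part of the integrand -/

/-- The primitive of `x ↦ x⁻ᵐ` on `(0, +∞)` without constant term: the Hadamard finite part of
`∫₀^R x⁻ᵐ dx`. -/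
noncomputable def powPrimitive (m : ℕ) (R : ℝ) : ℂ :=
  if m = 1 then (Real.log R : ℂ) else (R : ℂ) ^ (1 - (m : ℤ)) / (1 - (m : ℂ))

/-- A primitive of `z⁻ᵐ ℓ` with respect to `z`, where `ℓ` is any branch of the logarithm of `z` up
to a constant, entered as an independent variable so that it can be followed along a path. -/
noncomputable def powLogPrimitive (m : ℕ) (z ℓ : ℂ) : ℂ :=
  if m = 1 then ℓ ^ 2 / 2
  else z ^ (1 - (m : ℤ)) / (1 - (m : ℂ)) * ℓ - z ^ (1 - (m : ℤ)) / (1 - (m : ℂ)) ^ 2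

theorem one_sub_natCast_ne_zero {m : ℕ} (hm : m ≠ 1) : (1 - (m : ℂ)) ≠ 0 := by
  rw [sub_ne_zero]; exact_mod_cast hm.symm

theorem hasDerivAt_zpow_one_sub {z : ℝ → ℂ} {z' : ℂ} {t : ℝ} (hz : HasDerivAt z z' t)
    (h0 : z t ≠ 0) (m : ℕ) :
    HasDerivAt (fun t => z t ^ (1 - (m : ℤ))) ((1 - (m : ℂ)) * z t ^ (-(m : ℤ)) * z') t := by
  have := (hasDerivAt_zpow (1 - (m : ℤ)) (z t) (Or.inl h0)).comp t hz
  simpa [Function.comp_def] using this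

theorem hasDerivAt_powLogPrimitive {z ℓ : ℝ → ℂ} {z' : ℂ} {t : ℝ} (hz : HasDerivAt z z' t)
    (hℓ : HasDerivAt ℓ (z' / z t) t) (h0 : z t ≠ 0) (m : ℕ) :
    HasDerivAt (fun t => powLogPrimitive m (z t) (ℓ t)) (z t ^ (-(m : ℤ)) * ℓ t * z') t := by
  unfold powLogPrimitive
  split_ifs with hm
  · subst hm
    have := (hℓ.fun_pow 2).div_const 2
    convert! this using 1
    simp; field_simp
  · have hm1 := one_sub_natCast_ne_zero hm
    have h1 := hasDerivAt_zpow_one_sub hz h0 m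
    have h2 := ((h1.div_const (1 - (m : ℂ))).fun_mul hℓ).fun_sub (h1.div_const ((1 - (m : ℂ)) ^ 2))
    convert! h2 using 1
    rw [show 1 - (m : ℤ) = -(m : ℤ) + 1 by ring, zpow_add_one₀ h0]
    field_simp
    ring

theorem hasDerivAt_powPrimitive (m : ℕ) {x : ℝ} (hx : 0 < x) :
    HasDerivAt (powPrimitive m) ((x : ℂ) ^ (-(m : ℤ))) x := by
  unfold powPrimitive
  split_ifs with hm
  · subst hm
    have := (Real.hasDerivAt_log hx.ne').ofReal_comp
    simpa using! this
  · have hm1 := one_sub_natCast_ne_zero hm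
    have h1 := (hasDerivAt_zpow_one_sub (HasDerivAt.ofReal_comp (hasDerivAt_id x))
      (by simpa using hx.ne') m).div_const (1 - (m : ℂ))
    convert! h1 using 1
    simp; field_simp

theorem polarPt_ne_zero {R : ℝ} (hR : 0 < R) (θ : ℝ) : polarPt R θ ≠ 0 := by
  rw [← norm_pos_iff, norm_polarPt hR.le]; exact hR

theorem neg_polarPt (R θ : ℝ) : -polarPt R θ = polarPt R (θ - Real.pi) := by
  unfold polarPt
  rw [Complex.ofReal_sub, sub_mul, Complex.exp_sub, Complex.exp_pi_mul_I]
  ring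

theorem polarPt_sub_two_pi (R θ : ℝ) : polarPt R (θ - 2 * Real.pi) = polarPt R θ := by
  unfold polarPt
  push_cast
  rw [sub_mul, Complex.exp_sub, Complex.exp_two_pi_mul_I, div_one]

theorem log_polarPt {R θ : ℝ} (hR : 0 < R) (h1 : -Real.pi < θ) (h2 : θ ≤ Real.pi) :
    Complex.log (polarPt R θ) = Real.log R + θ * Complex.I := by
  unfold polarPt
  rw [Complex.log_ofReal_mul hR (Complex.exp_ne_zero _), Complex.log_exp (by simpa) (by simpa)]

/-- The logarithm of `-z` on the arc before the crossing of the positive real axis. -/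
theorem log_neg_polarPt_of_le {R θ : ℝ} (hR : 0 < R) (h1 : 0 < θ) (h2 : θ ≤ 2 * Real.pi) :
    Complex.log (-polarPt R θ) = Real.log R + ((θ - Real.pi : ℝ) : ℂ) * Complex.I := by
  rw [neg_polarPt, log_polarPt hR (by linarith) (by linarith)]

/-- The logarithm of `-z` on the arc after the crossing of the positive real axis. -/
theorem log_neg_polarPt_of_gt {R θ : ℝ} (hR : 0 < R) (h1 : 2 * Real.pi < θ)
    (h2 : θ ≤ 4 * Real.pi) :
    Complex.log (-polarPt R θ) = Real.log R + ((θ - 3 * Real.pi : ℝ) : ℂ) * Complex.I := by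
  rw [← polarPt_sub_two_pi, log_neg_polarPt_of_le hR (by linarith) (by linarith)]
  congr 3
  ring

theorem hasDerivAt_branch (c : ℂ) (R a θ : ℝ) (hR : 0 < R) :
    HasDerivAt (fun θ : ℝ => c + ((θ - a : ℝ) : ℂ) * Complex.I)
      (polarPt R θ * Complex.I / polarPt R θ) θ := by
  rw [mul_div_cancel_left₀ _ (polarPt_ne_zero hR θ)]
  have := ((((hasDerivAt_id θ).sub_const a).ofReal_comp).mul_const Complex.I).const_add c
  simpa using! this

theorem continuous_zpow_polarPt {R : ℝ} (hR : 0 < R) (k : ℤ) :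
    Continuous fun θ => polarPt R θ ^ k :=
  (continuous_polarPt R).zpow₀ k fun θ => Or.inl (polarPt_ne_zero hR θ)

namespace ClosedUpPath

variable {p p' : ℝ → ℂ} {v₁ v₂ R θ₂ θ₃ : ℝ} (H : ClosedUpPath p p' v₁ v₂ R θ₂ θ₃)
include H

theorem ne_zero (v : ℝ) : p v ≠ 0 := fun h => H.avoids v (by simp [h, nonnegRay])

theorem intervalIntegrable_log_left :
    IntervalIntegrable (fun θ => Complex.log (-polarPt R θ)) volume θ₂ (2 * Real.pi) := by
  have : IntervalIntegrable (fun θ : ℝ => (Real.log R : ℂ) + ((θ - Real.pi : ℝ) : ℂ) * Complex.I)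
      volume θ₂ (2 * Real.pi) := Continuous.intervalIntegrable (by fun_prop) _ _
  refine this.congr fun θ hθ => ?_
  rw [uIoc_of_le H.angle_lt.le] at hθ
  exact (log_neg_polarPt_of_le H.R_pos (H.angle_pos.trans hθ.1) hθ.2).symm

theorem intervalIntegrable_log_right :
    IntervalIntegrable (fun θ => Complex.log (-polarPt R θ)) volume (2 * Real.pi) θ₃ := by
  have : IntervalIntegrable (fun θ : ℝ => (Real.log R : ℂ) + ((θ - 3 * Real.pi : ℝ) : ℂ) * Complex.I)
      volume (2 * Real.pi) θ₃ := Continuous.intervalIntegrable (by fun_prop) _ _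
  refine this.congr fun θ hθ => ?_
  rw [uIoc_of_le H.lt_angle.le] at hθ
  exact (log_neg_polarPt_of_gt H.R_pos hθ.1 (hθ.2.trans H.angle_lt'.le)).symm

theorem intervalIntegrable_mul_log_arc {G : ℂ → ℂ}
    (hG : ContinuousOn G (polarPt R '' Icc θ₂ θ₃)) :
    IntervalIntegrable (fun θ => G (polarPt R θ) * Complex.log (-polarPt R θ)
      * (polarPt R θ * Complex.I)) volume θ₂ θ₃ := by
  refine ((H.intervalIntegrable_log_left.trans H.intervalIntegrable_log_right).continuousOn_mul
    ?_).mul_continuousOn (((continuous_polarPt R).mul continuous_const).continuousOn)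
  rw [uIcc_of_le H.angle_le]
  exact hG.comp (continuous_polarPt R).continuousOn (mapsTo_image _ _)

theorem intervalIntegrable_mul_log_curve {G : ℂ → ℂ} (hG : ContinuousOn G (p '' Icc v₁ v₂)) :
    IntervalIntegrable (fun v => G (p v) * Complex.log (-p v) * p' v) volume v₁ v₂ := by
  refine ContinuousOn.intervalIntegrable ?_
  rw [uIcc_of_le H.le]
  refine ((hG.comp H.continuous.continuousOn (mapsTo_image _ _)).mul ?_).mul
    H.continuous_deriv.continuousOn
  exact (H.continuous.neg.clog fun v =>
    neg_mem_slitPlane_of_notMem_nonnegRay (H.avoids v)).continuousOn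

/-- The powers `z⁻ᵐ` times `log (-z)` have explicit primitives, so that their integral along the
loop is the jump of a primitive at the point `R`. -/
theorem integral_zpow_mul_log {m : ℕ} :
    (∫ v in v₁..v₂, p v ^ (-(m : ℤ)) * Complex.log (-p v) * p' v)
      + (∫ θ in θ₂..θ₃, polarPt R θ ^ (-(m : ℤ)) * Complex.log (-polarPt R θ)
          * (polarPt R θ * Complex.I)) =
      2 * Real.pi * Complex.I * powPrimitive m R := by
  have hR := H.R_pos
  have hz := continuous_zpow_polarPt hR (-(m : ℤ))
  have hGa : ContinuousOn (fun z : ℂ => z ^ (-(m : ℤ))) (polarPt R '' Icc θ₂ θ₃) := by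
    refine continuousOn_id.zpow₀ _ ?_
    rintro _ ⟨θ, -, rfl⟩; exact Or.inl (polarPt_ne_zero hR θ)
  have hGp : ContinuousOn (fun z : ℂ => z ^ (-(m : ℤ))) (p '' Icc v₁ v₂) := by
    refine continuousOn_id.zpow₀ _ ?_
    rintro _ ⟨θ, -, rfl⟩; exact Or.inl (H.ne_zero θ)
  have hcurve := H.intervalIntegrable_mul_log_curve hGp
  have hsplit := H.intervalIntegrable_mul_log_arc hGa
  have h1 : ∫ v in v₁..v₂, p v ^ (-(m : ℤ)) * Complex.log (-p v) * p' v =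
      powLogPrimitive m (p v₂) (Complex.log (-p v₂)) -
        powLogPrimitive m (p v₁) (Complex.log (-p v₁)) := by
    refine intervalIntegral.integral_eq_sub_of_hasDerivAt
      (f := fun v => powLogPrimitive m (p v) (Complex.log (-p v))) (fun v _ => ?_)
      hcurve
    refine hasDerivAt_powLogPrimitive (H.hasDerivAt v) ?_ (H.ne_zero v) m
    have := (H.hasDerivAt v).fun_neg.clog_real (neg_mem_slitPlane_of_notMem_nonnegRay (H.avoids v))
    rwa [neg_div_neg_eq] at this
  have h2 : ∫ θ in θ₂..(2 * Real.pi), polarPt R θ ^ (-(m : ℤ)) * Complex.log (-polarPt R θ)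
          * (polarPt R θ * Complex.I) =
      powLogPrimitive m (polarPt R (2 * Real.pi))
          (Real.log R + ((2 * Real.pi - Real.pi : ℝ) : ℂ) * Complex.I) -
        powLogPrimitive m (polarPt R θ₂) (Real.log R + ((θ₂ - Real.pi : ℝ) : ℂ) * Complex.I) := by
    rw [← intervalIntegral.integral_eq_sub_of_hasDerivAt
      (f := fun θ : ℝ => powLogPrimitive m (polarPt R θ)
        (Real.log R + ((θ - Real.pi : ℝ) : ℂ) * Complex.I))
      (fun θ _ => hasDerivAt_powLogPrimitive (hasDerivAt_polarPt R θ)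
        (hasDerivAt_branch _ R _ θ hR) (polarPt_ne_zero hR θ) m)
      (Continuous.intervalIntegrable ((hz.mul (by fun_prop)).mul
        ((continuous_polarPt R).mul continuous_const)) _ _)]
    refine intervalIntegral.integral_congr_ae (Eventually.of_forall fun θ hθ => ?_)
    rw [uIoc_of_le H.angle_lt.le] at hθ
    rw [log_neg_polarPt_of_le hR (H.angle_pos.trans hθ.1) hθ.2]
  have h3 : ∫ θ in (2 * Real.pi)..θ₃, polarPt R θ ^ (-(m : ℤ)) * Complex.log (-polarPt R θ)
          * (polarPt R θ * Complex.I) =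
      powLogPrimitive m (polarPt R θ₃) (Real.log R + ((θ₃ - 3 * Real.pi : ℝ) : ℂ) * Complex.I) -
        powLogPrimitive m (polarPt R (2 * Real.pi))
          (Real.log R + ((2 * Real.pi - 3 * Real.pi : ℝ) : ℂ) * Complex.I) := by
    rw [← intervalIntegral.integral_eq_sub_of_hasDerivAt
      (f := fun θ : ℝ => powLogPrimitive m (polarPt R θ)
        (Real.log R + ((θ - 3 * Real.pi : ℝ) : ℂ) * Complex.I))
      (fun θ _ => hasDerivAt_powLogPrimitive (hasDerivAt_polarPt R θ)
        (hasDerivAt_branch _ R _ θ hR) (polarPt_ne_zero hR θ) m)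
      (Continuous.intervalIntegrable ((hz.mul (by fun_prop)).mul
        ((continuous_polarPt R).mul continuous_const)) _ _)]
    refine intervalIntegral.integral_congr_ae (Eventually.of_forall fun θ hθ => ?_)
    rw [uIoc_of_le H.lt_angle.le] at hθ
    rw [log_neg_polarPt_of_gt hR hθ.1 (hθ.2.trans H.angle_lt'.le)]
  have hsub1 : uIcc θ₂ (2 * Real.pi) ⊆ uIcc θ₂ θ₃ := by
    rw [uIcc_of_le H.angle_lt.le, uIcc_of_le H.angle_le]
    exact Icc_subset_Icc_right H.lt_angle.le
  have hsub2 : uIcc (2 * Real.pi) θ₃ ⊆ uIcc θ₂ θ₃ := by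
    rw [uIcc_of_le H.lt_angle.le, uIcc_of_le H.angle_le]
    exact Icc_subset_Icc_left H.angle_lt.le
  -- the boundary terms cancel except at the angle `2π`, where the logarithm jumps by `2πi`
  rw [← intervalIntegral.integral_add_adjacent_intervals (hsplit.mono_set hsub1)
    (hsplit.mono_set hsub2), h1, h2, h3, H.start_eq, H.end_eq,
    log_neg_polarPt_of_le hR H.angle_pos H.angle_lt.le,
    log_neg_polarPt_of_gt hR H.lt_angle H.angle_lt'.le]
  have h2pi : polarPt R (2 * Real.pi) = R := by
    unfold polarPt; push_cast; rw [Complex.exp_two_pi_mul_I, mul_one]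
  rw [h2pi]
  unfold powLogPrimitive powPrimitive
  split_ifs with hm
  · push_cast; ring
  · push_cast; ring

end ClosedUpPath

/-- The Taylor expansion of `f` at `0` to order `n`, with a remainder that is holomorphic on the
whole domain of `f`. -/
theorem exists_taylor_remainder {D : Set ℂ} {f : ℂ → ℂ} (hD : IsOpen D) (h0 : (0 : ℂ) ∈ D)
    (hf : DifferentiableOn ℂ f D) (n : ℕ) :
    ∃ F : ℂ → ℂ, DifferentiableOn ℂ F D ∧ ∀ z ≠ 0, z ^ (-(n : ℤ)) * f z =
      (∑ i ∈ Finset.range n, iteratedDeriv i f 0 / (i.factorial : ℂ) * z ^ (-((n - i : ℕ) : ℤ)))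
        + F z := by
  obtain ⟨F, hF, hfF⟩ := (hf.analyticAt (hD.mem_nhds h0)).exists_eq_sum_add_pow_mul n
  have key : ∀ z ≠ 0, z ^ (-(n : ℤ)) * f z =
      (∑ i ∈ Finset.range n, iteratedDeriv i f 0 / (i.factorial : ℂ) * z ^ (-((n - i : ℕ) : ℤ)))
        + F z := by
    intro z hz
    rw [hfF z, mul_add, Finset.mul_sum]
    congr 1
    · refine Finset.sum_congr rfl fun i hi => ?_
      have hin : i ≤ n := (Finset.mem_range.1 hi).le
      have : z ^ (-((n - i : ℕ) : ℤ)) = z ^ (-(n : ℤ)) * z ^ i := by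
        rw [← zpow_natCast z i, ← zpow_add₀ hz]
        congr 1
        push_cast [hin]; ring
      rw [this, smul_eq_mul]
      ring
    · rw [smul_eq_mul, ← mul_assoc, zpow_neg, zpow_natCast, inv_mul_cancel₀ (pow_ne_zero n hz),
        one_mul]
  refine ⟨F, fun z hz => ?_, key⟩
  by_cases hz0 : z = 0
  · rw [hz0]; exact hF.differentiableAt.differentiableWithinAt
  · have hd : DifferentiableAt ℂ (fun z => z ^ (-(n : ℤ)) * f z -
        ∑ i ∈ Finset.range n, iteratedDeriv i f 0 / (i.factorial : ℂ) * z ^ (-((n - i : ℕ) : ℤ)))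
        z := by
      refine ((differentiableAt_zpow.2 (Or.inl hz0)).mul
        (hf.differentiableAt (hD.mem_nhds hz))).sub ?_
      exact DifferentiableAt.fun_sum fun i _ =>
        (differentiableAt_zpow.2 (Or.inl hz0)).const_mul _
    refine (hd.congr_of_eventuallyEq ?_).differentiableWithinAt
    filter_upwards [isOpen_ne.mem_nhds hz0] with w hw
    rw [key w hw]; ring

/-- The finite part of `∫₀^R x⁻ⁿ f(x) dx`, in terms of the Taylor coefficients of `f` at `0` and of
the remainder `F`. -/
noncomputable def finitePartTo (n : ℕ) (f F : ℂ → ℂ) (R : ℝ) : ℂ :=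
  (∫ x in (0 : ℝ)..R, F x) +
    ∑ i ∈ Finset.range n, iteratedDeriv i f 0 / (i.factorial : ℂ) * powPrimitive (n - i) R

/-- The contour representation of the finite part of `∫₀^R x⁻ⁿ f(x) dx`. -/
theorem ClosedUpPath.integral_zpow_mul_mul_log {p p' : ℝ → ℂ} {v₁ v₂ R θ₂ θ₃ : ℝ}
    (H : ClosedUpPath p p' v₁ v₂ R θ₂ θ₃) {D : Set ℂ} {f F : ℂ → ℂ} {n : ℕ}
    (hD : IsOpen D) (hF : DifferentiableOn ℂ F D)
    (hfF : ∀ z ≠ 0, z ^ (-(n : ℤ)) * f z =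
      (∑ i ∈ Finset.range n, iteratedDeriv i f 0 / (i.factorial : ℂ) * z ^ (-((n - i : ℕ) : ℤ)))
        + F z)
    (hKD : loopTrace p v₁ v₂ R θ₂ θ₃ ⊆ D) (hray : nonnegRay ⊆ D)
    (hin : ∀ x : ℝ, 0 ≤ x → x < R → ∫ y, loopWeight p' v₂ R θ₂ y / (loopCurve p v₂ R θ₂ y - x)
      ∂(loopMeasure v₁ v₂ θ₂ θ₃) = 2 * Real.pi * Complex.I)
    (hout : ∀ a ∉ D, ∫ x, loopWeight p' v₂ R θ₂ x / (loopCurve p v₂ R θ₂ x - a)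
      ∂(loopMeasure v₁ v₂ θ₂ θ₃) = 0) :
    (∫ v in v₁..v₂, p v ^ (-(n : ℤ)) * f (p v) * Complex.log (-p v) * p' v)
      + (∫ θ in θ₂..θ₃, polarPt R θ ^ (-(n : ℤ)) * f (polarPt R θ) * Complex.log (-polarPt R θ)
          * (polarPt R θ * Complex.I)) =
      2 * Real.pi * Complex.I * finitePartTo n f F R := by
  have hR := H.R_pos
  set c : ℕ → ℂ := fun i => iteratedDeriv i f 0 / (i.factorial : ℂ) with hc
  have hzp : ∀ m : ℕ, ContinuousOn (fun z : ℂ => z ^ (-(m : ℤ))) (p '' Icc v₁ v₂) := by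
    intro m
    refine continuousOn_id.zpow₀ _ ?_
    rintro _ ⟨θ, -, rfl⟩; exact Or.inl (H.ne_zero θ)
  have hza : ∀ m : ℕ, ContinuousOn (fun z : ℂ => z ^ (-(m : ℤ))) (polarPt R '' Icc θ₂ θ₃) := by
    intro m
    refine continuousOn_id.zpow₀ _ ?_
    rintro _ ⟨θ, -, rfl⟩; exact Or.inl (polarPt_ne_zero hR θ)
  have h1 : ∫ v in v₁..v₂, p v ^ (-(n : ℤ)) * f (p v) * Complex.log (-p v) * p' v =
      (∑ i ∈ Finset.range n, c i * ∫ v in v₁..v₂,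
        p v ^ (-((n - i : ℕ) : ℤ)) * Complex.log (-p v) * p' v) +
        ∫ v in v₁..v₂, F (p v) * Complex.log (-p v) * p' v := by
    simp_rw [← intervalIntegral.integral_const_mul]
    rw [← intervalIntegral.integral_finsetSum, ← intervalIntegral.integral_add]
    · refine intervalIntegral.integral_congr fun v _ => ?_
      rw [hfF _ (H.ne_zero v), add_mul, add_mul, Finset.sum_mul, Finset.sum_mul]
      congr 1
      exact Finset.sum_congr rfl fun i _ => by ring
    · refine (IntervalIntegrable.sum (Finset.range n) fun i _ =>
        (H.intervalIntegrable_mul_log_curve (hzp (n - i))).const_mul (c i)).congr fun v _ => ?_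
      rw [Finset.sum_apply]
    · exact H.intervalIntegrable_mul_log_curve
        (hF.continuousOn.mono fun z hz => hKD (Or.inl hz))
    · exact fun i _ => (H.intervalIntegrable_mul_log_curve (hzp (n - i))).const_mul (c i)
  have h2 : ∫ θ in θ₂..θ₃, polarPt R θ ^ (-(n : ℤ)) * f (polarPt R θ)
        * Complex.log (-polarPt R θ) * (polarPt R θ * Complex.I) =
      (∑ i ∈ Finset.range n, c i * ∫ θ in θ₂..θ₃,
        polarPt R θ ^ (-((n - i : ℕ) : ℤ)) * Complex.log (-polarPt R θ)
          * (polarPt R θ * Complex.I)) +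
        ∫ θ in θ₂..θ₃, F (polarPt R θ) * Complex.log (-polarPt R θ)
          * (polarPt R θ * Complex.I) := by
    simp_rw [← intervalIntegral.integral_const_mul]
    rw [← intervalIntegral.integral_finsetSum, ← intervalIntegral.integral_add]
    · refine intervalIntegral.integral_congr fun v _ => ?_
      rw [hfF _ (polarPt_ne_zero hR v), add_mul, add_mul, Finset.sum_mul, Finset.sum_mul]
      congr 1
      exact Finset.sum_congr rfl fun i _ => by ring
    · refine (IntervalIntegrable.sum (Finset.range n) fun i _ =>
        (H.intervalIntegrable_mul_log_arc (hza (n - i))).const_mul (c i)).congr fun v _ => ?_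
      rw [Finset.sum_apply]
    · exact H.intervalIntegrable_mul_log_arc
        (hF.continuousOn.mono fun z hz => hKD (Or.inr hz))
    · exact fun i _ => (H.intervalIntegrable_mul_log_arc (hza (n - i))).const_mul (c i)
  have h3 := H.integral_mul_log hD hF hKD hray hin hout
  rw [h1, h2, add_add_add_comm, h3, ← Finset.sum_add_distrib]
  simp_rw [← mul_add]
  rw [Finset.sum_congr rfl fun i _ => by rw [H.integral_zpow_mul_log]]
  unfold finitePartTo
  rw [mul_add, add_comm, Finset.mul_sum]
  congr 1
  exact Finset.sum_congr rfl fun i _ => by ring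

/-! ### The finite part and its contour representation -/

section FinitePart

variable {D : Set ℂ} {f F : ℂ → ℂ} {n : ℕ} {α : ℝ}

theorem exists_growth_bound (hgrowth : f =O[Bornology.cobounded ℂ ⊓ 𝓟 D] fun z : ℂ => ‖z‖ ^ ((n : ℝ) - 1 - α)) :
    ∃ C R₀ : ℝ, 0 < C ∧ 0 < R₀ ∧ ∀ z ∈ D, R₀ ≤ ‖z‖ →
      ‖z ^ (-(n : ℤ)) * f z‖ ≤ C * ‖z‖ ^ (-1 - α) := by
  obtain ⟨C, hC, hb⟩ := hgrowth.exists_pos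
  rw [Asymptotics.isBigOWith_iff, eventually_inf_principal] at hb
  obtain ⟨r, -, hr⟩ := (Metric.hasBasis_cobounded_compl_closedBall (0 : ℂ)).mem_iff.1 hb
  refine ⟨C, max r 0 + 1, hC, by positivity, fun z hzD hz => ?_⟩
  have hz0 : 0 < ‖z‖ := lt_of_lt_of_le (by positivity) hz
  have h1 : ‖f z‖ ≤ C * ‖‖z‖ ^ ((n : ℝ) - 1 - α)‖ := by
    refine hr ?_ hzD
    simp only [mem_compl_iff, mem_closedBall_zero_iff, not_le]
    linarith [le_max_left r 0]
  rw [Real.norm_of_nonneg (by positivity)] at h1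
  rw [norm_mul, norm_zpow]
  calc ‖z‖ ^ (-(n : ℤ)) * ‖f z‖ ≤ ‖z‖ ^ (-(n : ℤ)) * (C * ‖z‖ ^ ((n : ℝ) - 1 - α)) := by gcongr
    _ = C * ‖z‖ ^ (-1 - α) := by
      have : ‖z‖ ^ (-(n : ℤ)) = ‖z‖ ^ (-(n : ℝ)) := by
        rw [← Real.rpow_intCast]; simp
      rw [this, mul_left_comm, ← Real.rpow_add hz0]
      congr 2; ring

theorem integrableOn_Ioi_zpow_mul (hray : nonnegRay ⊆ D)
    (hf : DifferentiableOn ℂ f D) (hα : 0 < α)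
    (hgrowth : f =O[Bornology.cobounded ℂ ⊓ 𝓟 D] fun z : ℂ => ‖z‖ ^ ((n : ℝ) - 1 - α))
    {ε : ℝ} (hε : 0 < ε) :
    IntegrableOn (fun x : ℝ => (x : ℂ) ^ (-(n : ℤ)) * f x) (Ioi ε) := by
  obtain ⟨C, R₀, hC, hR₀, hb⟩ := exists_growth_bound hgrowth
  have hcont : ContinuousOn (fun x : ℝ => (x : ℂ) ^ (-(n : ℤ)) * f x) (Ici ε) := by
    refine ContinuousOn.mul (Complex.continuous_ofReal.continuousOn.zpow₀ _ fun x hx => ?_)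
      (hf.continuousOn.comp Complex.continuous_ofReal.continuousOn fun x hx => ?_)
    · left; exact_mod_cast (hε.trans_le hx).ne'
    · exact hray (ofReal_mem_nonnegRay (hε.le.trans hx))
  have ho : (fun x : ℝ => (x : ℂ) ^ (-(n : ℤ)) * f x) =O[atTop] fun x : ℝ => x ^ (-1 - α) := by
    refine Asymptotics.IsBigO.of_bound C ?_
    filter_upwards [eventually_ge_atTop R₀] with x hx
    have hx0 : 0 ≤ x := hR₀.le.trans hx
    have := hb x (hray (ofReal_mem_nonnegRay hx0)) (by simpa [abs_of_nonneg hx0] using hx)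
    rw [Real.norm_of_nonneg (by positivity)]
    simpa [abs_of_nonneg hx0] using this
  refine ((hcont.locallyIntegrableOn measurableSet_Ici).integrableOn_of_isBigO_atTop ho
    ⟨Ioi 1, Ioi_mem_atTop 1, ?_⟩).mono_set Ioi_subset_Ici_self
  exact integrableOn_Ioi_rpow_of_lt (by linarith) one_pos

theorem finitePartTo_sub (hray : nonnegRay ⊆ D) (hF : DifferentiableOn ℂ F D)
    (hfF : ∀ z ≠ 0, z ^ (-(n : ℤ)) * f z =
      (∑ i ∈ Finset.range n, iteratedDeriv i f 0 / (i.factorial : ℂ) * z ^ (-((n - i : ℕ) : ℤ)))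
        + F z) {a b : ℝ} (ha : 0 < a) (hb : 0 < b) :
    finitePartTo n f F b - finitePartTo n f F a = ∫ x in a..b, (x : ℂ) ^ (-(n : ℤ)) * f x := by
  have hFi : ∀ {s t : ℝ}, 0 ≤ s → 0 ≤ t → IntervalIntegrable (fun x : ℝ => F x) volume s t := by
    intro s t hs ht
    refine (hF.continuousOn.comp Complex.continuous_ofReal.continuousOn
      fun x hx => hray (ofReal_mem_nonnegRay ?_)).intervalIntegrable
    exact (le_min hs ht).trans hx.1
  have hpos : ∀ x ∈ uIcc a b, 0 < x := fun x hx => (lt_min ha hb).trans_le hx.1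
  have hpi : ∀ m : ℕ, IntervalIntegrable (fun x : ℝ => (x : ℂ) ^ (-(m : ℤ))) volume a b :=
    fun m => (Complex.continuous_ofReal.continuousOn.zpow₀ _ fun x hx =>
      Or.inl (by exact_mod_cast (hpos x hx).ne')).intervalIntegrable
  have hpow : ∀ m : ℕ, ∫ x in a..b, (x : ℂ) ^ (-(m : ℤ)) = powPrimitive m b - powPrimitive m a :=
    fun m => intervalIntegral.integral_eq_sub_of_hasDerivAt
      (fun x hx => hasDerivAt_powPrimitive m (hpos x hx)) (hpi m)
  have h1 : ∫ x in a..b, (x : ℂ) ^ (-(n : ℤ)) * f x =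
      (∑ i ∈ Finset.range n, iteratedDeriv i f 0 / (i.factorial : ℂ) *
        ∫ x in a..b, (x : ℂ) ^ (-((n - i : ℕ) : ℤ))) + ∫ x in a..b, F x := by
    simp_rw [← intervalIntegral.integral_const_mul]
    rw [← intervalIntegral.integral_finsetSum fun i _ => (hpi (n - i)).const_mul _,
      ← intervalIntegral.integral_add ?_ (hFi ha.le hb.le)]
    · exact intervalIntegral.integral_congr fun x hx =>
        hfF _ (by exact_mod_cast (hpos x hx).ne')
    · refine (IntervalIntegrable.sum (Finset.range n) fun i _ =>
        (hpi (n - i)).const_mul (iteratedDeriv i f 0 / (i.factorial : ℂ))).congr fun v _ => ?_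
      rw [Finset.sum_apply]
  have h2 := intervalIntegral.integral_add_adjacent_intervals (hFi le_rfl ha.le) (hFi ha.le hb.le)
  rw [h1]
  simp_rw [hpow, mul_sub]
  rw [Finset.sum_sub_distrib]
  unfold finitePartTo
  rw [← h2]
  ring

theorem tendsto_finitePartTo_atTop (hray : nonnegRay ⊆ D)
    (hf : DifferentiableOn ℂ f D) (hF : DifferentiableOn ℂ F D)
    (hfF : ∀ z ≠ 0, z ^ (-(n : ℤ)) * f z =
      (∑ i ∈ Finset.range n, iteratedDeriv i f 0 / (i.factorial : ℂ) * z ^ (-((n - i : ℕ) : ℤ)))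
        + F z) (hα : 0 < α)
    (hgrowth : f =O[Bornology.cobounded ℂ ⊓ 𝓟 D] fun z : ℂ => ‖z‖ ^ ((n : ℝ) - 1 - α)) :
    Tendsto (finitePartTo n f F) atTop
      (𝓝 (finitePartTo n f F 1 + ∫ x in Ioi (1 : ℝ), (x : ℂ) ^ (-(n : ℤ)) * f x)) := by
  refine ((intervalIntegral_tendsto_integral_Ioi 1
    (integrableOn_Ioi_zpow_mul hray hf hα hgrowth one_pos) tendsto_id).const_add
    (finitePartTo n f F 1)).congr' ?_
  filter_upwards [eventually_gt_atTop 0] with R hR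
  rw [id, ← finitePartTo_sub hray hF hfF one_pos hR]
  ring

theorem sum_powPrimitive_eq (hn : 1 ≤ n) (ε : ℝ) :
    ∑ i ∈ Finset.range n, iteratedDeriv i f 0 / (i.factorial : ℂ) * powPrimitive (n - i) ε =
      -(∑ k ∈ Finset.range (n - 1),
            (ε : ℂ) ^ ((k : ℤ) + 1 - (n : ℤ)) / ((k.factorial : ℂ) * ((n : ℂ) - 1 - (k : ℂ)))
              * iteratedDeriv k f 0)
        + (Real.log ε : ℂ) / ((n - 1).factorial : ℂ) * iteratedDeriv (n - 1) f 0 := by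
  obtain ⟨m, rfl⟩ : ∃ m, n = m + 1 := ⟨n - 1, by omega⟩
  rw [Finset.sum_range_succ, add_tsub_cancel_right, ← Finset.sum_neg_distrib]
  congr 1
  · refine Finset.sum_congr rfl fun k hk => ?_
    have hkm : k < m := Finset.mem_range.1 hk
    have h1 : m + 1 - k ≠ 1 := by omega
    have h2 : (1 : ℤ) - ((m + 1 - k : ℕ) : ℤ) = (k : ℤ) + 1 - ((m + 1 : ℕ) : ℤ) := by
      push_cast [show k ≤ m + 1 by omega]; ring
    have h3 : (1 : ℂ) - ((m + 1 - k : ℕ) : ℂ) = -(((m + 1 : ℕ) : ℂ) - 1 - k) := by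
      push_cast [show k ≤ m + 1 by omega]; ring
    rw [powPrimitive, if_neg h1, h2, h3, div_neg, mul_neg, neg_inj, div_mul_div_comm,
      div_mul_eq_mul_div, mul_comm (iteratedDeriv _ _ _)]
  · simp only [add_tsub_cancel_left, powPrimitive, if_true]
    ring

/-- The Hadamard finite part exists. -/
theorem hasFinitePart_of_growth (hn : 1 ≤ n) (hray : nonnegRay ⊆ D)
    (hf : DifferentiableOn ℂ f D) (hF : DifferentiableOn ℂ F D)
    (hfF : ∀ z ≠ 0, z ^ (-(n : ℤ)) * f z =
      (∑ i ∈ Finset.range n, iteratedDeriv i f 0 / (i.factorial : ℂ) * z ^ (-((n - i : ℕ) : ℤ)))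
        + F z) (hα : 0 < α)
    (hgrowth : f =O[Bornology.cobounded ℂ ⊓ 𝓟 D] fun z : ℂ => ‖z‖ ^ ((n : ℝ) - 1 - α)) :
    HasFinitePart n f
      (finitePartTo n f F 1 + ∫ x in Ioi (1 : ℝ), (x : ℂ) ^ (-(n : ℤ)) * f x) := by
  set I := finitePartTo n f F 1 + ∫ x in Ioi (1 : ℝ), (x : ℂ) ^ (-(n : ℤ)) * f x
  have hFc : ContinuousOn (fun x : ℝ => F x) (Ici 0) :=
    hF.continuousOn.comp Complex.continuous_ofReal.continuousOn
      fun x hx => hray (ofReal_mem_nonnegRay hx)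
  have hlim : Tendsto (fun ε : ℝ => I - ∫ x in (0 : ℝ)..ε, F x) (𝓝[>] 0) (𝓝 (I - 0)) := by
    refine tendsto_const_nhds.sub ?_
    have h1 : ContinuousOn (fun ε : ℝ => ∫ x in (0 : ℝ)..ε, F x) (uIcc 0 1) :=
      intervalIntegral.continuousOn_primitive_interval
        ((hFc.mono (by rw [uIcc_of_le zero_le_one]; exact Icc_subset_Ici_self)).integrableOn_compact
          isCompact_uIcc)
    have h2 := h1 0 (by simp)
    rw [uIcc_of_le zero_le_one] at h2
    have h3 := h2.tendsto
    rw [intervalIntegral.integral_same] at h3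
    refine h3.mono_left ?_
    rw [← nhdsWithin_Ioc_eq_nhdsGT (zero_lt_one (α := ℝ))]
    exact nhdsWithin_mono _ Ioc_subset_Icc_self
  rw [sub_zero] at hlim
  refine hlim.congr' ?_
  filter_upwards [self_mem_nhdsWithin] with ε hε
  have hε' : 0 < ε := hε
  have h1 := sum_powPrimitive_eq (f := f) hn ε
  have h2 := finitePartTo_sub hray hF hfF hε' one_pos
  have h3 := intervalIntegral.integral_interval_add_Ioi
    (integrableOn_Ioi_zpow_mul hray hf hα hgrowth hε')
    (integrableOn_Ioi_zpow_mul hray hf hα hgrowth one_pos)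
  have h4 : finitePartTo n f F ε = (∫ x in (0 : ℝ)..ε, F x) +
    ∑ i ∈ Finset.range n, iteratedDeriv i f 0 / (i.factorial : ℂ) * powPrimitive (n - i) ε := rfl
  rw [← h3, ← h2, h4, h1]
  simp only [I]
  ring

end FinitePart

/-- The contribution of a large closing arc is small. -/
theorem norm_integral_arc_le {D : Set ℂ} {f : ℂ → ℂ} {n : ℕ} {α C R₀ R θ₂ θ₃ : ℝ}
    (hb : ∀ z ∈ D, R₀ ≤ ‖z‖ → ‖z ^ (-(n : ℤ)) * f z‖ ≤ C * ‖z‖ ^ (-1 - α))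
    (hR : 0 < R) (hR₀ : R₀ ≤ R) (hθ : θ₂ ≤ θ₃) (hθ' : θ₃ - θ₂ ≤ 4 * Real.pi) (hC : 0 < C)
    (harc : polarPt R '' Icc θ₂ θ₃ ⊆ D) :
    ‖∫ θ in θ₂..θ₃, polarPt R θ ^ (-(n : ℤ)) * f (polarPt R θ) * Complex.log (-polarPt R θ)
      * (polarPt R θ * Complex.I)‖ ≤
      4 * Real.pi * C * (R ^ (-α) * |Real.log R| + Real.pi * R ^ (-α)) := by
  have h1 : ∀ θ ∈ uIoc θ₂ θ₃, ‖polarPt R θ ^ (-(n : ℤ)) * f (polarPt R θ)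
      * Complex.log (-polarPt R θ) * (polarPt R θ * Complex.I)‖ ≤
      C * R ^ (-1 - α) * (|Real.log R| + Real.pi) * R := by
    intro θ hθm
    rw [uIoc_of_le hθ] at hθm
    have hn := norm_polarPt hR.le θ
    have h2 := hb _ (harc ⟨θ, ⟨hθm.1.le, hθm.2⟩, rfl⟩) (by rwa [hn])
    have h3 : ‖Complex.log (-polarPt R θ)‖ ≤ |Real.log R| + Real.pi := by
      refine (Complex.norm_le_abs_re_add_abs_im _).trans ?_
      rw [Complex.log_re, Complex.log_im, norm_neg, hn]
      exact add_le_add le_rfl (Complex.abs_arg_le_pi _)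
    rw [hn] at h2
    rw [norm_mul, norm_mul, norm_mul _ Complex.I, hn, Complex.norm_I, mul_one]
    gcongr
  refine (intervalIntegral.norm_integral_le_of_norm_le_const h1).trans ?_
  rw [abs_of_nonneg (sub_nonneg.2 hθ)]
  have h4 : R ^ (-1 - α) * R = R ^ (-α) := by
    rw [← Real.rpow_add_one hR.ne']; congr 1; ring
  calc _ ≤ C * R ^ (-1 - α) * (|Real.log R| + Real.pi) * R * (4 * Real.pi) := by gcongr
    _ = 4 * Real.pi * C * (R ^ (-1 - α) * R * |Real.log R| + Real.pi * (R ^ (-1 - α) * R)) := by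
      ring
    _ = _ := by rw [h4]

theorem tendsto_arc_bound {α : ℝ} (hα : 0 < α) (C : ℝ) :
    Tendsto (fun R : ℝ => 4 * Real.pi * C * (R ^ (-α) * |Real.log R| + Real.pi * R ^ (-α)))
      atTop (𝓝 0) := by
  have h1 : Tendsto (fun R : ℝ => R ^ (-α)) atTop (𝓝 0) := tendsto_rpow_neg_atTop hα
  have h2 : Tendsto (fun R : ℝ => R ^ (-α) * |Real.log R|) atTop (𝓝 0) := by
    have h3 := (isLittleO_log_rpow_atTop hα).tendsto_div_nhds_zero.abs
    rw [abs_zero] at h3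
    refine h3.congr' ?_
    filter_upwards [eventually_gt_atTop 0] with R hR
    rw [abs_div, abs_of_pos (Real.rpow_pos_of_pos hR α), Real.rpow_neg hR.le]
    ring
  have := (h2.add (h1.const_mul Real.pi)).const_mul (4 * Real.pi * C)
  simpa using this

/-! ### The change of variables `u = ψ v` -/

/-- The properties of a double exponential transform `ψ`, with inverse `χ`, that matter for the
change of variables. -/
structure SmoothChange (ψ χ : ℝ → ℝ) : Prop where
  right_inv : ∀ u, ψ (χ u) = u
  left_inv : ∀ v, χ (ψ v) = v
  hasDerivAt_inv : ∀ u, HasDerivAt χ (deriv ψ (χ u))⁻¹ u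
  differentiable : Differentiable ℝ ψ
  continuous_deriv : Continuous (deriv ψ)
  deriv_pos : ∀ v, 0 < deriv ψ v
  strictMono : StrictMono ψ
  tendsto_inv_atTop : Tendsto χ atTop atTop
  tendsto_inv_atBot : Tendsto χ atBot atBot

theorem exists_smoothChange {ψ : ℝ → ℝ} (h1 : ContDiff ℝ 1 ψ) (h2 : ∀ v, 0 < deriv ψ v)
    (h3 : Function.Surjective ψ) : ∃ χ, SmoothChange ψ χ := by
  have hmono : StrictMono ψ := strictMono_of_deriv_pos h2
  set e : ℝ ≃o ℝ := hmono.orderIsoOfSurjective ψ h3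
  have he : ∀ v, e v = ψ v := fun v => rfl
  have hr : ∀ u, ψ (e.symm u) = u := fun u => by rw [← he, e.apply_symm_apply]
  refine ⟨e.symm, hr, fun v => by rw [← he, e.symm_apply_apply], fun u => ?_,
    h1.differentiable (by norm_num), h1.continuous_deriv (by norm_num), h2, hmono,
    e.symm.tendsto_atTop, e.symm.tendsto_atBot⟩
  exact HasDerivAt.of_local_left_inverse e.symm.continuous.continuousAt
    (h1.differentiable (by norm_num) _).hasDerivAt (h2 _).ne' (Eventually.of_forall hr)

theorem IsDETransform.exists_smoothChange {ψ : ℝ → ℝ} (hψ : IsDETransform ψ) :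
    ∃ χ, SmoothChange ψ χ := by
  rcases hψ with rfl | rfl
  · refine _root_.exists_smoothChange (Real.contDiff_sinh.comp Real.contDiff_sinh) (fun v => ?_)
      (Real.sinh_surjective.comp Real.sinh_surjective)
    rw [((Real.hasDerivAt_sinh v).sinh).deriv]
    exact mul_pos (Real.cosh_pos _) (Real.cosh_pos _)
  · refine _root_.exists_smoothChange Real.contDiff_sinh (fun v => ?_) Real.sinh_surjective
    rw [(Real.hasDerivAt_sinh v).deriv]
    exact Real.cosh_pos _

theorem isOpen_strip (d : ℝ) : IsOpen (strip d) :=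
  isOpen_lt (continuous_abs.comp Complex.continuous_im) continuous_const

theorem ofReal_mem_strip {d : ℝ} (hd : 0 < d) (v : ℝ) : (v : ℂ) ∈ strip d := by
  simpa [strip] using hd

section Change

variable {φ : ℝ → ℂ} {ψ χ : ℝ → ℝ} {d : ℝ} {Φ : ℂ → ℂ}

theorem hasDerivAt_ofReal_strip (hd : 0 < d) (hΦ : AnalyticOnNhd ℂ Φ (strip d)) (v : ℝ) :
    HasDerivAt (fun v : ℝ => Φ v) (deriv Φ v) v :=
  ((hΦ _ (ofReal_mem_strip hd v)).differentiableAt.hasDerivAt).comp_ofReal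

theorem continuous_deriv_ofReal_strip (hd : 0 < d) (hΦ : AnalyticOnNhd ℂ Φ (strip d)) :
    Continuous fun v : ℝ => deriv Φ v :=
  continuous_iff_continuousAt.2 fun v => ContinuousAt.comp (g := deriv Φ)
    (hΦ.deriv _ (ofReal_mem_strip hd v)).continuousAt Complex.continuous_ofReal.continuousAt

theorem SmoothChange.hasDerivAt_path (hχ : SmoothChange ψ χ) (hd : 0 < d)
    (hΦ : AnalyticOnNhd ℂ Φ (strip d)) (hΦφ : ∀ v : ℝ, Φ (v : ℂ) = φ (ψ v)) (u : ℝ) :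
    HasDerivAt φ (((deriv ψ (χ u))⁻¹ : ℝ) • deriv Φ (χ u)) u := by
  have h1 := (hasDerivAt_ofReal_strip hd hΦ (χ u)).scomp u (hχ.hasDerivAt_inv u)
  refine h1.congr_of_eventuallyEq (Eventually.of_forall fun u => ?_)
  simp [hΦφ, hχ.right_inv]

theorem SmoothChange.deriv_path_mul (hχ : SmoothChange ψ χ) (hd : 0 < d)
    (hΦ : AnalyticOnNhd ℂ Φ (strip d)) (hΦφ : ∀ v : ℝ, Φ (v : ℂ) = φ (ψ v)) (v : ℝ) :
    deriv φ (ψ v) * ((deriv ψ v : ℝ) : ℂ) = deriv Φ v := by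
  rw [(hχ.hasDerivAt_path hd hΦ hΦφ _).deriv, hχ.left_inv, Complex.real_smul]
  have : ((deriv ψ v : ℝ) : ℂ) ≠ 0 := by exact_mod_cast (hχ.deriv_pos v).ne'
  push_cast
  field_simp

theorem SmoothChange.continuous_deriv_path (hχ : SmoothChange ψ χ) (hd : 0 < d)
    (hΦ : AnalyticOnNhd ℂ Φ (strip d)) (hΦφ : ∀ v : ℝ, Φ (v : ℂ) = φ (ψ v)) :
    Continuous (deriv φ) := by
  have hχc : Continuous χ :=
    continuous_iff_continuousAt.2 fun u => (hχ.hasDerivAt_inv u).continuousAt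
  have : deriv φ = fun u => ((deriv ψ (χ u))⁻¹ : ℝ) • deriv Φ (χ u) :=
    funext fun u => (hχ.hasDerivAt_path hd hΦ hΦφ u).deriv
  rw [this]
  exact ((hχ.continuous_deriv.comp hχc).inv₀ fun u => (hχ.deriv_pos _).ne').smul
    ((continuous_deriv_ofReal_strip hd hΦ).comp hχc)

theorem SmoothChange.integral_deriv_path_div (hχ : SmoothChange ψ χ) (hd : 0 < d)
    (hΦ : AnalyticOnNhd ℂ Φ (strip d)) (hΦφ : ∀ v : ℝ, Φ (v : ℂ) = φ (ψ v)) {a : ℂ}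
    (ha : ∀ u, φ u ≠ a) (v₁ v₂ : ℝ) :
    ∫ u in (ψ v₁)..(ψ v₂), deriv φ u / (φ u - a) = ∫ v in v₁..v₂, deriv Φ v / (Φ v - a) := by
  have hφc : Continuous φ := continuous_iff_continuousAt.2 fun u =>
    (hχ.hasDerivAt_path hd hΦ hΦφ u).continuousAt
  have hg : Continuous fun u => deriv φ u / (φ u - a) :=
    (hχ.continuous_deriv_path hd hΦ hΦφ).div (hφc.sub continuous_const)
      fun u => sub_ne_zero.2 (ha u)
  rw [← intervalIntegral.integral_deriv_smul_comp
    (fun v _ => (hχ.differentiable v).hasDerivAt) hχ.continuous_deriv.continuousOn hg]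
  refine intervalIntegral.integral_congr fun v _ => ?_
  simp only [Function.comp, Complex.real_smul]
  rw [← hχ.deriv_path_mul hd hΦ hΦφ, hΦφ]
  ring

end Change

theorem arg_neg_lt_pi {z : ℂ} (hz : z ∉ nonnegRay) : Complex.arg (-z) < Real.pi :=
  lt_of_le_of_ne (Complex.arg_le_pi _)
    (Complex.mem_slitPlane_iff_arg.1 (neg_mem_slitPlane_of_notMem_nonnegRay hz)).1

theorem polarPt_arg_neg_add_pi (z : ℂ) : polarPt ‖z‖ (Complex.arg (-z) + Real.pi) = z := by
  rw [← neg_inj, neg_polarPt, add_sub_cancel_right]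
  unfold polarPt
  rw [← norm_neg, Complex.norm_mul_exp_arg_mul_I]

theorem polarPt_arg_neg_add_three_pi (z : ℂ) :
    polarPt ‖z‖ (Complex.arg (-z) + 3 * Real.pi) = z := by
  rw [← polarPt_sub_two_pi]
  convert polarPt_arg_neg_add_pi z using 2
  ring

/-- The contour integral representation of the Hadamard finite part, in the variable `v`. -/
theorem exists_hasFinitePart_eq_integral {n : ℕ} (hn : 1 ≤ n) {f : ℂ → ℂ}
    {D : Set ℂ} (hD : IsOpen D) (hrayD : nonnegRay ⊆ D) (hfD : AnalyticOnNhd ℂ f D)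
    {α : ℝ} (hα : 0 < α)
    (hgrowth : f =O[Bornology.cobounded ℂ ⊓ 𝓟 D] fun z : ℂ => ‖z‖ ^ ((n : ℝ) - 1 - α))
    {φ : ℝ → ℂ} (hφ : EncirclesRay D φ) {ψ χ : ℝ → ℝ} (hχ : SmoothChange ψ χ)
    {d : ℝ} (hd : 0 < d) {Φ : ℂ → ℂ} (hΦ : AnalyticOnNhd ℂ Φ (strip d))
    (hΦφ : ∀ v : ℝ, Φ (v : ℂ) = φ (ψ v))
    (hint : Integrable fun v : ℝ => transformedIntegrand n f Φ v) :
    ∃ I : ℂ, HasFinitePart n f I ∧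
      ∫ v : ℝ, transformedIntegrand n f Φ v = 2 * Real.pi * Complex.I * I := by
  have hf := hfD.differentiableOn
  obtain ⟨F, hF, hfF⟩ := exists_taylor_remainder hD (hrayD (by simp [nonnegRay])) hf n
  refine ⟨_, hasFinitePart_of_growth hn hrayD hf hF hfF hα hgrowth, ?_⟩
  have hlimFP := tendsto_finitePartTo_atTop hrayD hf hF hfF hα hgrowth
  set I := finitePartTo n f F 1 + ∫ x in Ioi (1 : ℝ), (x : ℂ) ^ (-(n : ℤ)) * f x
  obtain ⟨C, R₀, hC, hR₀, hb⟩ := exists_growth_bound hgrowth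
  choose u₁ u₂ hu₁ hu₂ hnorm harg harc hin hout using fun j : ℕ => hφ.closes j
  set R : ℕ → ℝ := fun j => ‖φ (u₂ j)‖ with hRdef
  set θ₂ : ℕ → ℝ := fun j => Complex.arg (-φ (u₂ j)) + Real.pi with hθ₂
  set θ₃ : ℕ → ℝ := fun j => Complex.arg (-φ (u₁ j)) + 3 * Real.pi with hθ₃
  have hu₁' : Tendsto u₁ atTop atBot :=
    tendsto_atBot_mono hu₁ (tendsto_neg_atTop_atBot.comp tendsto_natCast_atTop_atTop)
  have hu₂' : Tendsto u₂ atTop atTop := tendsto_atTop_mono hu₂ tendsto_natCast_atTop_atTop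
  have hR : Tendsto R atTop atTop :=
    tendsto_norm_cobounded_atTop.comp (hφ.end_infinity.comp hu₂')
  have hRpos : ∀ j, 0 < R j := fun j => norm_pos_iff.2 fun h =>
    hφ.avoids (u₂ j) (by simp [h, nonnegRay])
  have H : ∀ j, ClosedUpPath (fun v : ℝ => Φ v) (fun v : ℝ => deriv Φ v) (χ (u₁ j)) (χ (u₂ j))
      (R j) (θ₂ j) (θ₃ j) := by
    intro j
    have h1 := Complex.neg_pi_lt_arg (-φ (u₁ j))
    have h2 := Complex.neg_pi_lt_arg (-φ (u₂ j))
    have h3 := arg_neg_lt_pi (hφ.avoids (u₁ j))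
    have h4 := arg_neg_lt_pi (hφ.avoids (u₂ j))
    refine ⟨hasDerivAt_ofReal_strip hd hΦ, continuous_deriv_ofReal_strip hd hΦ, ?_, hRpos j, ?_, ?_,
      by simp only [hθ₂]; linarith, by simp only [hθ₂]; linarith, by simp only [hθ₃]; linarith,
      by simp only [hθ₃]; linarith, fun v => hΦφ v ▸ hφ.avoids _⟩
    · rw [← hχ.strictMono.le_iff_le, hχ.right_inv, hχ.right_inv]
      have : (0 : ℝ) ≤ j := j.cast_nonneg
      linarith [hu₁ j, hu₂ j]
    · rw [hΦφ, hχ.right_inv]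
      simp only [hRdef, hθ₃]
      rw [← hnorm, polarPt_arg_neg_add_three_pi]
    · rw [hΦφ, hχ.right_inv]
      exact (polarPt_arg_neg_add_pi _).symm
  have hK : ∀ j, loopTrace (fun v : ℝ => Φ v) (χ (u₁ j)) (χ (u₂ j)) (R j) (θ₂ j) (θ₃ j) ⊆ D := by
    intro j
    refine union_subset ?_ (harc j)
    rintro _ ⟨v, -, rfl⟩
    simp only [hΦφ]
    exact hφ.mem _
  have hW : ∀ j (a : ℂ), (∀ u, φ u ≠ a) →
      a ∉ loopTrace (fun v : ℝ => Φ v) (χ (u₁ j)) (χ (u₂ j)) (R j) (θ₂ j) (θ₃ j) →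
      ∫ x, loopWeight (fun v : ℝ => deriv Φ v) (χ (u₂ j)) (R j) (θ₂ j) x /
        (loopCurve (fun v : ℝ => Φ v) (χ (u₂ j)) (R j) (θ₂ j) x - a)
        ∂(loopMeasure (χ (u₁ j)) (χ (u₂ j)) (θ₂ j) (θ₃ j)) =
      2 * Real.pi * Complex.I * closedWinding φ (u₁ j) (u₂ j) a := by
    intro j a ha haK
    rw [(H j).integral_weight_div haK, ← hχ.integral_deriv_path_div hd hΦ hΦφ ha, hχ.right_inv,
      hχ.right_inv, closedWinding, mul_inv_cancel_left₀ Complex.two_pi_I_ne_zero]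
    rfl
  have key : ∀ j, (∫ v in (χ (u₁ j))..(χ (u₂ j)), transformedIntegrand n f Φ v) +
      (∫ θ in (θ₂ j)..(θ₃ j), polarPt (R j) θ ^ (-(n : ℤ)) * f (polarPt (R j) θ)
        * Complex.log (-polarPt (R j) θ) * (polarPt (R j) θ * Complex.I)) =
      2 * Real.pi * Complex.I * finitePartTo n f F (R j) := by
    intro j
    refine (H j).integral_zpow_mul_mul_log hD hF hfF (hK j) hrayD (fun x hx hxR => ?_)
      fun a ha => ?_
    · rw [hW j x (fun u h => hφ.avoids u (h ▸ ofReal_mem_nonnegRay hx))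
        ((H j).ofReal_notMem_trace hx hxR.ne), hin j x hx hxR, mul_one]
    · rw [hW j a (fun u h => ha (h ▸ hφ.mem u)) fun h => ha (hK j h), hout j a ha, mul_zero]
  have hlim1 : Tendsto (fun j => ∫ v in (χ (u₁ j))..(χ (u₂ j)), transformedIntegrand n f Φ v) atTop
      (𝓝 (∫ v : ℝ, transformedIntegrand n f Φ v)) :=
    intervalIntegral_tendsto_integral hint (hχ.tendsto_inv_atBot.comp hu₁')
      (hχ.tendsto_inv_atTop.comp hu₂')
  have hlim2 : Tendsto (fun j => ∫ θ in (θ₂ j)..(θ₃ j), polarPt (R j) θ ^ (-(n : ℤ)) *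
      f (polarPt (R j) θ) * Complex.log (-polarPt (R j) θ) * (polarPt (R j) θ * Complex.I)) atTop
      (𝓝 0) := by
    refine squeeze_zero_norm' ?_ ((tendsto_arc_bound hα C).comp hR)
    filter_upwards [hR.eventually_ge_atTop R₀] with j hj
    refine norm_integral_arc_le hb (hRpos j) hj (H j).angle_le ?_ hC (harc j)
    linarith [(H j).angle_pos, (H j).angle_lt']
  have hlim3 := (hlimFP.comp hR).const_mul (2 * Real.pi * Complex.I : ℂ)
  refine tendsto_nhds_unique ?_ hlim3
  have := hlim1.add hlim2
  rw [add_zero] at this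
  exact this.congr key

/-! ### Decay of the transformed integrand on the real line -/

theorem analyticAt_log_neg {Φ : ℂ → ℂ} {w : ℂ} (hΦ : AnalyticAt ℂ Φ w) (hw : Φ w ∉ nonnegRay) :
    AnalyticAt ℂ (fun w => Complex.log (-Φ w)) w :=
  hΦ.neg.clog (neg_mem_slitPlane_of_notMem_nonnegRay hw)

theorem ne_zero_of_notMem_nonnegRay {z : ℂ} (hz : z ∉ nonnegRay) : z ≠ 0 := by
  rintro rfl; exact hz (by simp [nonnegRay])

theorem analyticAt_transformedIntegrand {n : ℕ} {f Φ : ℂ → ℂ} {w : ℂ} (hΦ : AnalyticAt ℂ Φ w)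
    (hw : Φ w ∉ nonnegRay) (hf : AnalyticAt ℂ f (Φ w)) :
    AnalyticAt ℂ (transformedIntegrand n f Φ) w :=
  (((hΦ.zpow (ne_zero_of_notMem_nonnegRay hw)).mul (hf.comp hΦ)).mul
    (analyticAt_log_neg hΦ hw)).mul hΦ.deriv

/-- A holomorphic map from the strip `|Im w| < d` to the plane cut along `[0, +∞)` has a bounded
logarithmic derivative on the real line, because `exp (i log (-Φ))` is bounded above and below. -/
theorem norm_deriv_log_neg_le {d : ℝ} (hd : 0 < d) {Φ : ℂ → ℂ} (hΦ : AnalyticOnNhd ℂ Φ (strip d))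
    (hΦray : ∀ w ∈ strip d, Φ w ∉ nonnegRay) (v : ℝ) :
    ‖deriv (fun w => Complex.log (-Φ w)) v‖ ≤ Real.exp Real.pi * (Real.exp Real.pi / (d / 2)) := by
  set L : ℂ → ℂ := fun w => Complex.log (-Φ w) with hL
  have hLd : ∀ w ∈ strip d, DifferentiableAt ℂ L w := fun w hw =>
    (analyticAt_log_neg (hΦ w hw) (hΦray w hw)).differentiableAt
  have hnorm : ∀ w, ‖Complex.exp (Complex.I * L w)‖ = Real.exp (-Complex.arg (-Φ w)) := by
    intro w
    rw [Complex.norm_exp]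
    simp [hL, Complex.log_im]
  have hsub : Metric.closedBall (v : ℂ) (d / 2) ⊆ strip d := by
    intro w hw
    rw [mem_closedBall_iff_norm] at hw
    have := (Complex.abs_im_le_norm (w - v)).trans hw
    simp only [Complex.sub_im, Complex.ofReal_im, sub_zero] at this
    exact lt_of_le_of_lt this (by linarith)
  have h1 : ‖deriv (fun w => Complex.exp (Complex.I * L w)) v‖ ≤ Real.exp Real.pi / (d / 2) := by
    refine Complex.norm_deriv_le_of_forall_mem_sphere_norm_le (half_pos hd) ?_ fun w _ => ?_
    · apply DifferentiableOn.diffContOnCl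
      rw [closure_ball _ (half_pos hd).ne']
      exact fun w hw => (((hLd w (hsub hw)).const_mul Complex.I).cexp).differentiableWithinAt
    · rw [hnorm]
      exact Real.exp_le_exp.2 (by linarith [Complex.neg_pi_lt_arg (-Φ w)])
  have h2 := (((hLd v (ofReal_mem_strip hd v)).hasDerivAt.const_mul Complex.I).cexp).deriv
  rw [h2, norm_mul, norm_mul, Complex.norm_I, one_mul, hnorm] at h1
  have h3 : Real.exp (-Real.pi) ≤ Real.exp (-Complex.arg (-Φ v)) :=
    Real.exp_le_exp.2 (by linarith [Complex.arg_le_pi (-Φ v)])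
  calc ‖deriv L v‖ = Real.exp Real.pi * (Real.exp (-Real.pi) * ‖deriv L v‖) := by
        rw [← mul_assoc, ← Real.exp_add]; simp
    _ ≤ Real.exp Real.pi * (Real.exp (-Complex.arg (-Φ v)) * ‖deriv L v‖) := by gcongr
    _ ≤ _ := by gcongr

theorem exists_pos_le_norm_path {φ : ℝ → ℂ} (hφ : Continuous φ) (h0 : ∀ u, φ u ≠ 0)
    (hbot : Tendsto φ atBot (Bornology.cobounded ℂ))
    (htop : Tendsto φ atTop (Bornology.cobounded ℂ)) : ∃ δ > 0, ∀ u, δ ≤ ‖φ u‖ := by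
  have hlim : Tendsto (fun u => ‖φ u‖) (cocompact ℝ) atTop := by
    rw [cocompact_eq_atBot_atTop]
    exact (tendsto_norm_cobounded_atTop.comp hbot).sup (tendsto_norm_cobounded_atTop.comp htop)
  obtain ⟨u₀, hu₀⟩ := hφ.norm.exists_forall_le hlim
  exact ⟨‖φ u₀‖, norm_pos_iff.2 (h0 u₀), hu₀⟩

/-- `Φ⁻ⁿ Φ'` is `Φ¹⁻ⁿ` times the bounded function `(log (-Φ))'`, and `log (-Φ)` grows at most
linearly. -/
theorem exists_bound_transformedIntegrand {n : ℕ} (hn : 1 ≤ n) {f Φ : ℂ → ℂ} {d : ℝ} (hd : 0 < d)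
    (hΦ : AnalyticOnNhd ℂ Φ (strip d)) (hΦray : ∀ w ∈ strip d, Φ w ∉ nonnegRay)
    {δ : ℝ} (hδ : 0 < δ) (hδΦ : ∀ v : ℝ, δ ≤ ‖Φ v‖) :
    ∃ K > 0, ∀ v : ℝ, ‖transformedIntegrand n f Φ v‖ ≤ K * (1 + |v|) * ‖f (Φ v)‖ := by
  set L : ℂ → ℂ := fun w => Complex.log (-Φ w) with hL
  set M := Real.exp Real.pi * (Real.exp Real.pi / (d / 2))
  have hM : 0 < M := by positivity
  have hLd : ∀ v : ℝ, DifferentiableAt ℂ L v := fun v =>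
    (analyticAt_log_neg (hΦ _ (ofReal_mem_strip hd v))
      (hΦray _ (ofReal_mem_strip hd v))).differentiableAt
  have hL' : ∀ v : ℝ, ‖deriv L v‖ ≤ M := norm_deriv_log_neg_le hd hΦ hΦray
  have hLgrow : ∀ v : ℝ, ‖L v‖ ≤ ‖L 0‖ + M * |v| := by
    intro v
    have h1 := Convex.norm_image_sub_le_of_norm_hasDerivWithin_le (f := fun v : ℝ => L v)
      (fun x _ => ((hLd x).hasDerivAt.comp_ofReal).hasDerivWithinAt) (fun x _ => hL' x)
      convex_univ (mem_univ 0) (mem_univ v)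
    rw [sub_zero, Real.norm_eq_abs] at h1
    have h2 := norm_le_norm_add_norm_sub' (L v) (L 0)
    simp only [Complex.ofReal_zero] at h1
    linarith
  refine ⟨M * (δ ^ (n - 1))⁻¹ * (‖L 0‖ + M), by positivity, fun v => ?_⟩
  have hstrip := ofReal_mem_strip hd v
  have h0 := ne_zero_of_notMem_nonnegRay (hΦray v hstrip)
  have hderiv : deriv Φ v = Φ v * deriv L v := by
    have h2 := ((hΦ v hstrip).differentiableAt.hasDerivAt.neg.clog
      (neg_mem_slitPlane_of_notMem_nonnegRay (hΦray v hstrip))).deriv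
    have h3 : deriv L v = -deriv Φ v / -Φ v := h2
    rw [h3, neg_div_neg_eq, mul_div_cancel₀ _ h0]
  have h3 : ‖Φ v‖ ^ (-(n : ℤ)) * ‖Φ v‖ ≤ (δ ^ (n - 1))⁻¹ := by
    have hp := norm_pos_iff.2 h0
    obtain ⟨m, rfl⟩ : ∃ m, n = m + 1 := ⟨n - 1, by omega⟩
    rw [zpow_neg, zpow_natCast, pow_succ, mul_inv, mul_assoc, inv_mul_cancel₀ hp.ne', mul_one,
      add_tsub_cancel_right]
    have := hδΦ v
    gcongr
  have h4 : ‖L v‖ ≤ (‖L 0‖ + M) * (1 + |v|) := by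
    have := hLgrow v
    nlinarith [norm_nonneg (L 0), abs_nonneg v, mul_nonneg (norm_nonneg (L 0)) (abs_nonneg v)]
  unfold transformedIntegrand
  rw [hderiv, norm_mul, norm_mul, norm_mul, norm_mul, norm_zpow]
  calc ‖Φ v‖ ^ (-(n : ℤ)) * ‖f (Φ v)‖ * ‖L v‖ * (‖Φ v‖ * ‖deriv L v‖)
      = (‖Φ v‖ ^ (-(n : ℤ)) * ‖Φ v‖) * ‖deriv L v‖ * ‖L v‖ * ‖f (Φ v)‖ := by ring
    _ ≤ (δ ^ (n - 1))⁻¹ * M * ((‖L 0‖ + M) * (1 + |v|)) * ‖f (Φ v)‖ := by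
        have := hL' v
        gcongr
    _ = _ := by ring

theorem one_add_mul_exp_le {c₁ c₂ : ℝ} (hc₁ : 0 < c₁) (hc₂ : 0 < c₂) :
    ∃ B > 0, ∀ x : ℝ, 0 ≤ x →
      (1 + x) * Real.exp (-c₁ * Real.exp (c₂ * x)) ≤ B * Real.exp (-x) := by
  set q := c₁ * c₂ ^ 2 / 2
  have hq : 0 < q := by positivity
  refine ⟨Real.exp (1 / q), Real.exp_pos _, fun x hx => ?_⟩
  have h1 : 1 + x ≤ Real.exp x := by linarith [Real.add_one_le_exp x]
  have h2 : (c₂ * x) ^ 2 / 2 ≤ Real.exp (c₂ * x) := by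
    have := Real.quadratic_le_exp_of_nonneg (mul_nonneg hc₂.le hx)
    nlinarith [mul_nonneg hc₂.le hx]
  -- `e^y ≥ y² / 2` is enough for the double exponential
  have h3 : 2 * x - q * x ^ 2 ≤ 1 / q := by
    rw [le_div_iff₀ hq]
    nlinarith [sq_nonneg (q * x - 1)]
  calc (1 + x) * Real.exp (-c₁ * Real.exp (c₂ * x))
      ≤ Real.exp x * Real.exp (-c₁ * Real.exp (c₂ * x)) := by gcongr
    _ = Real.exp (x + -c₁ * Real.exp (c₂ * x)) := by rw [Real.exp_add]
    _ ≤ Real.exp (1 / q + -x) := by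
        refine Real.exp_le_exp.2 ?_
        have : c₁ * ((c₂ * x) ^ 2 / 2) ≤ c₁ * Real.exp (c₂ * x) := by gcongr
        simp only [q] at h3 ⊢
        nlinarith
    _ = _ := Real.exp_add _ _

theorem integrable_exp_neg_abs : Integrable fun x : ℝ => Real.exp (-|x|) := by
  have h1 : IntegrableOn (fun x : ℝ => Real.exp (-|x|)) (Ioi 0) :=
    (integrableOn_exp_neg_Ioi 0).congr_fun (fun x hx => by
      simp only [abs_of_pos (mem_Ioi.1 hx)]) measurableSet_Ioi
  rw [← integrableOn_univ, ← Iic_union_Ioi (a := (0 : ℝ))]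
  refine IntegrableOn.union ?_ h1
  have := (integrableOn_exp_Iic 0).congr_fun (g := fun x : ℝ => Real.exp (-|x|)) (fun x hx => by
      simp only [abs_of_nonpos (mem_Iic.1 hx), neg_neg]) measurableSet_Iic
  exact this

theorem mul_sum_exp_neg_le_one (s : ℝ) (J : ℕ) :
    s * ∑ j ∈ Finset.range J, Real.exp (-s * (j + 1)) ≤ 1 := by
  have hstep : ∀ j : ℕ, s * Real.exp (-s * (j + 1)) ≤
      Real.exp (-s * j) - Real.exp (-s * (j + 1 : ℕ)) := by
    intro j
    have h1 : Real.exp (-s * j) = Real.exp (-s * (j + 1)) * Real.exp s := by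
      rw [← Real.exp_add]; congr 1; ring
    push_cast
    rw [h1]
    nlinarith [Real.add_one_le_exp s, Real.exp_pos (-s * (j + 1))]
  rw [Finset.mul_sum]
  refine (Finset.sum_le_sum fun j _ => hstep j).trans ?_
  rw [Finset.sum_range_sub' fun j : ℕ => Real.exp (-s * j)]
  simp [Real.exp_nonneg]

/-- The tail of a Riemann sum of a double exponentially decaying function is of the size of the
function at the truncation point, uniformly in the mesh. -/
theorem exists_tail_bound {c₁ c₂ : ℝ} (hc₁ : 0 < c₁) (hc₂ : 0 < c₂) :
    ∃ C > 0, ∀ h : ℝ, 0 < h → ∀ T : ℝ, 0 ≤ T → ∀ J : ℕ,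
      h * ∑ j ∈ Finset.range J, (1 + (T + (j + 1) * h)) *
        Real.exp (-c₁ * Real.exp (c₂ * (T + (j + 1) * h))) ≤
      C * Real.exp (-c₁ * Real.exp (c₂ * T)) := by
  set a₀ := c₁ * c₂
  have ha₀ : 0 < a₀ := mul_pos hc₁ hc₂
  set κ := (1 + 1 / c₂) / a₀
  have hκ : 0 < κ := by positivity
  refine ⟨2 * κ + 4 / a₀ ^ 2, by positivity, fun h hh T hT J => ?_⟩
  -- beyond `T` the function decays at least at the rate `a`; as `a` grows linearly with `T`, the
  -- factor `1 / a` from the geometric sum compensates the factor `1 + T`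
  set a := a₀ * (1 + c₂ * T)
  have ha : a₀ ≤ a := le_mul_of_one_le_right ha₀.le (by nlinarith)
  have ha' : 0 < a := ha₀.trans_le ha
  set E := Real.exp (-c₁ * Real.exp (c₂ * T))
  have hterm : ∀ t : ℝ, 0 ≤ t → (1 + (T + t)) * Real.exp (-c₁ * Real.exp (c₂ * (T + t))) ≤
      E * ((κ * a + 2 / a) * Real.exp (-(a / 2) * t)) := by
    intro t ht
    have h1 : Real.exp (c₂ * T) + (1 + c₂ * T) * (c₂ * t) ≤ Real.exp (c₂ * (T + t)) := by
      rw [mul_add, Real.exp_add]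
      have h2 := Real.add_one_le_exp (c₂ * T)
      have h3 := Real.add_one_le_exp (c₂ * t)
      have h4 : 0 ≤ c₂ * t := by positivity
      nlinarith [Real.exp_pos (c₂ * T)]
    have h2 : Real.exp (-c₁ * Real.exp (c₂ * (T + t))) ≤ E * Real.exp (-a * t) := by
      rw [← Real.exp_add]
      refine Real.exp_le_exp.2 ?_
      simp only [a, a₀]
      nlinarith
    have h3 : 1 + T ≤ κ * a := by
      have : κ * a = (1 + 1 / c₂) * (1 + c₂ * T) := by simp only [κ, a]; field_simp
      rw [this]
      have h5 : (1 + 1 / c₂) * (1 + c₂ * T) = 1 + T + 1 / c₂ + c₂ * T := by field_simp; ring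
      rw [h5]
      have : 0 ≤ 1 / c₂ := by positivity
      nlinarith
    have h4 : t ≤ 2 / a * Real.exp (a / 2 * t) := by
      have := Real.add_one_le_exp (a / 2 * t)
      calc t = 2 / a * (a / 2 * t) := by field_simp
        _ ≤ _ := by gcongr; linarith
    have h5 : (1 + (T + t)) * Real.exp (-a * t) ≤ (κ * a + 2 / a) * Real.exp (-(a / 2) * t) := by
      have e1 : Real.exp (-a * t) ≤ Real.exp (-(a / 2) * t) :=
        Real.exp_le_exp.2 (by nlinarith)
      have e2 : Real.exp (a / 2 * t) * Real.exp (-a * t) = Real.exp (-(a / 2) * t) := by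
        rw [← Real.exp_add]; congr 1; ring
      calc (1 + (T + t)) * Real.exp (-a * t)
          = (1 + T) * Real.exp (-a * t) + t * Real.exp (-a * t) := by ring
        _ ≤ κ * a * Real.exp (-(a / 2) * t) + 2 / a * Real.exp (a / 2 * t) * Real.exp (-a * t) := by
            gcongr
        _ = _ := by rw [mul_assoc (2 / a), e2]; ring
    calc _ ≤ (1 + (T + t)) * (E * Real.exp (-a * t)) := by gcongr
      _ = E * ((1 + (T + t)) * Real.exp (-a * t)) := by ring
      _ ≤ _ := by gcongr
  have hgeo := mul_sum_exp_neg_le_one (a / 2 * h) J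
  calc _ ≤ h * ∑ j ∈ Finset.range J, E * ((κ * a + 2 / a) * Real.exp (-(a / 2 * h) * (j + 1))) := by
        refine mul_le_mul_of_nonneg_left (Finset.sum_le_sum fun j _ => ?_) hh.le
        refine (hterm ((j + 1) * h) (by positivity)).trans (le_of_eq ?_)
        congr 3; ring
    _ = E * ((κ * a + 2 / a) * (2 / a)) *
        (a / 2 * h * ∑ j ∈ Finset.range J, Real.exp (-(a / 2 * h) * (j + 1))) := by
        simp_rw [← Finset.mul_sum]
        field_simp
    _ ≤ E * ((κ * a + 2 / a) * (2 / a)) * 1 := by gcongr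
    _ ≤ E * (2 * κ + 4 / a₀ ^ 2) := by
        rw [mul_one]
        refine mul_le_mul_of_nonneg_left ?_ (Real.exp_nonneg _)
        have : (κ * a + 2 / a) * (2 / a) = 2 * κ + 4 / a ^ 2 := by field_simp; ring
        rw [this]
        gcongr
    _ = _ := mul_comm _ _

/-! ### Contour integrals against the periodic Cauchy kernel -/

/-- The integral of `G` over the boundary of the rectangle `x₁ < Re w < x₂`, `|Im w| < b`,
described counterclockwise. -/
noncomputable def rectIntegral (G : ℂ → ℂ) (x₁ x₂ b : ℝ) : ℂ :=
  (∫ x in x₁..x₂, G ((x : ℂ) - (b : ℂ) * Complex.I))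
    - (∫ x in x₁..x₂, G ((x : ℂ) + (b : ℂ) * Complex.I))
    + Complex.I * (∫ y in (-b)..b, G ((x₂ : ℂ) + (y : ℂ) * Complex.I))
    - Complex.I * (∫ y in (-b)..b, G ((x₁ : ℂ) + (y : ℂ) * Complex.I))

theorem rectIntegral_eq_zero {G : ℂ → ℂ} {x₁ x₂ b : ℝ}
    (hG : DifferentiableOn ℂ G (uIcc x₁ x₂ ×ℂ uIcc (-b) b)) : rectIntegral G x₁ x₂ b = 0 := by
  have := Complex.integral_boundary_rect_eq_zero_of_differentiableOn G ⟨x₁, -b⟩ ⟨x₂, b⟩ hG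
  simp only [smul_eq_mul] at this
  rw [← this]
  unfold rectIntegral
  simp only [Complex.ofReal_neg, neg_mul, sub_eq_add_neg]

/-- The exponential of period `P`, equal to `1` at `c`. -/
noncomputable def periodicExp (P : ℝ) (c w : ℂ) : ℂ :=
  Complex.exp (-(2 * Real.pi * Complex.I) * (w - c) / P)

/-- The periodic Cauchy kernel: it has period `P`, a simple pole at `c` with residue `P / (2πi)`, and
tends to `1` and to `0` at the lower and the upper end of the period strip. -/
noncomputable def periodicKernel (P : ℝ) (c w : ℂ) : ℂ := (1 - periodicExp P c w)⁻¹

section Kernel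

variable {P : ℝ} {c : ℂ}

theorem norm_periodicExp (P : ℝ) (c w : ℂ) :
    ‖periodicExp P c w‖ = Real.exp (2 * Real.pi * (w - c).im / P) := by
  unfold periodicExp
  rw [Complex.norm_exp]
  congr 1
  rw [Complex.div_ofReal_re]
  simp

theorem periodicExp_ne_zero (w : ℂ) : periodicExp P c w ≠ 0 := Complex.exp_ne_zero _

theorem periodicExp_self : periodicExp P c c = 1 := by simp [periodicExp]

theorem periodicExp_add_period (hP : 0 < P) (w : ℂ) :
    periodicExp P c (w + P) = periodicExp P c w := by
  unfold periodicExp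
  have hP' : (P : ℂ) ≠ 0 := by exact_mod_cast hP.ne'
  have : -(2 * Real.pi * Complex.I) * (w + P - c) / P =
      -(2 * Real.pi * Complex.I) * (w - c) / P - 2 * Real.pi * Complex.I := by
    field_simp; ring
  rw [this, Complex.exp_sub, Complex.exp_two_pi_mul_I, div_one]

theorem hasDerivAt_periodicExp (P : ℝ) (c w : ℂ) : HasDerivAt (periodicExp P c)
    (-(2 * Real.pi * Complex.I) / P * periodicExp P c w) w := by
  have h1 : HasDerivAt (fun w : ℂ => -(2 * Real.pi * Complex.I) * (w - c) / P)
      (-(2 * Real.pi * Complex.I) / P) w := by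
    simpa using (((hasDerivAt_id w).sub_const c).const_mul (-(2 * Real.pi * Complex.I))).div_const
      (P : ℂ)
  have := h1.cexp
  convert! this using 1
  exact mul_comm _ _

theorem continuous_periodicExp : Continuous (periodicExp P c) :=
  continuous_iff_continuousAt.2 fun w => (hasDerivAt_periodicExp P c w).continuousAt

theorem eq_of_periodicExp_eq_one (hP : 0 < P) {w : ℂ} (hw : periodicExp P c w = 1)
    (hre : |(w - c).re| < P) : w = c := by
  obtain ⟨k, hk⟩ := Complex.exp_eq_one_iff.1 hw
  have hP' : (P : ℂ) ≠ 0 := by exact_mod_cast hP.ne'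
  have h2 : w - c = -(k * P : ℝ) := by
    have h3 := Complex.two_pi_I_ne_zero
    rw [div_eq_iff hP'] at hk
    push_cast
    have : (2 * Real.pi * Complex.I) * (w - c + k * P) = 0 := by linear_combination -hk
    rcases mul_eq_zero.1 this with h | h
    · exact absurd h h3
    · linear_combination h
  have h3 : k = 0 := by
    rw [h2, Complex.neg_re, Complex.ofReal_re, abs_neg, abs_mul, abs_of_pos hP] at hre
    have h4 : |(k : ℝ)| < 1 := by
      by_contra! h
      nlinarith
    have : |k| < 1 := by exact_mod_cast h4
    exact Int.abs_lt_one_iff.1 this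
  rw [h3] at h2
  simpa [sub_eq_zero] using h2

/-- A primitive of the kernel on a horizontal line below the pole, where `|periodicExp| < 1`. -/
theorem hasDerivAt_horizontal_log {P : ℝ} (hP : 0 < P) {c : ℂ} {t x : ℝ} (h : t < c.im) :
    HasDerivAt (fun x : ℝ => (x : ℂ) + P / (2 * Real.pi * Complex.I) *
        Complex.log (1 - periodicExp P c (x + t * Complex.I)))
      (periodicKernel P c (x + t * Complex.I)) x := by
  set w : ℂ := x + t * Complex.I
  have hP' : (P : ℂ) ≠ 0 := by exact_mod_cast hP.ne'
  have hq : ‖periodicExp P c w‖ < 1 := by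
    rw [norm_periodicExp, Real.exp_lt_one_iff]
    have : (w - c).im = t - c.im := by simp [w]
    rw [this]
    exact div_neg_of_neg_of_pos (mul_neg_of_pos_of_neg Real.two_pi_pos (by linarith)) hP
  have hsl : 1 - periodicExp P c w ∈ Complex.slitPlane := by
    left
    have := (Complex.re_le_norm (periodicExp P c w)).trans_lt hq
    simp; linarith
  have hw : HasDerivAt (fun x : ℝ => (x : ℂ) + t * Complex.I) 1 x :=
    (HasDerivAt.ofReal_comp (hasDerivAt_id x)).add_const _
  have h1 := ((hasDerivAt_periodicExp P c w).comp x hw).const_sub 1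
  have h2 := (HasDerivAt.ofReal_comp (hasDerivAt_id x)).add
    ((h1.clog_real hsl).const_mul (P / (2 * Real.pi * Complex.I) : ℂ))
  convert! h2 using 1
  unfold periodicKernel
  have h3 := Complex.slitPlane_ne_zero hsl
  have h4 : (Real.pi : ℂ) ≠ 0 := by exact_mod_cast Real.pi_ne_zero
  simp only [Function.comp, Complex.ofReal_one, mul_one]
  change _ = 1 + (P : ℂ) / (2 * Real.pi * Complex.I) *
    (-(-(2 * Real.pi * Complex.I) / P * periodicExp P c w) / (1 - periodicExp P c w))
  field_simp
  ring

/-- A primitive of the kernel on a horizontal line above the pole, where `|periodicExp| > 1`. -/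
theorem hasDerivAt_horizontal_log_inv {P : ℝ} (hP : 0 < P) {c : ℂ} {t x : ℝ} (h : c.im < t) :
    HasDerivAt (fun x : ℝ => P / (2 * Real.pi * Complex.I) *
        Complex.log (1 - (periodicExp P c (x + t * Complex.I))⁻¹))
      (periodicKernel P c (x + t * Complex.I)) x := by
  set w : ℂ := x + t * Complex.I
  have hP' : (P : ℂ) ≠ 0 := by exact_mod_cast hP.ne'
  have hq0 : periodicExp P c w ≠ 0 := periodicExp_ne_zero w
  have hq : ‖(periodicExp P c w)⁻¹‖ < 1 := by
    rw [norm_inv, norm_periodicExp, ← Real.exp_neg, Real.exp_lt_one_iff]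
    have : (w - c).im = t - c.im := by simp [w]
    rw [this, neg_lt_zero]
    exact div_pos (mul_pos Real.two_pi_pos (by linarith)) hP
  have hsl : 1 - (periodicExp P c w)⁻¹ ∈ Complex.slitPlane := by
    left
    have := (Complex.re_le_norm (periodicExp P c w)⁻¹).trans_lt hq
    rw [Complex.sub_re, Complex.one_re]; linarith
  have hw : HasDerivAt (fun x : ℝ => (x : ℂ) + t * Complex.I) 1 x :=
    (HasDerivAt.ofReal_comp (hasDerivAt_id x)).add_const _
  have h0 : HasDerivAt (fun x : ℝ => periodicExp P c ((x : ℂ) + t * Complex.I))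
      (-(2 * Real.pi * Complex.I) / P * periodicExp P c w * 1) x := by
    have := (hasDerivAt_periodicExp P c w).comp x hw
    exact this
  have h1 := (h0.fun_inv hq0).const_sub 1
  have h2 := (h1.clog_real hsl).const_mul (P / (2 * Real.pi * Complex.I) : ℂ)
  convert! h2 using 1
  unfold periodicKernel
  have h3 := Complex.slitPlane_ne_zero hsl
  have h4 : (Real.pi : ℂ) ≠ 0 := by exact_mod_cast Real.pi_ne_zero
  have h5 : 1 - periodicExp P c w ≠ 0 := by
    intro h
    rw [← sub_eq_zero.1 h, inv_one, sub_self] at h3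
    exact h3 rfl
  have h6 : periodicExp P c w - 1 ≠ 0 := by rw [← neg_ne_zero, neg_sub]; exact h5
  simp only [mul_one]
  change _ = (P : ℂ) / (2 * Real.pi * Complex.I) *
    (-(-(-(2 * Real.pi * Complex.I) / P * periodicExp P c w) / periodicExp P c w ^ 2)
      / (1 - (periodicExp P c w)⁻¹))
  have h7 : 1 - (periodicExp P c w)⁻¹ = -(1 - periodicExp P c w) / periodicExp P c w := by
    field_simp; ring
  rw [h7]
  field_simp

theorem periodicExp_ne_one_of_im_ne (hP : 0 < P) {w : ℂ} (h : w.im ≠ c.im) :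
    periodicExp P c w ≠ 1 := by
  intro h1
  have h2 := norm_periodicExp P c w
  rw [h1, norm_one, eq_comm, Real.exp_eq_one_iff, div_eq_zero_iff, mul_eq_zero] at h2
  rcases h2 with (h2 | h2) | h2
  · exact Real.two_pi_pos.ne' h2
  · rw [Complex.sub_im, sub_eq_zero] at h2; exact h h2
  · exact hP.ne' h2

theorem continuousAt_periodicKernel {w : ℂ} (h : periodicExp P c w ≠ 1) :
    ContinuousAt (periodicKernel P c) w :=
  (continuousAt_const.sub continuous_periodicExp.continuousAt).inv₀ (sub_ne_zero.2 h.symm)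

theorem continuous_periodicKernel_horizontal (hP : 0 < P) {t : ℝ} (h : t ≠ c.im) :
    Continuous fun x : ℝ => periodicKernel P c (x + t * Complex.I) := by
  refine continuous_iff_continuousAt.2 fun x => ?_
  refine ContinuousAt.comp (g := periodicKernel P c)
    (continuousAt_periodicKernel (periodicExp_ne_one_of_im_ne hP ?_)) (by fun_prop)
  simpa using h

theorem integral_periodicKernel_of_lt (hP : 0 < P) {t : ℝ} (h : t < c.im) (x₁ : ℝ) :
    ∫ x in x₁..(x₁ + P), periodicKernel P c (x + t * Complex.I) = P := by
  rw [intervalIntegral.integral_eq_sub_of_hasDerivAt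
    (fun x _ => hasDerivAt_horizontal_log hP h)
    ((continuous_periodicKernel_horizontal hP h.ne).intervalIntegrable _ _)]
  have : ((x₁ + P : ℝ) : ℂ) + t * Complex.I = (x₁ + t * Complex.I) + P := by push_cast; ring
  rw [this, periodicExp_add_period hP]
  push_cast; ring

theorem integral_periodicKernel_of_gt (hP : 0 < P) {t : ℝ} (h : c.im < t) (x₁ : ℝ) :
    ∫ x in x₁..(x₁ + P), periodicKernel P c (x + t * Complex.I) = 0 := by
  rw [intervalIntegral.integral_eq_sub_of_hasDerivAt
    (fun x _ => hasDerivAt_horizontal_log_inv hP h)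
    ((continuous_periodicKernel_horizontal hP h.ne').intervalIntegrable _ _)]
  have : ((x₁ + P : ℝ) : ℂ) + t * Complex.I = (x₁ + t * Complex.I) + P := by push_cast; ring
  rw [this, periodicExp_add_period hP]
  ring

theorem periodicKernel_add_period (hP : 0 < P) (w : ℂ) :
    periodicKernel P c (w + P) = periodicKernel P c w := by
  unfold periodicKernel; rw [periodicExp_add_period hP]

theorem rectIntegral_periodicKernel (hP : 0 < P) {x₁ b : ℝ} (hb : |c.im| < b) :
    rectIntegral (periodicKernel P c) x₁ (x₁ + P) b = P := by
  obtain ⟨h1, h2⟩ := abs_lt.1 hb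
  unfold rectIntegral
  have e1 := integral_periodicKernel_of_lt hP (t := -b) h1 x₁
  have e2 := integral_periodicKernel_of_gt hP (t := b) h2 x₁
  simp only [Complex.ofReal_neg, neg_mul, ← sub_eq_add_neg] at e1
  have e3 : ∀ y : ℝ, periodicKernel P c (((x₁ + P : ℝ) : ℂ) + y * Complex.I) =
      periodicKernel P c ((x₁ : ℂ) + y * Complex.I) := by
    intro y
    rw [← periodicKernel_add_period hP ((x₁ : ℂ) + y * Complex.I)]
    congr 1
    push_cast; ring
  rw [e1, e2]
  simp only [e3]
  ring

/-- Continuity on the boundary of a rectangle is all that is needed for additivity. -/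
theorem rectIntegral_add {G₁ G₂ : ℂ → ℂ} {x₁ x₂ b : ℝ} {S : Set ℂ}
    (h₁ : ∀ w ∈ S, ContinuousAt G₁ w) (h₂ : ∀ w ∈ S, ContinuousAt G₂ w)
    (hS₁ : ∀ x ∈ uIcc x₁ x₂, (x : ℂ) - b * Complex.I ∈ S ∧ (x : ℂ) + b * Complex.I ∈ S)
    (hS₂ : ∀ y ∈ uIcc (-b) b, (x₁ : ℂ) + y * Complex.I ∈ S ∧ (x₂ : ℂ) + y * Complex.I ∈ S) :
    rectIntegral (fun w => G₁ w + G₂ w) x₁ x₂ b =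
      rectIntegral G₁ x₁ x₂ b + rectIntegral G₂ x₁ x₂ b := by
  have hc : ∀ {G : ℂ → ℂ}, (∀ w ∈ S, ContinuousAt G w) → ∀ {γ : ℝ → ℂ} {s t : ℝ},
      Continuous γ → (∀ x ∈ uIcc s t, γ x ∈ S) →
      IntervalIntegrable (fun x => G (γ x)) volume s t := by
    intro G hG γ s t hγ hS
    exact ContinuousOn.intervalIntegrable fun x hx =>
      (ContinuousAt.comp (hG _ (hS x hx)) hγ.continuousAt).continuousWithinAt
  unfold rectIntegral
  rw [intervalIntegral.integral_add (hc h₁ (by fun_prop) fun x hx => (hS₁ x hx).1)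
      (hc h₂ (by fun_prop) fun x hx => (hS₁ x hx).1),
    intervalIntegral.integral_add (hc h₁ (by fun_prop) fun x hx => (hS₁ x hx).2)
      (hc h₂ (by fun_prop) fun x hx => (hS₁ x hx).2),
    intervalIntegral.integral_add (hc h₁ (by fun_prop) fun x hx => (hS₂ x hx).1)
      (hc h₂ (by fun_prop) fun x hx => (hS₂ x hx).1),
    intervalIntegral.integral_add (hc h₁ (by fun_prop) fun x hx => (hS₂ x hx).2)
      (hc h₂ (by fun_prop) fun x hx => (hS₂ x hx).2)]
  ring

theorem rectIntegral_const_mul (a : ℂ) (G : ℂ → ℂ) (x₁ x₂ b : ℝ) :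
    rectIntegral (fun w => a * G w) x₁ x₂ b = a * rectIntegral G x₁ x₂ b := by
  unfold rectIntegral
  simp only [intervalIntegral.integral_const_mul]
  ring

theorem rectIntegral_congr {G₁ G₂ : ℂ → ℂ} {x₁ x₂ b : ℝ} {S : Set ℂ}
    (h : ∀ w ∈ S, G₁ w = G₂ w)
    (hS₁ : ∀ x ∈ uIcc x₁ x₂, (x : ℂ) - b * Complex.I ∈ S ∧ (x : ℂ) + b * Complex.I ∈ S)
    (hS₂ : ∀ y ∈ uIcc (-b) b, (x₁ : ℂ) + y * Complex.I ∈ S ∧ (x₂ : ℂ) + y * Complex.I ∈ S) :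
    rectIntegral G₁ x₁ x₂ b = rectIntegral G₂ x₁ x₂ b := by
  unfold rectIntegral
  rw [intervalIntegral.integral_congr fun x hx => h _ (hS₁ x hx).1,
    intervalIntegral.integral_congr fun x hx => h _ (hS₁ x hx).2,
    intervalIntegral.integral_congr fun x hx => h _ (hS₂ x hx).1,
    intervalIntegral.integral_congr fun x hx => h _ (hS₂ x hx).2]

/-- Cauchy's integral formula with the periodic kernel, on a rectangle whose width is exactly one
period. -/
theorem rectIntegral_mul_periodicKernel (hP : 0 < P) {x₁ b d : ℝ} (hbd : b < d) (hb : |c.im| < b)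
    (hc₁ : x₁ < c.re) (hc₂ : c.re < x₁ + P) {g : ℂ → ℂ} (hg : DifferentiableOn ℂ g (strip d)) :
    rectIntegral (fun w => g w * periodicKernel P c w) x₁ (x₁ + P) b = P * g c := by
  have hb0 : 0 < b := (abs_nonneg _).trans_lt hb
  have hle : x₁ ≤ x₁ + P := by linarith
  have hcd : c ∈ strip d := hb.trans hbd
  have hopen := isOpen_strip d
  have hstrip : ∀ w ∈ uIcc x₁ (x₁ + P) ×ℂ uIcc (-b) b, w ∈ strip d := by
    intro w hw
    have h2 := hw.2
    rw [mem_preimage, uIcc_of_le (by linarith), mem_Icc, ← abs_le] at h2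
    exact h2.trans_lt hbd
  have hne1 : ∀ w ∈ uIcc x₁ (x₁ + P) ×ℂ uIcc (-b) b, w ≠ c → periodicExp P c w ≠ 1 := by
    intro w hw hwc h
    have h1 := hw.1
    rw [mem_preimage, uIcc_of_le hle] at h1
    refine hwc (eq_of_periodicExp_eq_one hP h ?_)
    rw [Complex.sub_re, abs_lt]
    constructor <;> linarith [h1.1, h1.2]
  -- the closed rectangle without the pole, which contains the boundary
  set S : Set ℂ := {w | w ∈ uIcc x₁ (x₁ + P) ×ℂ uIcc (-b) b ∧ w ≠ c}
  have hmem : ∀ x ∈ uIcc x₁ (x₁ + P), ∀ y ∈ uIcc (-b) b,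
      (x : ℂ) + y * Complex.I ∈ uIcc x₁ (x₁ + P) ×ℂ uIcc (-b) b := by
    intro x hx y hy
    exact ⟨by simpa using hx, by simpa using hy⟩
  have hS₁ : ∀ x ∈ uIcc x₁ (x₁ + P),
      (x : ℂ) - b * Complex.I ∈ S ∧ (x : ℂ) + b * Complex.I ∈ S := by
    intro x hx
    obtain ⟨h1, h2⟩ := abs_lt.1 hb
    refine ⟨⟨?_, fun h => ?_⟩, ⟨hmem x hx b right_mem_uIcc, fun h => ?_⟩⟩
    · have := hmem x hx (-b) left_mem_uIcc
      simpa [sub_eq_add_neg] using this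
    · rw [← h] at h1; simp at h1
    · rw [← h] at h2; simp at h2
  have hS₂ : ∀ y ∈ uIcc (-b) b,
      (x₁ : ℂ) + y * Complex.I ∈ S ∧ ((x₁ + P : ℝ) : ℂ) + y * Complex.I ∈ S := by
    intro y hy
    refine ⟨⟨hmem _ left_mem_uIcc y hy, fun h => ?_⟩, ⟨hmem _ right_mem_uIcc y hy, fun h => ?_⟩⟩
    · rw [← h] at hc₁; simp at hc₁
    · rw [← h] at hc₂; simp at hc₂
  have hq : DifferentiableOn ℂ (fun w => 1 - periodicExp P c w) (strip d) := fun w _ =>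
    ((hasDerivAt_periodicExp P c w).const_sub 1).differentiableAt.differentiableWithinAt
  have hA : DifferentiableOn ℂ (dslope g c) (strip d) :=
    (Complex.differentiableOn_dslope (hopen.mem_nhds hcd)).2 hg
  have hB : DifferentiableOn ℂ (dslope (fun w => 1 - periodicExp P c w) c) (strip d) :=
    (Complex.differentiableOn_dslope (hopen.mem_nhds hcd)).2 hq
  have hB0 : ∀ w ∈ uIcc x₁ (x₁ + P) ×ℂ uIcc (-b) b,
      dslope (fun w => 1 - periodicExp P c w) c w ≠ 0 := by
    intro w hw
    by_cases h : w = c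
    · rw [h, dslope_same, ((hasDerivAt_periodicExp P c c).const_sub 1).deriv, periodicExp_self,
        mul_one, neg_ne_zero]
      exact div_ne_zero (neg_ne_zero.2 Complex.two_pi_I_ne_zero) (by exact_mod_cast hP.ne')
    · rw [dslope_of_ne _ h, slope_def_field, periodicExp_self, sub_self, sub_zero]
      exact div_ne_zero (sub_ne_zero.2 (hne1 w hw h).symm) (sub_ne_zero.2 h)
  -- `(g - g c)` times the kernel extends over the pole as a quotient of difference quotients
  have hzero : rectIntegral (fun w => dslope g c w / dslope (fun w => 1 - periodicExp P c w) c w)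
      x₁ (x₁ + P) b = 0 :=
    rectIntegral_eq_zero ((hA.mono hstrip).div (hB.mono hstrip) hB0)
  have hcongr : rectIntegral (fun w => g w * periodicKernel P c w) x₁ (x₁ + P) b =
      rectIntegral (fun w => dslope g c w / dslope (fun w => 1 - periodicExp P c w) c w +
        g c * periodicKernel P c w) x₁ (x₁ + P) b := by
    refine rectIntegral_congr (S := S) (fun w hw => ?_) hS₁ hS₂
    have h1 := sub_ne_zero.2 hw.2
    have h2 : 1 - periodicExp P c w ≠ 0 := sub_ne_zero.2 (hne1 w hw.1 hw.2).symm
    rw [dslope_of_ne _ hw.2, dslope_of_ne _ hw.2, slope_def_field, slope_def_field,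
      periodicExp_self, sub_self, sub_zero, periodicKernel]
    field_simp
    ring
  rw [hcongr, rectIntegral_add (S := S) (fun w hw => ?_) (fun w hw => ?_) hS₁ hS₂, hzero,
    rectIntegral_const_mul, rectIntegral_periodicKernel hP hb, zero_add, mul_comm]
  · have hn := hopen.mem_nhds (hstrip w hw.1)
    exact ((hA.differentiableAt hn).continuousAt).div ((hB.differentiableAt hn).continuousAt)
      (hB0 w hw.1)
  · exact continuousAt_const.mul (continuousAt_periodicKernel (hne1 w hw.1 hw.2))

end Kernel

/-! ### Boundedness and decay on smaller strips -/

section Bound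

variable {g : ℂ → ℂ} {d : ℝ}

theorem horizontal_mem_strip {b : ℝ} (hb : |b| < d) (x : ℝ) :
    (x : ℂ) + b * Complex.I ∈ strip d := by simpa [strip] using hb

theorem continuous_horizontal (hg : DifferentiableOn ℂ g (strip d)) {b : ℝ} (hb : |b| < d) :
    Continuous fun x : ℝ => g ((x : ℂ) + b * Complex.I) :=
  hg.continuousOn.comp_continuous (by fun_prop) (horizontal_mem_strip hb)

theorem continuous_horizontal' (hg : DifferentiableOn ℂ g (strip d)) {b : ℝ} (hb : |b| < d) :
    Continuous fun x : ℝ => g ((x : ℂ) - b * Complex.I) := by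
  have := continuous_horizontal hg (b := -b) (by rwa [abs_neg])
  simpa [← sub_eq_add_neg] using this

theorem continuousOn_vertical (hg : DifferentiableOn ℂ g (strip d)) {b : ℝ} (hbd : b < d) (z : ℝ) :
    ContinuousOn (fun y : ℝ => g ((z : ℂ) + y * Complex.I)) (Icc (-b) b) :=
  hg.continuousOn.comp (by fun_prop) fun _ hy =>
    horizontal_mem_strip ((abs_le.2 hy).trans_lt hbd) z

/-- An integral over the boundary of a rectangle, with the integrand dominated by `κ ‖g‖`. -/
theorem norm_rectIntegral_le (hg : DifferentiableOn ℂ g (strip d)) {G : ℂ → ℂ} {a b κ : ℝ}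
    (ha : 0 ≤ a) (hb : 0 ≤ b) (hbd : b < d)
    (h₁ : ∀ x : ℝ, ‖G ((x : ℂ) - b * Complex.I)‖ ≤ κ * ‖g ((x : ℂ) - b * Complex.I)‖)
    (h₂ : ∀ x : ℝ, ‖G ((x : ℂ) + b * Complex.I)‖ ≤ κ * ‖g ((x : ℂ) + b * Complex.I)‖)
    (h₃ : ∀ y : ℝ, ‖G ((a : ℂ) + y * Complex.I)‖ ≤ κ * ‖g ((a : ℂ) + y * Complex.I)‖)
    (h₄ : ∀ y : ℝ, ‖G (-(a : ℂ) + y * Complex.I)‖ ≤ κ * ‖g (-(a : ℂ) + y * Complex.I)‖) :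
    ‖rectIntegral G (-a) a b‖ ≤ κ * rectBoundaryIntegral g a b := by
  have hb' : |b| < d := by rwa [abs_of_nonneg hb]
  have hleb : -b ≤ b := by linarith
  have hlea : -a ≤ a := by linarith
  have key : ∀ {u v : ℝ → ℂ} {s t : ℝ}, s ≤ t → (∀ x, ‖u x‖ ≤ κ * ‖v x‖) →
      IntervalIntegrable (fun x => ‖v x‖) volume s t →
      ‖∫ x in s..t, u x‖ ≤ κ * ∫ x in s..t, ‖v x‖ := by
    intro u v s t hst huv hv
    rw [← intervalIntegral.integral_const_mul]
    exact intervalIntegral.norm_integral_le_of_norm_le hst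
      (Eventually.of_forall fun x _ => huv x) (hv.const_mul _)
  have hv : ∀ z : ℝ, IntervalIntegrable (fun y : ℝ => ‖g ((z : ℂ) + y * Complex.I)‖) volume (-b) b :=
    fun z => ContinuousOn.intervalIntegrable
      (by rw [uIcc_of_le hleb]; exact (continuousOn_vertical hg hbd z).norm)
  have e1 := key hlea h₁ ((continuous_horizontal' hg hb').norm.intervalIntegrable _ _)
  have e2 := key hlea h₂ ((continuous_horizontal hg hb').norm.intervalIntegrable _ _)
  have e3 := key hleb h₃ (hv a)
  have e4 := key hleb h₄ (by simpa using hv (-a))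
  unfold rectIntegral rectBoundaryIntegral
  rw [Complex.ofReal_neg]
  refine (norm_sub_le _ _).trans ?_
  rw [norm_mul, Complex.norm_I, one_mul]
  have e5 := norm_add_le ((∫ x in (-a)..a, G ((x : ℂ) - b * Complex.I)) -
    ∫ x in (-a)..a, G ((x : ℂ) + b * Complex.I))
    (Complex.I * ∫ y in (-b)..b, G ((a : ℂ) + y * Complex.I))
  rw [norm_mul, Complex.norm_I, one_mul] at e5
  have e6 := norm_sub_le (∫ x in (-a)..a, G ((x : ℂ) - b * Complex.I))
    (∫ x in (-a)..a, G ((x : ℂ) + b * Complex.I))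
  linarith

/-- At vertical distance `η` from the pole the kernel of a large period `P` is at most `P / η`, as the
kernel `P / (2πi (w - c))` to which it is close suggests. -/
theorem norm_periodicKernel_le_of_im {P η : ℝ} (hη : 0 < η) (hP : 2 * Real.pi * η ≤ P) {c w : ℂ}
    (h : η ≤ |(w - c).im|) : ‖periodicKernel P c w‖ ≤ P / η := by
  have hpi := Real.pi_gt_three
  have hP0 : 0 < P := lt_of_lt_of_le (by positivity) hP
  rw [periodicKernel, norm_inv, ← inv_div]
  refine inv_anti₀ (div_pos hη hP0) ?_
  have hq := norm_periodicExp P c w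
  set t := (w - c).im
  have hx0 : η / P ≤ Real.pi * η / P := by
    rw [div_le_div_iff_of_pos_right hP0]; nlinarith
  rcases le_abs.1 h with ht | ht
  · have h1 := norm_sub_norm_le (periodicExp P c w) 1
    rw [norm_one, hq, norm_sub_rev] at h1
    have h2 := Real.add_one_le_exp (2 * Real.pi * t / P)
    have h3 : η / P ≤ 2 * Real.pi * t / P := by
      rw [div_le_div_iff_of_pos_right hP0]; nlinarith
    linarith
  · have h1 := norm_sub_norm_le 1 (periodicExp P c w)
    rw [norm_one, hq] at h1
    set x := 2 * Real.pi * η / P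
    have hx : 0 < x := by positivity
    have hx1 : x ≤ 1 := (div_le_one hP0).2 hP
    have h2 : Real.exp (2 * Real.pi * t / P) ≤ Real.exp (-x) := by
      refine Real.exp_le_exp.2 ?_
      simp only [x]
      rw [← neg_div, div_le_div_iff_of_pos_right hP0]
      nlinarith
    have h3 : Real.exp (-x) ≤ 1 - x / 2 := by
      rw [Real.exp_neg]
      refine inv_le_of_inv_le₀ (by linarith) ?_
      refine le_trans ?_ (Real.add_one_le_exp x)
      rw [inv_le_comm₀ (by linarith) (by linarith), inv_eq_one_div, div_le_iff₀ (by linarith)]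
      nlinarith
    have h4 : x / 2 = Real.pi * η / P := by simp only [x]; ring
    linarith

theorem norm_periodicKernel_le_one {P : ℝ} {c w : ℂ}
    (h : Real.cos (2 * Real.pi * (w - c).re / P) ≤ 0) : ‖periodicKernel P c w‖ ≤ 1 := by
  rw [periodicKernel, norm_inv]
  refine inv_le_one_of_one_le₀ (le_trans ?_ (Complex.re_le_norm _))
  have : (periodicExp P c w).re ≤ 0 := by
    unfold periodicExp
    rw [Complex.exp_re]
    refine mul_nonpos_of_nonneg_of_nonpos (Real.exp_nonneg _) ?_
    rw [Complex.div_ofReal_im]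
    have e : (-(2 * Real.pi * Complex.I) * (w - c)).im = -(2 * Real.pi * (w - c).re) := by simp
    rw [e, neg_div, Real.cos_neg]
    exact h
  rw [Complex.sub_re, Complex.one_re]
  linarith

/-- A function with finite boundary norm is bounded on smaller strips: represent it by an integral
over the boundary of a large rectangle, against the kernel whose period is the width of the
rectangle. Contrary to the Cauchy kernel, this one needs no separate discussion on the vertical
sides, where it is bounded. -/
theorem exists_bound_substrip (hg : DifferentiableOn ℂ g (strip d)) {N : ℝ}
    (hN : HasBoundaryNorm g d N) {b : ℝ} (hb : 0 ≤ b) (hbd : b < d) :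
    ∃ M, ∀ w : ℂ, |w.im| ≤ b → ‖g w‖ ≤ M := by
  set η := (d - b) / 2
  have hη : 0 < η := by simp only [η]; linarith
  have hd : 0 < d := hb.trans_lt hbd
  refine ⟨(N + 1) / η, fun w hw => ?_⟩
  have ev1 : ∀ᶠ ε in 𝓝[>] (0 : ℝ), rectBoundaryIntegral g (1 / ε) (d * (1 - ε)) < N + 1 :=
    hN.eventually_lt_const (by linarith)
  have ev2 : ∀ᶠ ε in 𝓝[>] (0 : ℝ), 2 * |w.re| + 2 * Real.pi * η + 1 ≤ 1 / ε := by
    simp only [one_div]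
    exact tendsto_inv_nhdsGT_zero.eventually_ge_atTop _
  have ev3 : ∀ᶠ ε in 𝓝[>] (0 : ℝ), b + η < d * (1 - ε) := by
    have : Tendsto (fun ε : ℝ => d * (1 - ε)) (𝓝[>] 0) (𝓝 (d * (1 - 0))) :=
      ((continuous_const.mul (continuous_const.sub continuous_id)).tendsto 0).mono_left
        nhdsWithin_le_nhds
    refine this.eventually_const_lt ?_
    simp only [η]; linarith
  obtain ⟨ε, ⟨h1, h2, h3⟩, hε⟩ := (ev1.and (ev2.and ev3)).and self_mem_nhdsWithin |>.exists
  have hε0 : (0 : ℝ) < ε := hε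
  set a := 1 / ε
  set B := d * (1 - ε)
  have hBd : B < d := by simp only [B]; nlinarith
  have hpi := Real.pi_gt_three
  have ha1 : 1 ≤ a := by nlinarith [abs_nonneg w.re, mul_pos Real.two_pi_pos hη]
  have ha0 : 0 < a := by linarith
  have hP : 2 * Real.pi * η ≤ 2 * a := by nlinarith [abs_nonneg w.re]
  have hP0 : 0 < 2 * a := by linarith
  have hwB : |w.im| < B := by linarith
  obtain ⟨hr1, hr2⟩ := abs_le.1 (show |w.re| ≤ a / 2 by
    nlinarith [mul_pos Real.two_pi_pos hη])
  have hcell := rectIntegral_mul_periodicKernel (P := 2 * a) (c := w) (x₁ := -a) hP0 hBd hwB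
    (by linarith) (by linarith) hg
  rw [show -a + 2 * a = a by ring] at hcell
  have hκ : 1 ≤ 2 * a / η := by
    rw [le_div_iff₀ hη]; nlinarith
  -- the point `w` is in the middle half of the rectangle, hence off the vertical sides by at least a
  -- quarter of the period, and there `periodicExp` has nonpositive real part
  have hcos : ∀ y : ℝ, Real.cos (2 * Real.pi * (((a : ℂ) + y * Complex.I) - w).re / (2 * a)) ≤ 0 := by
    intro y
    have : 2 * Real.pi * (((a : ℂ) + y * Complex.I) - w).re / (2 * a) =
        Real.pi - Real.pi * (w.re / a) := by
      simp; field_simp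
    have h5 : |w.re / a| ≤ 1 / 2 := by
      rw [abs_div, abs_of_pos ha0, div_le_iff₀ ha0]
      exact abs_le.2 ⟨by linarith, by linarith⟩
    obtain ⟨h6, h7⟩ := abs_le.1 h5
    rw [this, Real.cos_pi_sub, neg_nonpos]
    exact Real.cos_nonneg_of_neg_pi_div_two_le_of_le (by nlinarith) (by nlinarith)
  have hver : ∀ y : ℝ, ‖periodicKernel (2 * a) w ((a : ℂ) + y * Complex.I)‖ ≤ 2 * a / η :=
    fun y => (norm_periodicKernel_le_one (hcos y)).trans hκ
  have hver' : ∀ y : ℝ, ‖periodicKernel (2 * a) w (-(a : ℂ) + y * Complex.I)‖ ≤ 2 * a / η := by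
    intro y
    rw [← periodicKernel_add_period hP0]
    convert hver y using 3
    push_cast; ring
  obtain ⟨hi1, hi2⟩ := abs_le.1 hw
  have hmain := norm_rectIntegral_le (g := g) (d := d)
    (G := fun z => g z * periodicKernel (2 * a) w z) (a := a) (b := B) (κ := 2 * a / η)
    hg ha0.le (by linarith) hBd (fun x => ?_) (fun x => ?_) (fun y => ?_) (fun y => ?_)
  · rw [hcell, norm_mul, Complex.norm_real,
      Real.norm_of_nonneg hP0.le] at hmain
    have h5 : 2 * a / η * rectBoundaryIntegral g a B ≤ 2 * a / η * (N + 1) :=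
      mul_le_mul_of_nonneg_left h1.le (by positivity)
    have h6 : 2 * a * ‖g w‖ ≤ 2 * a * ((N + 1) / η) :=
      (hmain.trans h5).trans (le_of_eq (by ring))
    exact le_of_mul_le_mul_left h6 hP0
  all_goals
    rw [norm_mul, mul_comm]
    refine mul_le_mul_of_nonneg_right ?_ (norm_nonneg _)
  · refine norm_periodicKernel_le_of_im hη hP ?_
    rw [le_abs]; right
    simp; linarith
  · refine norm_periodicKernel_le_of_im hη hP ?_
    rw [le_abs]; left
    simp; linarith
  · exact hver y
  · exact hver' y

/-- A function that is bounded on a strip and exponentially small on the real line is small at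
infinity in smaller strips. This is the three lines theorem, applied around each point to the
product with a Gaussian. -/
theorem norm_le_three_lines (hg : DifferentiableOn ℂ g (strip d)) {β M B : ℝ} (hβ : |β| < d)
    (hM : ∀ w : ℂ, |w.im| ≤ |β| → ‖g w‖ ≤ M) (hB : ∀ v : ℝ, ‖g v‖ ≤ B * Real.exp (-|v|))
    (x₀ : ℝ) {s : ℝ} (hs : s ∈ Icc (0 : ℝ) 1) :
    ‖g ((x₀ : ℂ) + (β * s : ℝ) * Complex.I)‖ ≤
      (B * Real.exp 1 * Real.exp (-|x₀|)) ^ (1 - s) * (M * Real.exp (β ^ 2)) ^ s := by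
  have hM0 : 0 ≤ M := (norm_nonneg _).trans (hM 0 (by simp))
  have hB0 : 0 ≤ B := by simpa using (norm_nonneg _).trans (hB 0)
  -- `γ` maps `0 ≤ Re z ≤ 1` onto the strip between the real line and the height `β`; the Gaussian
  -- factor centred at `x₀` localizes the bound on the real line to a neighbourhood of `x₀`
  set γ : ℂ → ℂ := fun z => (x₀ : ℂ) + β * z * Complex.I with hγ
  set F : ℂ → ℂ := fun z => g (γ z) * Complex.exp ((β : ℂ) ^ 2 * z ^ 2) with hF
  have him : ∀ z, (γ z).im = β * z.re := fun z => by simp [hγ]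
  have hexp : ∀ z : ℂ, ‖Complex.exp ((β : ℂ) ^ 2 * z ^ 2)‖ =
      Real.exp (β ^ 2 * (z.re ^ 2 - z.im ^ 2)) := by
    intro z
    rw [Complex.norm_exp]
    congr 1
    rw [← Complex.ofReal_pow, Complex.re_ofReal_mul]
    congr 1
    simp [pow_two]
  have hclosed : ∀ z ∈ Complex.HadamardThreeLines.verticalClosedStrip 0 1, |(γ z).im| ≤ |β| := by
    intro z hz
    have hz' : 0 ≤ z.re ∧ z.re ≤ 1 := hz
    rw [him, abs_mul, abs_of_nonneg hz'.1]
    exact mul_le_of_le_one_right (abs_nonneg _) hz'.2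
  have hbound : ∀ z ∈ Complex.HadamardThreeLines.verticalClosedStrip 0 1,
      ‖F z‖ ≤ M * Real.exp (β ^ 2) := by
    intro z hz
    have hz' : 0 ≤ z.re ∧ z.re ≤ 1 := hz
    simp only [hF]
    rw [norm_mul, hexp]
    refine mul_le_mul (hM _ (hclosed z hz)) (Real.exp_le_exp.2 ?_) (Real.exp_nonneg _) hM0
    have : z.re ^ 2 - z.im ^ 2 ≤ 1 := by nlinarith [sq_nonneg z.im]
    nlinarith [sq_nonneg β]
  have hdiff : DiffContOnCl ℂ F (Complex.HadamardThreeLines.verticalStrip 0 1) := by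
    apply DifferentiableOn.diffContOnCl
    have hcl : closure (Complex.HadamardThreeLines.verticalStrip 0 1) ⊆
        Complex.HadamardThreeLines.verticalClosedStrip 0 1 :=
      closure_minimal (fun z hz => ⟨le_of_lt hz.1, le_of_lt hz.2⟩)
        (isClosed_Icc.preimage Complex.continuous_re)
    intro z hz
    have hzs : γ z ∈ strip d := (hclosed z (hcl hz)).trans_lt hβ
    have h1 : DifferentiableAt ℂ γ z := by simp only [hγ]; fun_prop
    have h2 : DifferentiableAt ℂ (fun z => g (γ z)) z :=
      (hg.differentiableAt ((isOpen_strip d).mem_nhds hzs)).comp z h1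
    exact (h2.mul (by fun_prop)).differentiableWithinAt
  have hmem : (s : ℂ) ∈ Complex.HadamardThreeLines.verticalClosedStrip 0 1 := by
    change (s : ℂ).re ∈ Icc (0 : ℝ) 1
    simpa using hs
  have h3 := Complex.HadamardThreeLines.norm_le_interp_of_mem_verticalClosedStrip' (f := F)
    (z := (s : ℂ)) (a := B * Real.exp 1 * Real.exp (-|x₀|)) (b := M * Real.exp (β ^ 2))
    zero_lt_one hmem hdiff ⟨_, by rintro _ ⟨z, hz, rfl⟩; exact hbound z hz⟩ ?_ ?_
  · simp only [Complex.ofReal_re, sub_zero, div_one] at h3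
    refine le_trans ?_ h3
    simp only [hF]
    rw [norm_mul, hexp]
    have h4 : γ s = (x₀ : ℂ) + (β * s : ℝ) * Complex.I := by simp [hγ]
    rw [h4]
    refine le_mul_of_one_le_right (norm_nonneg _) (Real.one_le_exp ?_)
    rw [Complex.ofReal_re, Complex.ofReal_im, zero_pow two_ne_zero, sub_zero]
    positivity
  · intro z hz
    have hz' : z.re = 0 := hz
    have h4 : γ z = ((x₀ - β * z.im : ℝ) : ℂ) := by
      apply Complex.ext
      · simp [hγ, hz']; ring
      · simp [hγ, hz']
    simp only [hF]
    rw [norm_mul, hexp, h4, hz']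
    calc _ ≤ B * Real.exp (-|x₀ - β * z.im|) * Real.exp (β ^ 2 * (0 ^ 2 - z.im ^ 2)) := by
          gcongr; exact hB _
      _ = B * Real.exp (-|x₀ - β * z.im| + β ^ 2 * (0 ^ 2 - z.im ^ 2)) := by
          rw [mul_assoc, ← Real.exp_add]
      _ ≤ B * Real.exp (1 + -|x₀|) := by
          refine mul_le_mul_of_nonneg_left (Real.exp_le_exp.2 ?_) hB0
          have h5 : |x₀| - |β * z.im| ≤ |x₀ - β * z.im| := abs_sub_abs_le_abs_sub _ _
          have h6 : β ^ 2 * (0 ^ 2 - z.im ^ 2) = -|β * z.im| ^ 2 := by rw [sq_abs]; ring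
          rw [h6]
          nlinarith [sq_nonneg (|β * z.im| - 1 / 2)]
      _ = _ := by rw [Real.exp_add, mul_assoc]
  · intro z hz
    have hz' : z.re = 1 := hz
    exact hbound z ⟨by rw [hz']; exact zero_le_one, by rw [hz']⟩

theorem eventually_norm_le_of_three_lines (hg : DifferentiableOn ℂ g (strip d)) {b b' M B : ℝ}
    (hb' : 0 ≤ b') (hbb : b' < b) (hb : b < d)
    (hM : ∀ w : ℂ, |w.im| ≤ b → ‖g w‖ ≤ M) (hB : ∀ v : ℝ, ‖g v‖ ≤ B * Real.exp (-|v|))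
    {η : ℝ} (hη : 0 < η) :
    ∀ᶠ a : ℝ in atTop, ∀ y : ℝ, |y| ≤ b' →
      ‖g ((a : ℂ) + y * Complex.I)‖ ≤ η ∧ ‖g (-(a : ℂ) + y * Complex.I)‖ ≤ η := by
  have hb0 : 0 < b := hb'.trans_lt hbb
  set s₀ := b' / b
  have hs₀ : s₀ < 1 := (div_lt_one hb0).2 hbb
  have hM0 : 0 ≤ M := (norm_nonneg _).trans (hM 0 (by simpa using hb0.le))
  have hB0 : 0 ≤ B := by simpa using (norm_nonneg _).trans (hB 0)
  set A₁ := (M + 1) * Real.exp (b ^ 2)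
  have hA₁ : 1 ≤ A₁ := by
    have := Real.one_le_exp (sq_nonneg b)
    simp only [A₁]; nlinarith
  have hlim : Tendsto (fun a : ℝ => B * Real.exp 1 * Real.exp (-a)) atTop (𝓝 0) := by
    simpa using (Real.tendsto_exp_neg_atTop_nhds_zero).const_mul (B * Real.exp 1)
  have hlim2 : Tendsto (fun a : ℝ => (B * Real.exp 1 * Real.exp (-a)) ^ (1 - s₀) * A₁) atTop
      (𝓝 0) := by
    have := (hlim.rpow_const (p := 1 - s₀) (Or.inr (by linarith))).mul_const A₁
    rwa [Real.zero_rpow (by linarith), zero_mul] at this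
  filter_upwards [hlim.eventually_le_const one_pos, hlim2.eventually_le_const hη,
    eventually_ge_atTop 0] with a h1 h2 ha y hy
  have key : ∀ x₀ : ℝ, |x₀| = a → ‖g ((x₀ : ℂ) + y * Complex.I)‖ ≤ η := by
    intro x₀ hx₀
    obtain ⟨β, hβ, hβy⟩ : ∃ β : ℝ, |β| = b ∧ β * (|y| / b) = y := by
      rcases le_total 0 y with h | h
      · exact ⟨b, abs_of_pos hb0, by rw [abs_of_nonneg h]; field_simp⟩
      · exact ⟨-b, by rw [abs_neg, abs_of_pos hb0], by rw [abs_of_nonpos h]; field_simp⟩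
    have hs : |y| / b ∈ Icc (0 : ℝ) 1 :=
      ⟨by positivity, (div_le_one hb0).2 (hy.trans hbb.le)⟩
    -- `M + 1`, so that the bound at height `b` is at least `1` and its powers are monotone
    have h3 := norm_le_three_lines hg (by rwa [hβ]) (M := M + 1)
      (fun w hw => (hM w (hβ ▸ hw)).trans (by linarith)) hB x₀ hs
    rw [hβy, hx₀, ← sq_abs β, hβ] at h3
    refine h3.trans (le_trans ?_ h2)
    have h4 : |y| / b ≤ s₀ := by simp only [s₀]; gcongr
    have h5 : A₁ ^ (|y| / b) ≤ A₁ := by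
      simpa using Real.rpow_le_rpow_of_exponent_le hA₁ hs.2
    have h0 : 0 ≤ B * Real.exp 1 * Real.exp (-a) := by positivity
    refine mul_le_mul ?_ h5 (by positivity) (by positivity)
    exact Real.rpow_le_rpow_of_exponent_ge' h0 h1 (by linarith) (by linarith)
  refine ⟨key a (abs_of_nonneg ha), ?_⟩
  have := key (-a) (by rw [abs_neg, abs_of_nonneg ha])
  simpa using this

end Bound

/-! ### The error of the trapezoidal rule -/

theorem sum_Icc_neg_succ (u : ℤ → ℂ) (m : ℕ) :
    ∑ k ∈ Finset.Icc (-((m + 1 : ℕ) : ℤ)) ((m + 1 : ℕ) : ℤ), u k =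
      (∑ k ∈ Finset.Icc (-(m : ℤ)) (m : ℤ), u k) + (u ((m + 1 : ℕ) : ℤ) + u (-((m + 1 : ℕ) : ℤ))) := by
  have h1 : Finset.Icc (-((m + 1 : ℕ) : ℤ)) ((m + 1 : ℕ) : ℤ) =
      insert ((m + 1 : ℕ) : ℤ) (insert (-((m + 1 : ℕ) : ℤ)) (Finset.Icc (-(m : ℤ)) (m : ℤ))) := by
    ext k
    simp only [Finset.mem_Icc, Finset.mem_insert]
    omega
  rw [h1, Finset.sum_insert, Finset.sum_insert]
  · ring
  · simp only [Finset.mem_Icc]; omega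
  · simp only [Finset.mem_Icc, Finset.mem_insert]; omega

/-- The terms that a longer symmetric sum adds to a shorter one. -/
theorem norm_sum_Icc_sub_le (u : ℤ → ℂ) (n₀ J : ℕ) :
    ‖(∑ k ∈ Finset.Icc (-((n₀ + J : ℕ) : ℤ)) ((n₀ + J : ℕ) : ℤ), u k) -
      ∑ k ∈ Finset.Icc (-(n₀ : ℤ)) (n₀ : ℤ), u k‖ ≤
      ∑ j ∈ Finset.range J,
        (‖u ((n₀ + j + 1 : ℕ) : ℤ)‖ + ‖u (-((n₀ + j + 1 : ℕ) : ℤ))‖) := by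
  induction J with
  | zero => simp
  | succ J ih =>
    rw [← add_assoc, sum_Icc_neg_succ, Finset.sum_range_succ, add_sub_right_comm]
    refine (norm_add_le _ _).trans (add_le_add ih (norm_add_le _ _))

theorem rectIntegral_add_adjacent {G : ℂ → ℂ} {b : ℝ}
    (h₁ : Continuous fun x : ℝ => G ((x : ℂ) - b * Complex.I))
    (h₂ : Continuous fun x : ℝ => G ((x : ℂ) + b * Complex.I)) (x₁ x₂ x₃ : ℝ) :
    rectIntegral G x₁ x₂ b + rectIntegral G x₂ x₃ b = rectIntegral G x₁ x₃ b := by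
  unfold rectIntegral
  rw [← intervalIntegral.integral_add_adjacent_intervals (h₁.intervalIntegrable x₁ x₂)
    (h₁.intervalIntegrable x₂ x₃),
    ← intervalIntegral.integral_add_adjacent_intervals (h₂.intervalIntegrable x₁ x₂)
    (h₂.intervalIntegrable x₂ x₃)]
  ring

theorem periodicKernel_int_mul {h : ℝ} (hh : 0 < h) (k : ℤ) :
    periodicKernel h (((k : ℝ) * h : ℝ) : ℂ) = periodicKernel h 0 := by
  have hP' : (h : ℂ) ≠ 0 := by exact_mod_cast hh.ne'
  funext w
  unfold periodicKernel periodicExp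
  have : -(2 * Real.pi * Complex.I) * (w - ((k : ℝ) * h : ℝ)) / h =
      -(2 * Real.pi * Complex.I) * (w - 0) / h + k * (2 * Real.pi * Complex.I) := by
    push_cast; field_simp; ring
  rw [this, Complex.exp_add, Complex.exp_int_mul_two_pi_mul_I, mul_one]

section Trapezoid

variable {g : ℂ → ℂ} {d : ℝ}

/-- The trapezoidal sum as a contour integral. -/
theorem rectIntegral_eq_sum (hg : DifferentiableOn ℂ g (strip d)) {h b : ℝ} (hh : 0 < h)
    (hb : 0 < b) (hbd : b < d) (m : ℕ) :
    rectIntegral (fun w => g w * periodicKernel h 0 w) (-((m + 1 / 2) * h)) ((m + 1 / 2) * h) b =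
      h * ∑ k ∈ Finset.Icc (-(m : ℤ)) (m : ℤ), g (((k : ℝ) * h : ℝ) : ℂ) := by
  have hb' : |b| < d := by rwa [abs_of_pos hb]
  have hc₂ : Continuous fun x : ℝ => g ((x : ℂ) + b * Complex.I) *
      periodicKernel h 0 ((x : ℂ) + b * Complex.I) :=
    (continuous_horizontal hg hb').mul
      (continuous_periodicKernel_horizontal hh (by simpa using hb.ne'))
  have hc₁ : Continuous fun x : ℝ => g ((x : ℂ) - b * Complex.I) *
      periodicKernel h 0 ((x : ℂ) - b * Complex.I) := by
    refine (continuous_horizontal' hg hb').mul ?_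
    have := continuous_periodicKernel_horizontal (P := h) (c := 0) hh (t := -b)
      (by simpa using hb.ne')
    simpa [← sub_eq_add_neg] using this
  -- one cell of the rectangle, of width `h` and centred at a sampling point
  have hcell : ∀ k : ℤ, rectIntegral (fun w => g w * periodicKernel h 0 w) ((k - 1 / 2) * h)
      ((k + 1 / 2) * h) b = h * g (((k : ℝ) * h : ℝ) : ℂ) := by
    intro k
    have := rectIntegral_mul_periodicKernel (P := h) (c := (((k : ℝ) * h : ℝ) : ℂ))
      (x₁ := (k - 1 / 2) * h) hh hbd (by simpa using hb) (by rw [Complex.ofReal_re]; linarith)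
      (by rw [Complex.ofReal_re]; linarith) hg
    rw [periodicKernel_int_mul hh] at this
    rw [← this]
    congr 1
    ring
  induction m with
  | zero =>
    have := hcell 0
    simp only [Int.cast_zero, zero_sub, zero_add, neg_mul] at this
    simpa using this
  | succ m ih =>
    have h1 := hcell ((m + 1 : ℕ) : ℤ)
    have h2 := hcell (-((m + 1 : ℕ) : ℤ))
    rw [sum_Icc_neg_succ fun k : ℤ => g (((k : ℝ) * h : ℝ) : ℂ), mul_add, mul_add, ← ih, ← h1, ← h2]
    push_cast
    have e1 : ((m : ℝ) + 1 - 1 / 2) * h = (m + 1 / 2) * h := by ring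
    have e2 : (-((m : ℝ) + 1) + 1 / 2) * h = -((m + 1 / 2) * h) := by ring
    have e3 : (-((m : ℝ) + 1) - 1 / 2) * h = -((m + 1 + 1 / 2) * h) := by ring
    simp only [e1, e2, e3]
    rw [add_comm (rectIntegral _ ((m + 1 / 2) * h) _ b), ← add_assoc, add_comm (rectIntegral _ _ _ b),
      rectIntegral_add_adjacent hc₁ hc₂, rectIntegral_add_adjacent hc₁ hc₂]

theorem periodicExp_half_int {h : ℝ} (hh : 0 < h) (k : ℤ) (y : ℝ) :
    periodicExp h 0 ((((k + 1 / 2) * h : ℝ) : ℂ) + y * Complex.I) =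
      -(Real.exp (2 * Real.pi * y / h) : ℂ) := by
  have hP' : (h : ℂ) ≠ 0 := by exact_mod_cast hh.ne'
  unfold periodicExp
  have : -(2 * Real.pi * Complex.I) * ((((k + 1 / 2) * h : ℝ) : ℂ) + y * Complex.I - 0) / h =
      ((2 * Real.pi * y / h : ℝ) : ℂ) - Real.pi * Complex.I - k * (2 * Real.pi * Complex.I) := by
    push_cast
    field_simp
    ring_nf
    rw [Complex.I_sq]
    ring
  rw [this, Complex.exp_sub, Complex.exp_sub, Complex.exp_int_mul_two_pi_mul_I,
    Complex.exp_pi_mul_I, Complex.ofReal_exp, div_one, div_neg, div_one]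

theorem periodicKernel_half_int {h : ℝ} (hh : 0 < h) (k : ℤ) (y : ℝ) :
    periodicKernel h 0 ((((k + 1 / 2) * h : ℝ) : ℂ) + y * Complex.I) =
      ((1 + Real.exp (2 * Real.pi * y / h))⁻¹ : ℝ) := by
  rw [periodicKernel, periodicExp_half_int hh, sub_neg_eq_add]
  push_cast; rfl

theorem norm_periodicKernel_half_int_le {h : ℝ} (hh : 0 < h) (k : ℤ) {y : ℝ} (hy : 0 ≤ y) :
    ‖periodicKernel h 0 ((((k + 1 / 2) * h : ℝ) : ℂ) + y * Complex.I)‖ ≤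
      Real.exp (-(2 * Real.pi * |y| / h)) := by
  rw [periodicKernel_half_int hh, Complex.norm_real, Real.norm_of_nonneg (by positivity),
    abs_of_nonneg hy, Real.exp_neg]
  have := Real.exp_pos (2 * Real.pi * y / h)
  exact inv_anti₀ this (by linarith)

theorem norm_periodicKernel_half_int_sub_one_le {h : ℝ} (hh : 0 < h) (k : ℤ) {y : ℝ}
    (hy : y ≤ 0) :
    ‖periodicKernel h 0 ((((k + 1 / 2) * h : ℝ) : ℂ) + y * Complex.I) - 1‖ ≤
      Real.exp (-(2 * Real.pi * |y| / h)) := by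
  rw [periodicKernel_half_int hh, ← Complex.ofReal_one, ← Complex.ofReal_sub, Complex.norm_real,
    abs_of_nonpos hy]
  have he := Real.exp_pos (2 * Real.pi * y / h)
  have : (1 + Real.exp (2 * Real.pi * y / h))⁻¹ - 1 =
      -(Real.exp (2 * Real.pi * y / h) / (1 + Real.exp (2 * Real.pi * y / h))) := by
    field_simp; ring
  rw [this, norm_neg, Real.norm_of_nonneg (by positivity)]
  refine (div_le_self he.le (by linarith)).trans (le_of_eq ?_)
  congr 1; ring

theorem norm_periodicKernel_upper_le {h b : ℝ} (hh : 0 < h) (hb : 0 < b) (x : ℝ) :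
    ‖periodicKernel h 0 ((x : ℂ) + b * Complex.I)‖ ≤
      Real.exp (-(2 * Real.pi * b / h)) / (1 - Real.exp (-(2 * Real.pi * b / h))) := by
  have hq := norm_periodicExp h 0 ((x : ℂ) + b * Complex.I)
  have him : ((x : ℂ) + b * Complex.I - 0).im = b := by simp
  rw [him] at hq
  set s := 2 * Real.pi * b / h
  have hs : 0 < s := by positivity
  have h1 := norm_sub_norm_le (periodicExp h 0 ((x : ℂ) + b * Complex.I)) 1
  rw [norm_one, hq, norm_sub_rev] at h1
  have h2 : 1 < Real.exp s := Real.one_lt_exp_iff.2 hs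
  rw [periodicKernel, norm_inv]
  refine (inv_anti₀ (by linarith) h1).trans (le_of_eq ?_)
  rw [Real.exp_neg]
  have : Real.exp s - 1 ≠ 0 := by linarith
  field_simp

theorem norm_periodicKernel_lower_sub_one_le {h b : ℝ} (hh : 0 < h) (hb : 0 < b) (x : ℝ) :
    ‖periodicKernel h 0 ((x : ℂ) - b * Complex.I) - 1‖ ≤
      Real.exp (-(2 * Real.pi * b / h)) / (1 - Real.exp (-(2 * Real.pi * b / h))) := by
  have hq := norm_periodicExp h 0 ((x : ℂ) - b * Complex.I)
  have him : ((x : ℂ) - b * Complex.I - 0).im = -b := by simp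
  rw [him, mul_neg, neg_div] at hq
  set s := 2 * Real.pi * b / h
  have hs : 0 < s := by positivity
  have h1 := norm_sub_norm_le 1 (periodicExp h 0 ((x : ℂ) - b * Complex.I))
  rw [norm_one, hq] at h1
  have h2 : Real.exp (-s) < 1 := Real.exp_lt_one_iff.2 (by linarith)
  have h3 : 1 - periodicExp h 0 ((x : ℂ) - b * Complex.I) ≠ 0 := by
    rw [← norm_pos_iff]; linarith
  have h4 : periodicKernel h 0 ((x : ℂ) - b * Complex.I) - 1 =
      periodicExp h 0 ((x : ℂ) - b * Complex.I) /
        (1 - periodicExp h 0 ((x : ℂ) - b * Complex.I)) := by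
    rw [periodicKernel]; field_simp; ring
  rw [h4, norm_div, hq]
  exact div_le_div_of_nonneg_left (Real.exp_nonneg _) (by linarith) h1

/-- On a vertical side at a half-integer multiple of `h`, the kernel (above the real axis), and the
kernel minus `1` (below it), are at most `e^{-2π|y|/h}`. -/
theorem norm_vertical_le (hg : DifferentiableOn ℂ g (strip d)) {h b : ℝ} (hh : 0 < h) (hb : 0 < b)
    (hbd : b < d) (k : ℤ) :
    ‖(∫ y in (-b)..b, g ((((k + 1 / 2) * h : ℝ) : ℂ) + y * Complex.I) *
        periodicKernel h 0 ((((k + 1 / 2) * h : ℝ) : ℂ) + y * Complex.I)) -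
      ∫ y in (-b)..0, g ((((k + 1 / 2) * h : ℝ) : ℂ) + y * Complex.I)‖ ≤
    ∫ y in (-b)..b, Real.exp (-(2 * Real.pi * |y| / h)) *
      ‖g ((((k + 1 / 2) * h : ℝ) : ℂ) + y * Complex.I)‖ := by
  set z : ℝ := (k + 1 / 2) * h with hz
  have hgv := continuousOn_vertical hg hbd z
  have hK : Continuous fun y : ℝ => periodicKernel h 0 ((z : ℂ) + y * Complex.I) := by
    simp only [hz, periodicKernel_half_int hh]
    refine Complex.continuous_ofReal.comp (Continuous.inv₀ (by fun_prop) fun y => ?_)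
    have := Real.exp_pos (2 * Real.pi * y / h)
    positivity
  have hsub : ∀ {s t : ℝ}, -b ≤ s → s ≤ t → t ≤ b → uIcc s t ⊆ Icc (-b) b := by
    intro s t h1 h2 h3
    rw [uIcc_of_le h2]
    exact Icc_subset_Icc h1 h3
  have hgi : ∀ {s t : ℝ}, -b ≤ s → s ≤ t → t ≤ b →
      IntervalIntegrable (fun y : ℝ => g ((z : ℂ) + y * Complex.I)) volume s t :=
    fun h1 h2 h3 => (hgv.mono (hsub h1 h2 h3)).intervalIntegrable
  have hgK : ∀ {s t : ℝ}, -b ≤ s → s ≤ t → t ≤ b → IntervalIntegrable (fun y : ℝ =>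
      g ((z : ℂ) + y * Complex.I) * periodicKernel h 0 ((z : ℂ) + y * Complex.I)) volume s t :=
    fun h1 h2 h3 => ((hgv.mono (hsub h1 h2 h3)).mul hK.continuousOn).intervalIntegrable
  have hbi : ∀ {s t : ℝ}, -b ≤ s → s ≤ t → t ≤ b → IntervalIntegrable (fun y : ℝ =>
      Real.exp (-(2 * Real.pi * |y| / h)) * ‖g ((z : ℂ) + y * Complex.I)‖) volume s t :=
    fun h1 h2 h3 => ((Continuous.continuousOn (by fun_prop)).mul
      (hgv.mono (hsub h1 h2 h3)).norm).intervalIntegrable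
  have hnb : -b ≤ 0 := by linarith
  have e : (∫ y in (-b)..b, g ((z : ℂ) + y * Complex.I) *
        periodicKernel h 0 ((z : ℂ) + y * Complex.I)) -
      ∫ y in (-b)..0, g ((z : ℂ) + y * Complex.I) =
      (∫ y in (-b)..0, g ((z : ℂ) + y * Complex.I) *
        (periodicKernel h 0 ((z : ℂ) + y * Complex.I) - 1)) +
      ∫ y in (0 : ℝ)..b, g ((z : ℂ) + y * Complex.I) *
        periodicKernel h 0 ((z : ℂ) + y * Complex.I) := by
    simp_rw [mul_sub, mul_one]
    rw [← intervalIntegral.integral_add_adjacent_intervals (hgK le_rfl hnb hb.le)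
      (hgK hnb hb.le le_rfl), intervalIntegral.integral_sub (hgK le_rfl hnb hb.le)
      (hgi le_rfl hnb hb.le)]
    ring
  rw [e, ← intervalIntegral.integral_add_adjacent_intervals (hbi le_rfl hnb hb.le)
      (hbi hnb hb.le le_rfl)]
  refine (norm_add_le _ _).trans (add_le_add ?_ ?_)
  · refine intervalIntegral.norm_integral_le_of_norm_le hnb (Eventually.of_forall fun y hy => ?_)
      (hbi le_rfl hnb hb.le)
    rw [norm_mul, mul_comm]
    exact mul_le_mul_of_nonneg_right (norm_periodicKernel_half_int_sub_one_le hh k hy.2)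
      (norm_nonneg _)
  · refine intervalIntegral.norm_integral_le_of_norm_le hb.le (Eventually.of_forall fun y hy => ?_)
      (hbi hnb hb.le le_rfl)
    rw [norm_mul, mul_comm]
    exact mul_le_mul_of_nonneg_right (norm_periodicKernel_half_int_le hh k hy.1.le)
      (norm_nonneg _)

/-- The truncated trapezoidal error, bounded by integrals over the boundary of a rectangle. -/
theorem norm_sum_sub_integral_le (hg : DifferentiableOn ℂ g (strip d)) {h b a : ℝ} (hh : 0 < h)
    (hb : 0 < b) (hbd : b < d) (m : ℕ) (ha : a = (m + 1 / 2) * h) :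
    ‖h * (∑ k ∈ Finset.Icc (-(m : ℤ)) (m : ℤ), g (((k : ℝ) * h : ℝ) : ℂ)) -
      ∫ x in (-a)..a, g (x : ℂ)‖ ≤
      Real.exp (-(2 * Real.pi * b / h)) / (1 - Real.exp (-(2 * Real.pi * b / h))) *
        ((∫ x in (-a)..a, ‖g ((x : ℂ) + b * Complex.I)‖) +
          ∫ x in (-a)..a, ‖g ((x : ℂ) - b * Complex.I)‖) +
      ((∫ y in (-b)..b, Real.exp (-(2 * Real.pi * |y| / h)) * ‖g ((a : ℂ) + y * Complex.I)‖) +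
        ∫ y in (-b)..b, Real.exp (-(2 * Real.pi * |y| / h)) * ‖g (-(a : ℂ) + y * Complex.I)‖) := by
  have hb' : |b| < d := by rwa [abs_of_pos hb]
  have hd : 0 < d := hb.trans hbd
  have ha0 : 0 < a := by rw [ha]; positivity
  have hlea : -a ≤ a := by linarith
  have hsum := rectIntegral_eq_sum hg hh hb hbd m
  rw [← ha] at hsum
  have hlow : (∫ x in (-a)..a, g ((x : ℂ) - b * Complex.I)) - (∫ x in (-a)..a, g (x : ℂ)) +
      Complex.I * (∫ y in (-b)..0, g ((a : ℂ) + y * Complex.I)) -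
      Complex.I * (∫ y in (-b)..0, g (-(a : ℂ) + y * Complex.I)) = 0 := by
    have := Complex.integral_boundary_rect_eq_zero_of_differentiableOn g ⟨-a, -b⟩ ⟨a, 0⟩
      (hg.mono fun w hw => ?_)
    · simp only [smul_eq_mul] at this
      simpa [← sub_eq_add_neg] using this
    · have h2 := hw.2
      simp only [mem_preimage, uIcc_of_le (neg_nonpos.2 hb.le), mem_Icc] at h2
      exact (abs_le.2 ⟨h2.1, h2.2.trans hb.le⟩).trans_lt hbd
  have hK₁ : Continuous fun x : ℝ => periodicKernel h 0 ((x : ℂ) - b * Complex.I) := by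
    have := continuous_periodicKernel_horizontal (P := h) (c := 0) hh (t := -b)
      (by simpa using hb.ne')
    simpa [← sub_eq_add_neg] using this
  have hg₁ := continuous_horizontal' hg hb'
  -- move the integral over `[-a, a]` to the lower half of the boundary of the rectangle
  have e : h * (∑ k ∈ Finset.Icc (-(m : ℤ)) (m : ℤ), g (((k : ℝ) * h : ℝ) : ℂ)) -
      ∫ x in (-a)..a, g (x : ℂ) =
      (∫ x in (-a)..a, g ((x : ℂ) - b * Complex.I) *
          (periodicKernel h 0 ((x : ℂ) - b * Complex.I) - 1)) -
        (∫ x in (-a)..a, g ((x : ℂ) + b * Complex.I) *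
          periodicKernel h 0 ((x : ℂ) + b * Complex.I)) +
        Complex.I * ((∫ y in (-b)..b, g ((a : ℂ) + y * Complex.I) *
          periodicKernel h 0 ((a : ℂ) + y * Complex.I)) -
          ∫ y in (-b)..0, g ((a : ℂ) + y * Complex.I)) -
        Complex.I * ((∫ y in (-b)..b, g (-(a : ℂ) + y * Complex.I) *
          periodicKernel h 0 (-(a : ℂ) + y * Complex.I)) -
          ∫ y in (-b)..0, g (-(a : ℂ) + y * Complex.I)) := by
    rw [← hsum]
    simp_rw [mul_sub (g _), mul_one]
    have hgK : Continuous fun x : ℝ => g ((x : ℂ) - b * Complex.I) *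
        periodicKernel h 0 ((x : ℂ) - b * Complex.I) := hg₁.mul hK₁
    rw [intervalIntegral.integral_sub (hgK.intervalIntegrable _ _)
      (hg₁.intervalIntegrable _ _)]
    unfold rectIntegral
    rw [Complex.ofReal_neg]
    linear_combination hlow
  have hv1 := norm_vertical_le hg hh hb hbd (m : ℤ)
  have hv2 := norm_vertical_le hg hh hb hbd (-(m : ℤ) - 1)
  have ea : (((m : ℤ) : ℝ) + 1 / 2) * h = a := by rw [ha]; push_cast; ring
  have ea' : (((-(m : ℤ) - 1 : ℤ) : ℝ) + 1 / 2) * h = -a := by rw [ha]; push_cast; ring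
  rw [ea] at hv1
  rw [ea', Complex.ofReal_neg] at hv2
  set ρ := Real.exp (-(2 * Real.pi * b / h)) / (1 - Real.exp (-(2 * Real.pi * b / h)))
  have h1 : ‖∫ x in (-a)..a, g ((x : ℂ) - b * Complex.I) *
          (periodicKernel h 0 ((x : ℂ) - b * Complex.I) - 1)‖ ≤
      ρ * ∫ x in (-a)..a, ‖g ((x : ℂ) - b * Complex.I)‖ := by
    rw [← intervalIntegral.integral_const_mul]
    refine intervalIntegral.norm_integral_le_of_norm_le hlea (Eventually.of_forall fun x _ => ?_)
      ((hg₁.norm.intervalIntegrable _ _).const_mul _)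
    rw [norm_mul, mul_comm]
    exact mul_le_mul_of_nonneg_right (norm_periodicKernel_lower_sub_one_le hh hb x) (norm_nonneg _)
  have h2 : ‖∫ x in (-a)..a, g ((x : ℂ) + b * Complex.I) *
          periodicKernel h 0 ((x : ℂ) + b * Complex.I)‖ ≤
      ρ * ∫ x in (-a)..a, ‖g ((x : ℂ) + b * Complex.I)‖ := by
    rw [← intervalIntegral.integral_const_mul]
    refine intervalIntegral.norm_integral_le_of_norm_le hlea (Eventually.of_forall fun x _ => ?_)
      (((continuous_horizontal hg hb').norm.intervalIntegrable _ _).const_mul _)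
    rw [norm_mul, mul_comm]
    exact mul_le_mul_of_nonneg_right (norm_periodicKernel_upper_le hh hb x) (norm_nonneg _)
  rw [e, mul_add]
  refine (norm_sub_le _ _).trans ?_
  rw [← add_assoc]
  refine add_le_add ((norm_add_le _ _).trans (add_le_add ((norm_sub_le _ _).trans ?_) ?_)) ?_
  · linarith
  · rw [norm_mul, Complex.norm_I, one_mul]; exact hv1
  · rw [norm_mul, Complex.norm_I, one_mul]; exact hv2

end Trapezoid

/-! ### The full trapezoidal sum -/

section Limit

variable {g : ℂ → ℂ} {d : ℝ}

/-- The bound of the kernel at height `b`. It is the factor `e^{-2πb/h} / (1 - e^{-2πb/h})` of the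
discretization error. -/
noncomputable def kernelBound (h b : ℝ) : ℝ :=
  Real.exp (-(2 * Real.pi * b / h)) / (1 - Real.exp (-(2 * Real.pi * b / h)))

theorem exp_lt_one_of_pos {h b : ℝ} (hh : 0 < h) (hb : 0 < b) :
    Real.exp (-(2 * Real.pi * b / h)) < 1 := by
  rw [Real.exp_lt_one_iff, neg_lt_zero]
  positivity

theorem exp_le_kernelBound {h b : ℝ} (hh : 0 < h) (hb : 0 < b) :
    Real.exp (-(2 * Real.pi * b / h)) ≤ kernelBound h b := by
  have h1 := exp_lt_one_of_pos hh hb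
  have h2 := Real.exp_pos (-(2 * Real.pi * b / h))
  exact le_div_self h2.le (by linarith) (by linarith)

theorem kernelBound_anti {h b b' : ℝ} (hh : 0 < h) (hb' : 0 < b') (hbb : b' ≤ b) :
    kernelBound h b ≤ kernelBound h b' := by
  have h1 := exp_lt_one_of_pos hh hb'
  have h2 : Real.exp (-(2 * Real.pi * b / h)) ≤ Real.exp (-(2 * Real.pi * b' / h)) := by
    gcongr
  exact div_le_div₀ (Real.exp_nonneg _) h2 (by linarith) (by linarith)

theorem continuousAt_kernelBound {h b : ℝ} (hh : 0 < h) (hb : 0 < b) :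
    ContinuousAt (kernelBound h) b := by
  have h1 := exp_lt_one_of_pos hh hb
  unfold kernelBound
  exact ContinuousAt.div (by fun_prop) (by fun_prop) (by linarith)

/-- On the vertical sides the weight is small for large `|y|`, and `g` is small for the other `y`. -/
theorem integral_vertical_le (hg : DifferentiableOn ℂ g (strip d)) {h b b' η : ℝ} (hh : 0 < h)
    (hb' : 0 < b') (hbb : b' ≤ b) (hbd : b < d) (hη : 0 ≤ η) (z : ℝ)
    (hz : ∀ y : ℝ, |y| ≤ b' → ‖g ((z : ℂ) + y * Complex.I)‖ ≤ η) :
    ∫ y in (-b)..b, Real.exp (-(2 * Real.pi * |y| / h)) * ‖g ((z : ℂ) + y * Complex.I)‖ ≤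
      kernelBound h b' * (∫ y in (-b)..b, ‖g ((z : ℂ) + y * Complex.I)‖) + 2 * d * η := by
  have hleb : -b ≤ b := by linarith
  have hgv : ContinuousOn (fun y : ℝ => g ((z : ℂ) + y * Complex.I)) (uIcc (-b) b) := by
    rw [uIcc_of_le hleb]; exact continuousOn_vertical hg hbd z
  have hρ : 0 ≤ kernelBound h b' := (Real.exp_nonneg _).trans (exp_le_kernelBound hh hb')
  have hi : IntervalIntegrable (fun y : ℝ => ‖g ((z : ℂ) + y * Complex.I)‖) volume (-b) b :=
    hgv.norm.intervalIntegrable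
  have h1 : ∫ y in (-b)..b, Real.exp (-(2 * Real.pi * |y| / h)) * ‖g ((z : ℂ) + y * Complex.I)‖ ≤
      ∫ y in (-b)..b, (kernelBound h b' * ‖g ((z : ℂ) + y * Complex.I)‖ + η) := by
    refine intervalIntegral.integral_mono_on hleb
      (ContinuousOn.intervalIntegrable ((Continuous.continuousOn (by fun_prop)).mul hgv.norm))
      ((hi.const_mul _).add intervalIntegrable_const) fun y _ => ?_
    have hn := norm_nonneg (g ((z : ℂ) + y * Complex.I))
    rcases le_total |y| b' with hy | hy
    · have h3 : Real.exp (-(2 * Real.pi * |y| / h)) ≤ 1 := by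
        rw [Real.exp_le_one_iff, neg_nonpos]; positivity
      nlinarith [hz y hy]
    · have h3 : Real.exp (-(2 * Real.pi * |y| / h)) ≤ Real.exp (-(2 * Real.pi * b' / h)) := by
        gcongr
      have h4 := mul_le_mul_of_nonneg_right (h3.trans (exp_le_kernelBound hh hb')) hn
      linarith
  refine h1.trans ?_
  rw [intervalIntegral.integral_add (hi.const_mul _) intervalIntegrable_const,
    intervalIntegral.integral_const_mul, intervalIntegral.integral_const, smul_eq_mul]
  nlinarith

/-- The trapezoidal error over a long interval is controlled by the boundary norm. The same `η` measures
the distance of the height from `d`, the size of `g` on the vertical sides up to that height, and the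
excess of the boundary integral over its limit. -/
theorem eventually_norm_sum_sub_integral_le (hg : DifferentiableOn ℂ g (strip d)) (hd : 0 < d)
    {N B h η : ℝ} (hN : HasBoundaryNorm g d N) (hB : ∀ v : ℝ, ‖g v‖ ≤ B * Real.exp (-|v|))
    (hh : 0 < h) (hη : 0 < η) (hηd : η < d) :
    ∀ᶠ m : ℕ in atTop, ‖h * (∑ k ∈ Finset.Icc (-(m : ℤ)) (m : ℤ), g (((k : ℝ) * h : ℝ) : ℂ)) -
      ∫ x in (-((m + 1 / 2) * h))..((m + 1 / 2) * h), g (x : ℂ)‖ ≤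
      kernelBound h (d - η) * (N + η) + 4 * d * η := by
  have hb' : 0 < d - η := by linarith
  have hρ : 0 ≤ kernelBound h (d - η) := (Real.exp_nonneg _).trans (exp_le_kernelBound hh hb')
  obtain ⟨M, hM⟩ := exists_bound_substrip hg hN (b := d - η / 2) (by linarith) (by linarith)
  have hatop : Tendsto (fun m : ℕ => ((m : ℝ) + 1 / 2) * h) atTop atTop :=
    (tendsto_atTop_add_const_right _ _ tendsto_natCast_atTop_atTop).atTop_mul_const hh
  have hε : Tendsto (fun m : ℕ => (((m : ℝ) + 1 / 2) * h)⁻¹) atTop (𝓝[>] 0) :=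
    tendsto_inv_atTop_nhdsGT_zero.comp hatop
  have hbt : Tendsto (fun m : ℕ => d * (1 - (((m : ℝ) + 1 / 2) * h)⁻¹)) atTop (𝓝 (d * (1 - 0))) :=
    ((hε.mono_right nhdsWithin_le_nhds).const_sub 1).const_mul d
  rw [sub_zero, mul_one] at hbt
  filter_upwards [hbt.eventually_const_le (show d - η < d by linarith),
    (hN.comp hε).eventually_le_const (show N < N + η by linarith),
    hatop.eventually (eventually_norm_le_of_three_lines hg hb'.le
      (show d - η < d - η / 2 by linarith) (by linarith) hM hB hη)] with m h1 h2 h3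
  -- with `ε = 1 / a`, the rectangle of the boundary norm has its vertical sides at `± a`
  rw [Function.comp_apply, one_div, inv_inv] at h2
  set a := ((m : ℝ) + 1 / 2) * h with ha
  set b := d * (1 - a⁻¹)
  have ha0 : 0 < a := by positivity
  have hbd : b < d := by
    have := inv_pos.2 ha0
    simp only [b]; nlinarith
  have hb0 : 0 < b := by linarith
  have hmain := norm_sum_sub_integral_le hg hh hb0 hbd m ha
  have hv1 := integral_vertical_le hg hh hb' h1 hbd hη.le a fun y hy => (h3 y hy).1
  have hv2 := integral_vertical_le hg hh hb' h1 hbd hη.le (-a) fun y hy => by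
    rw [Complex.ofReal_neg]; exact (h3 y hy).2
  rw [Complex.ofReal_neg] at hv2
  have hlea : -a ≤ a := by linarith
  have hpos : 0 ≤ (∫ x in (-a)..a, ‖g ((x : ℂ) + b * Complex.I)‖) +
      ∫ x in (-a)..a, ‖g ((x : ℂ) - b * Complex.I)‖ :=
    add_nonneg (intervalIntegral.integral_nonneg hlea fun _ _ => norm_nonneg _)
      (intervalIntegral.integral_nonneg hlea fun _ _ => norm_nonneg _)
  have hhor := mul_le_mul_of_nonneg_right (kernelBound_anti hh hb' h1) hpos
  have hbdry := mul_le_mul_of_nonneg_left h2 hρ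
  refine hmain.trans ?_
  rw [← kernelBound]
  simp only [rectBoundaryIntegral] at hbdry
  linarith

/-- The error of the trapezoidal rule for a function on a strip with finite boundary norm, with the
truncation error `τ`. -/
theorem norm_integral_sub_sum_le (hg : DifferentiableOn ℂ g (strip d)) (hd : 0 < d)
    {N B h τ : ℝ} (hN : HasBoundaryNorm g d N) (hB : ∀ v : ℝ, ‖g v‖ ≤ B * Real.exp (-|v|))
    (hint : Integrable fun v : ℝ => g v) (hh : 0 < h) (n₀ : ℕ)
    (hτ : ∀ J : ℕ, h * ∑ j ∈ Finset.range J, (‖g (((n₀ + j + 1 : ℕ) * h : ℝ) : ℂ)‖ +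
      ‖g ((-((n₀ + j + 1 : ℕ) * h) : ℝ) : ℂ)‖) ≤ τ) :
    ‖(∫ v : ℝ, g v) -
      h * ∑ k ∈ Finset.Icc (-(n₀ : ℤ)) (n₀ : ℤ), g (((k : ℝ) * h : ℝ) : ℂ)‖ ≤
      N * kernelBound h d + τ := by
  have hatop : Tendsto (fun m : ℕ => ((m : ℝ) + 1 / 2) * h) atTop atTop :=
    (tendsto_atTop_add_const_right _ _ tendsto_natCast_atTop_atTop).atTop_mul_const hh
  have hlim : Tendsto (fun m : ℕ => ∫ v in (-((m + 1 / 2) * h))..((m + 1 / 2) * h), g (v : ℂ))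
      atTop (𝓝 (∫ v : ℝ, g v)) :=
    intervalIntegral_tendsto_integral hint (tendsto_neg_atTop_atBot.comp hatop) hatop
  set T : ℂ := h * ∑ k ∈ Finset.Icc (-(n₀ : ℤ)) (n₀ : ℤ), g (((k : ℝ) * h : ℝ) : ℂ)
  have key : ∀ η : ℝ, 0 < η → η < d →
      ‖(∫ v : ℝ, g v) - T‖ ≤ η + (kernelBound h (d - η) * (N + η) + 4 * d * η) + τ := by
    intro η hη hηd
    have e1 : ∀ᶠ m : ℕ in atTop, ‖(∫ v : ℝ, g v) -
        ∫ v in (-((m + 1 / 2) * h))..((m + 1 / 2) * h), g (v : ℂ)‖ < η := by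
      filter_upwards [hlim (Metric.ball_mem_nhds _ hη)] with m hm
      rw [← dist_eq_norm, dist_comm]; exact hm
    obtain ⟨m, ⟨h1, h2⟩, h3⟩ := ((e1.and
      (eventually_norm_sum_sub_integral_le hg hd hN hB hh hη hηd)).and
      (eventually_ge_atTop n₀)).exists
    obtain ⟨J, rfl⟩ := Nat.exists_eq_add_of_le h3
    have h4 : ‖h * (∑ k ∈ Finset.Icc (-((n₀ + J : ℕ) : ℤ)) ((n₀ + J : ℕ) : ℤ),
        g (((k : ℝ) * h : ℝ) : ℂ)) - T‖ ≤ τ := by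
      rw [← mul_sub, norm_mul, Complex.norm_real, Real.norm_of_nonneg hh.le]
      refine le_trans (mul_le_mul_of_nonneg_left (norm_sum_Icc_sub_le
        (fun k : ℤ => g (((k : ℝ) * h : ℝ) : ℂ)) n₀ J) hh.le) (le_trans (le_of_eq ?_) (hτ J))
      simp only [Int.cast_natCast, Int.cast_neg, neg_mul]
    rw [norm_sub_rev] at h2
    refine (norm_sub_le_norm_sub_add_norm_sub _
      (∫ v in (-(((n₀ + J : ℕ) + 1 / 2) * h))..(((n₀ + J : ℕ) + 1 / 2) * h), g (v : ℂ)) _).trans ?_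
    have h5 := norm_sub_le_norm_sub_add_norm_sub
      (∫ v in (-(((n₀ + J : ℕ) + 1 / 2) * h))..(((n₀ + J : ℕ) + 1 / 2) * h), g (v : ℂ))
      (h * (∑ k ∈ Finset.Icc (-((n₀ + J : ℕ) : ℤ)) ((n₀ + J : ℕ) : ℤ),
        g (((k : ℝ) * h : ℝ) : ℂ))) T
    linarith
  have hcont : Tendsto (fun η : ℝ => η + (kernelBound h (d - η) * (N + η) + 4 * d * η) + τ)
      (𝓝[>] 0) (𝓝 (0 + (kernelBound h (d - 0) * (N + 0) + 4 * d * 0) + τ)) := by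
    have hk : ContinuousAt (fun η : ℝ => kernelBound h (d - η)) 0 :=
      ContinuousAt.comp (g := kernelBound h) (f := fun η : ℝ => d - η)
        (by rw [sub_zero]; exact continuousAt_kernelBound hh hd) (by fun_prop)
    have : ContinuousAt (fun η : ℝ => η + (kernelBound h (d - η) * (N + η) + 4 * d * η) + τ) 0 := by
      fun_prop
    exact this.tendsto.mono_left nhdsWithin_le_nhds
  refine (ge_of_tendsto hcont ?_).trans (le_of_eq (by rw [sub_zero]; ring))
  filter_upwards [Ioo_mem_nhdsGT hd] with η hη using key η hη.1 hη.2

end Limit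

/-! ### The error bound -/

theorem transformedIntegrand_ofReal {n : ℕ} {f Φ : ℂ → ℂ} {φ : ℝ → ℂ} {ψ χ : ℝ → ℝ} {d : ℝ}
    (hχ : SmoothChange ψ χ) (hd : 0 < d) (hΦ : AnalyticOnNhd ℂ Φ (strip d))
    (hΦφ : ∀ v : ℝ, Φ (v : ℂ) = φ (ψ v)) (v : ℝ) :
    transformedIntegrand n f Φ v = (φ (ψ v)) ^ (-(n : ℤ)) * f (φ (ψ v)) *
      Complex.log (-φ (ψ v)) * deriv φ (ψ v) * ((deriv ψ v : ℝ) : ℂ) := by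
  rw [transformedIntegrand, ← hχ.deriv_path_mul hd hΦ hΦφ, hΦφ, mul_assoc]
  ring

/-- The approximation is a truncated trapezoidal sum for the transformed integrand. -/
theorem deApprox_eq {n : ℕ} {f Φ : ℂ → ℂ} {φ : ℝ → ℂ} {ψ χ : ℝ → ℝ} {d : ℝ}
    (hχ : SmoothChange ψ χ) (hd : 0 < d) (hΦ : AnalyticOnNhd ℂ Φ (strip d))
    (hΦφ : ∀ v : ℝ, Φ (v : ℂ) = φ (ψ v)) (h : ℝ) (m : ℕ) :
    deApprox n f φ ψ h m m = (2 * (Real.pi : ℂ) * Complex.I)⁻¹ *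
      (h * ∑ k ∈ Finset.Icc (-(m : ℤ)) (m : ℤ),
        transformedIntegrand n f Φ (((k : ℝ) * h : ℝ) : ℂ)) := by
  simp_rw [transformedIntegrand_ofReal hχ hd hΦ hΦφ]
  rw [deApprox, ← mul_assoc, div_eq_inv_mul]

/-- The samples beyond `N'`, summed with the weight `h`, in terms of a bound of the integrand. -/
theorem exists_truncation_bound {g : ℂ → ℂ} {A c₁ c₂ : ℝ} (hA : 0 < A) (hc₁ : 0 < c₁) (hc₂ : 0 < c₂)
    (hg : ∀ v : ℝ, ‖g v‖ ≤ A * ((1 + |v|) * Real.exp (-c₁ * Real.exp (c₂ * |v|)))) :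
    ∃ C > 0, ∀ h : ℝ, 0 < h → ∀ m J : ℕ,
      h * ∑ j ∈ Finset.range J, (‖g (((m + j + 1 : ℕ) * h : ℝ) : ℂ)‖ +
        ‖g ((-((m + j + 1 : ℕ) * h) : ℝ) : ℂ)‖) ≤
      C * Real.exp (-c₁ * Real.exp (c₂ * m * h)) := by
  obtain ⟨C, hC, htail⟩ := exists_tail_bound hc₁ hc₂
  refine ⟨2 * A * C, by positivity, fun h hh m J => ?_⟩
  have h1 := htail h hh (m * h) (by positivity) J
  set E : ℝ → ℝ := fun v => (1 + v) * Real.exp (-c₁ * Real.exp (c₂ * v)) with hE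
  have hterm : ∀ j : ℕ, ‖g (((m + j + 1 : ℕ) * h : ℝ) : ℂ)‖ +
      ‖g ((-((m + j + 1 : ℕ) * h) : ℝ) : ℂ)‖ ≤ 2 * A * E (m * h + (j + 1) * h) := by
    intro j
    have e : (((m + j + 1 : ℕ) : ℝ)) * h = m * h + (j + 1) * h := by push_cast; ring
    have h0 : 0 ≤ (m : ℝ) * h + (j + 1) * h := by positivity
    have h2 := hg (m * h + (j + 1) * h)
    have h3 := hg (-(m * h + (j + 1) * h))
    rw [abs_neg] at h3
    rw [abs_of_nonneg h0] at h2 h3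
    rw [e]
    simp only [hE]
    linarith
  calc _ ≤ h * ∑ j ∈ Finset.range J, 2 * A * E (m * h + (j + 1) * h) := by
        gcongr with j
        exact hterm j
    _ = 2 * A * (h * ∑ j ∈ Finset.range J, E (m * h + (j + 1) * h)) := by
        rw [← Finset.mul_sum]; ring
    _ ≤ 2 * A * (C * Real.exp (-c₁ * Real.exp (c₂ * (m * h)))) := by gcongr
    _ = _ := by rw [mul_assoc c₂, mul_assoc (2 * A)]

theorem theorem2
    (n : ℕ) (hn : 1 ≤ n) (f : ℂ → ℂ)
    -- `f` is analytic on `D ⊇ [0, +∞)`, and `f(z) = O(|z|^(n-1-α))` as `z → ∞` in `D`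
    (D : Set ℂ) (hD : IsOpen D) (hrayD : nonnegRay ⊆ D) (hfD : AnalyticOnNhd ℂ f D)
    (α : ℝ) (hα : 0 < α)
    (hgrowth : f =O[Bornology.cobounded ℂ ⊓ 𝓟 D] fun z : ℂ => ‖z‖ ^ ((n : ℝ) - 1 - α))
    -- the path `C`, parametrized by `φ`, and the DE transform `ψ`
    (φ : ℝ → ℂ) (hφ : EncirclesRay D φ)
    (ψ : ℝ → ℝ) (hψ : IsDETransform ψ)
    -- `Φ = φ ∘ ψ` is analytic in the strip and maps it into `ℂ ∖ [0, +∞)`, where `f` is analytic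
    (d : ℝ) (hd : 0 < d) (Φ : ℂ → ℂ) (hΦ : AnalyticOnNhd ℂ Φ (strip d))
    (hΦφ : ∀ v : ℝ, Φ (v : ℂ) = φ (ψ v))
    (hΦray : ∀ w ∈ strip d, Φ w ∉ nonnegRay)
    (hfΦ : ∀ w ∈ strip d, AnalyticAt ℂ f (Φ w))
    -- the boundary norm is finite
    (N : ℝ) (hN : HasBoundaryNorm (transformedIntegrand n f Φ) d N)
    -- double exponential decay
    (C₀ c₁ c₂ : ℝ) (hC₀ : 0 < C₀) (hc₁ : 0 < c₁) (hc₂ : 0 < c₂)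
    (hdecay : ∀ v : ℝ, ‖f (φ (ψ v))‖ ≤ C₀ * Real.exp (-c₁ * Real.exp (c₂ * |v|))) :
    ∃ I : ℂ, HasFinitePart n f I ∧
      ∃ C : ℝ, 0 < C ∧ ∀ h : ℝ, 0 < h → ∀ N' : ℕ,
        ‖I - deApprox n f φ ψ h N' N'‖ ≤
          1 / (2 * Real.pi) * N *
              (Real.exp (-2 * Real.pi * d / h) / (1 - Real.exp (-2 * Real.pi * d / h)))
            + C * Real.exp (-c₁ * Real.exp (c₂ * N' * h)) := by
  obtain ⟨χ, hχ⟩ := hψ.exists_smoothChange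
  set g := transformedIntegrand n f Φ with hgdef
  have hgd : DifferentiableOn ℂ g (strip d) := fun w hw =>
    (analyticAt_transformedIntegrand (hΦ w hw) (hΦray w hw)
      (hfΦ w hw)).differentiableAt.differentiableWithinAt
  have hφc : Continuous φ :=
    continuous_iff_continuousAt.2 fun u => (hχ.hasDerivAt_path hd hΦ hΦφ u).continuousAt
  obtain ⟨δ, hδ, hδφ⟩ := exists_pos_le_norm_path hφc
    (fun u => ne_zero_of_notMem_nonnegRay (hφ.avoids u)) hφ.start_infinity hφ.end_infinity
  obtain ⟨K, hK, hgK⟩ := exists_bound_transformedIntegrand (f := f) hn hd hΦ hΦray hδ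
    fun v => by rw [hΦφ]; exact hδφ _
  have hgE : ∀ v : ℝ, ‖g v‖ ≤
      K * C₀ * ((1 + |v|) * Real.exp (-c₁ * Real.exp (c₂ * |v|))) := by
    intro v
    have h1 := hdecay v
    rw [← hΦφ] at h1
    calc ‖g v‖ ≤ K * (1 + |v|) * ‖f (Φ v)‖ := hgK v
      _ ≤ K * (1 + |v|) * (C₀ * Real.exp (-c₁ * Real.exp (c₂ * |v|))) := by gcongr
      _ = _ := by ring
  obtain ⟨B, hB, hBE⟩ := one_add_mul_exp_le hc₁ hc₂
  have hgB : ∀ v : ℝ, ‖g v‖ ≤ K * C₀ * B * Real.exp (-|v|) := by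
    intro v
    refine (hgE v).trans ?_
    rw [mul_assoc (K * C₀)]
    exact mul_le_mul_of_nonneg_left (hBE _ (abs_nonneg v)) (by positivity)
  have hgc : Continuous fun v : ℝ => g v :=
    hgd.continuousOn.comp_continuous Complex.continuous_ofReal (ofReal_mem_strip hd)
  have hint : Integrable fun v : ℝ => g v :=
    (integrable_exp_neg_abs.const_mul (K * C₀ * B)).mono' hgc.aestronglyMeasurable
      (Eventually.of_forall hgB)
  obtain ⟨I, hI, hIg⟩ :=
    exists_hasFinitePart_eq_integral hn hD hrayD hfD hα hgrowth hφ hχ hd hΦ hΦφ hint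
  obtain ⟨C, hC, htrunc⟩ := exists_truncation_bound (by positivity : 0 < K * C₀) hc₁ hc₂ hgE
  refine ⟨I, hI, 1 / (2 * Real.pi) * C, by positivity, fun h hh m => ?_⟩
  have hmain := norm_integral_sub_sum_le hgd hd hN hgB hint hh m (htrunc h hh m)
  have hpi : (2 * (Real.pi : ℂ) * Complex.I) ≠ 0 := Complex.two_pi_I_ne_zero
  have hIe : I = (2 * (Real.pi : ℂ) * Complex.I)⁻¹ * ∫ v : ℝ, g v := by
    rw [hIg, inv_mul_cancel_left₀ hpi]
  have hnorm : ‖(2 * (Real.pi : ℂ) * Complex.I)⁻¹‖ = 1 / (2 * Real.pi) := by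
    simp [abs_of_pos Real.pi_pos]
  rw [deApprox_eq hχ hd hΦ hΦφ, ← hgdef, hIe, ← mul_sub, norm_mul, hnorm]
  refine (mul_le_mul_of_nonneg_left hmain (by positivity)).trans (le_of_eq ?_)
  rw [kernelBound, show -(2 * Real.pi * d / h) = -2 * Real.pi * d / h by ring]
  ring
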